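/- Let $D\subseteq\mathbb C$ be a Jordan domain (a bounded domain whose boundary is a Jordan curve), let $\varphi$ be a conformal transformation of the open unit disk $\mathbf D$ onto $D$, and let $\mathcal W$ be a Whitney cube decomposition of $D$, i.e. a family of closed axis-parallel squares with pairwise disjoint interiors and union $D$, such that the ratio of the side length of a square to its distance from $\partial D$ is bounded above and below by positive constants. For $Q\in\mathcal W$ let the shadow $\mathrm{sh}(Q)$ be the set of points of $\partial D$ that are the endpoint $\lim_{r\uparrow1}\varphi(re^{i\theta})$ of the image under $\varphi$ of some radius $[0,e^{i\theta}]$ such that this image passes through $Q$, and let $s(Q)=\operatorname{diam}\mathrm{sh}(Q)$. Assume that $$\sum_{Q\in\mathcal W}s(Q)^2<\infty .$$ Let $U\subseteq\mathbb C$ be a bounded domain with $\partial D\cap U\neq\emptyset$. Let $\gamma$ be a parameterization of the Jordan curve $\partial D$ on a closed interval $I$ (either a bounded interval, with $\gamma$ simple except that its endpoints agree, or, more generally, any closed interval, such as $\mathbb R$, on which $\gamma$ takes the same value at two times exactly if they differ by a multiple of a fixed period). Fix $t\in I$ with $\gamma(t)\in U$, let $t_1$ be the supremum of the times $s\le t$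 in $I$ with $\gamma(s)\notin U$, let $t_2$ be the infimum of the times $s\ge t$ in $I$ with $\gamma(s)\notin U$ (with $t_1=-\infty$, resp. $t_2=+\infty$, if there are no such times), and let $K=\gamma(I\cap[t_1,t_2])$. Then every continuous function $f\colon U\to\mathbb C$ which belongs to $W^{1,2}(U\setminus K)$ also belongs to $W^{1,2}(U)$. In particular, such a function $f$ is ACL on $U$: for almost every horizontal and almost every vertical line $\ell$, $f$ is absolutely continuous on $\ell\cap U$, in the sense that for each $\varepsilon>0$ there is $\delta>0$ such that $\sum_i|f(b_i)-f(a_i)|<\varepsilon$ for all finite families of non-overlapping segments $[a_i,b_i]\subseteq\ell\cap U$ of total length less than $\delta$. Here $W^{1,2}(\Omega)$ is the space of functions in $L^2(\Omega)$ whose weak first partial derivatives are in $L^2(\Omega)$. The same holds if $W^{1,2}(\Omega)$ is replaced, for both $\Omega=U\setminus K$ and $\Omega=U$, by the space of locally integrable functions on $\Omega$ whose weak first partial derivatives are in $L^2(\Omega)$ (the functions themselves need not be in $L^2(\Omega)$). -/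

import Mathlib

open scoped ContDiff

/-- A Jordan domain in the plane: a bounded domain whose boundary is a Jordan curve, i.e. the
image of the circle under a continuous injective map. -/
def IsJordanDomain (D : Set ℂ) : Prop :=
  IsOpen D ∧ IsConnected D ∧ Bornology.IsBounded D ∧
    ∃ c : Circle → ℂ, Continuous c ∧ Function.Injective c ∧ Set.range c = frontier D

/-- `φ` is a conformal transformation of the open unit disk onto `D`. -/
def IsConformalFromDisk (φ : ℂ → ℂ) (D : Set ℂ) : Prop :=
  DifferentiableOn ℂ φ (Metric.ball 0 1) ∧ Set.BijOn φ (Metric.ball 0 1) D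

/-- The closed axis-parallel square with lower left corner `a` and side length `L`. -/
def closedSquare (a : ℂ) (L : ℝ) : Set ℂ :=
  Set.Icc a.re (a.re + L) ×ℂ Set.Icc a.im (a.im + L)

/-- A Whitney cube decomposition of `D`: a family of closed axis-parallel squares with pairwise
disjoint interiors and union `D`, whose side lengths are comparable, up to a constant which is the
same for all squares, to their distance from the boundary. (As the constant is arbitrary, it makes
no difference whether the distance is measured from the square or from each of its points. The
usual decompositions into dyadic squares are special cases.) -/
def IsWhitneyDecomposition (W : Set (Set ℂ)) (D : Set ℂ) : Prop :=
  ⋃₀ W = D ∧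
  (W.Pairwise fun Q Q' => Disjoint (interior Q) (interior Q')) ∧
  ∃ C : ℝ, 0 < C ∧ ∀ Q ∈ W, ∃ (a : ℂ) (L : ℝ), 0 < L ∧ Q = closedSquare a L ∧
    ∀ z ∈ Q, L ≤ C * Metric.infDist z (frontier D) ∧ Metric.infDist z (frontier D) ≤ C * L

/-- The shadow of `Q`: all boundary points of `D` that are the endpoint of the image under `φ` of
a radius `[0, ζ]`, `‖ζ‖ = 1`, which passes through `Q`. -/
def shadow (φ : ℂ → ℂ) (D Q : Set ℂ) : Set ℂ :=
  {w | w ∈ frontier D ∧ ∃ ζ : ℂ, ‖ζ‖ = 1 ∧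
    Filter.Tendsto (fun r : ℝ => φ (r * ζ)) (nhdsWithin 1 (Set.Iio 1)) (nhds w) ∧
    ∃ r : ℝ, 0 ≤ r ∧ r < 1 ∧ φ (r * ζ) ∈ Q}

/-- `γ`, defined on the closed interval `I` (possibly unbounded), is a parameterization of the
Jordan curve `S`: it is continuous with image `S`, and two times give the same point exactly if
they differ by a multiple of the period `T`. The case `I = [a, b]`, `T = b - a` is that of a curve
which is simple except for `γ a = γ b`; the case `I = ℝ` is that of a periodic parameterization. -/
def ParameterizesJordanCurve (γ : ℝ → ℂ) (I : Set ℝ) (S : Set ℂ) : Prop :=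
  IsClosed I ∧ I.OrdConnected ∧ ContinuousOn γ I ∧ γ '' I = S ∧
    ∃ T : ℝ, 0 < T ∧ ∀ s ∈ I, ∀ s' ∈ I, (γ s = γ s' ↔ ∃ n : ℤ, s - s' = n * T)

/-- The last time before `t` at which `γ` is outside `U` (`-∞` if there is none). -/
noncomputable def lastExitBefore (γ : ℝ → ℂ) (I : Set ℝ) (U : Set ℂ) (t : ℝ) : EReal :=
  sSup ((fun s : ℝ => (s : EReal)) '' {s | s ∈ I ∧ s ≤ t ∧ γ s ∉ U})

/-- The first time after `t` at which `γ` is outside `U` (`+∞` if there is none). -/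
noncomputable def firstExitAfter (γ : ℝ → ℂ) (I : Set ℝ) (U : Set ℂ) (t : ℝ) : EReal :=
  sInf ((fun s : ℝ => (s : EReal)) '' {s | s ∈ I ∧ t ≤ s ∧ γ s ∉ U})

/-- The arc `γ([t₁, t₂])`, where `t₁` and `t₂` are the last exit time before `t` and the first
exit time after `t`. If there is no such exit, the arc extends up to that end of `I`. -/
noncomputable def exitArc (γ : ℝ → ℂ) (I : Set ℝ) (U : Set ℂ) (t : ℝ) : Set ℂ :=
  γ '' {s | s ∈ I ∧ lastExitBefore γ I U t ≤ (s : EReal) ∧ (s : EReal) ≤ firstExitAfter γ I U t}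

/-- `g` is the weak derivative of `f` in the direction `v` on the open set `Ω`. -/
def IsWeakDeriv (f g : ℂ → ℂ) (v : ℂ) (Ω : Set ℂ) : Prop :=
  ∀ η : ℂ → ℝ, ContDiff ℝ ∞ η → HasCompactSupport η → tsupport η ⊆ Ω →
    ∫ z in Ω, (fderiv ℝ η z v) • f z = - ∫ z in Ω, η z • g z

/-- `f` is locally integrable on `Ω` and its weak first partial derivatives exist and lie in
`L²(Ω)`. -/
def HasL2WeakGradient (f : ℂ → ℂ) (Ω : Set ℂ) : Prop :=
  MeasureTheory.LocallyIntegrableOn f Ω MeasureTheory.volume ∧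
  ∃ g₁ g₂ : ℂ → ℂ,
    MeasureTheory.MemLp g₁ 2 (MeasureTheory.volume.restrict Ω) ∧
    MeasureTheory.MemLp g₂ 2 (MeasureTheory.volume.restrict Ω) ∧
    IsWeakDeriv f g₁ 1 Ω ∧ IsWeakDeriv f g₂ Complex.I Ω

/-- `f` belongs to the Sobolev space `W^{1,2}(Ω)`. -/
def MemW12 (f : ℂ → ℂ) (Ω : Set ℂ) : Prop :=
  MeasureTheory.MemLp f 2 (MeasureTheory.volume.restrict Ω) ∧ HasL2WeakGradient f Ω

/-- Absolute continuity of `h` on a set `E ⊆ ℝ`, tested on finite families of non-overlapping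
intervals contained in `E`. -/
def AbsContOn (h : ℝ → ℂ) (E : Set ℝ) : Prop :=
  ∀ ε : ℝ, 0 < ε → ∃ δ : ℝ, 0 < δ ∧ ∀ (n : ℕ) (a b : Fin n → ℝ),
    (∀ i, a i ≤ b i) → (∀ i, Set.Icc (a i) (b i) ⊆ E) →
    (Pairwise fun i j => Disjoint (Set.Ioo (a i) (b i)) (Set.Ioo (a j) (b j))) →
    ∑ i, (b i - a i) < δ → ∑ i, ‖h (b i) - h (a i)‖ < ε

/-- `f` is ACL on `U`: absolutely continuous on the intersection with `U` of almost every
horizontal and almost every vertical line. -/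
def IsACL (f : ℂ → ℂ) (U : Set ℂ) : Prop :=
  (∀ᵐ y : ℝ, AbsContOn (fun x : ℝ => f ⟨x, y⟩) {x : ℝ | (⟨x, y⟩ : ℂ) ∈ U}) ∧
  (∀ᵐ x : ℝ, AbsContOn (fun y : ℝ => f ⟨x, y⟩) {y : ℝ | (⟨x, y⟩ : ℂ) ∈ U})

/-! The arc lies in `frontier D`, so it suffices to show that ∂D as a whole is negligible for
continuous functions with square integrable gradient. A cutoff turns f into a continuous, compactly
supported F on the plane, with gradient in L² off ∂D. On almost every horizontal or vertical line, F
is a primitive of its weak derivative on each segment that misses ∂D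
(`IsWeakDeriv.ae_sub_eq_intervalIntegral`). What remains to be excluded is that F varies on ∂D
itself, as the Cantor function does on the Cantor set. By
`sub_eq_intervalIntegral_of_volume_image_eq_zero`, F is a primitive on the whole line as soon as ∂D
meets the line in a null set which the real and imaginary parts of F send to null sets.

This is proved from inside D (`CellCover.ae_volume_image_eq_zero`). The Whitney squares are divided
into cells so small that a square around each cell, containing all adjoining cells, stays in D. A
Poincaré inequality (`exists_norm_average_sub_le`) bounds the difference of the means of F over
adjoining cells by a number osc, and Σ osc² is finite because the relevant zones overlap boundedly.
By Carathéodory's theorem (`exists_radial_limit_of_mem_frontier`), a point x of ∂D is the endpoint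
of the image of a radius, and this curve passes only through squares whose shadow contains x. Along
it the means tend to F(x), and after a real projection they cannot cross a value that lies in none
of the intervals [mean - osc, mean + osc]. Hence the projected value of F at x lies in one of these
intervals, up to a countable set, and finitely many cells can be discarded beforehand.

The interval of a cell counts for a line only if the line meets the shadow of its square. The
integral over all lines of the total length that counts is therefore at most a multiple of Σ osc ·
s, which is finite because Σ osc² and Σ s² are. So the total is finite for almost every line, its
tails tend to 0, and the image of ∂D is null there. The same argument with s in place of osc shows
that almost every line meets ∂D in a null set.

Carathéodory's theorem is obtained from the length-area estimate `exists_small_arc_oscillation` and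
Janiszewski's theorem `mem_connectedComponentIn_union`, the latter by means of continuous
logarithms. In the end, being a primitive on almost every line yields the weak derivative across ∂D
by integration by parts and Fubini, and ACL by absolute continuity of the integral. -/

section Auxiliary

open Set Filter Topology Metric MeasureTheory

/-! ### Continuous logarithms and Janiszewski's theorem. -/

/-- `g` has a continuous logarithm on `X`. -/
def HasContinuousLog (g : ℂ → ℂ) (X : Set ℂ) : Prop :=
  ∃ h : ℂ → ℂ, ContinuousOn h X ∧ ∀ z ∈ X, Complex.exp (h z) = g z

lemma HasContinuousLog.of_norm_sub_one_lt {g : ℂ → ℂ} {X : Set ℂ} (hg : ContinuousOn g X)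
    (h : ∀ z ∈ X, ‖g z - 1‖ < 1) : HasContinuousLog g X := by
  have hs : ∀ z ∈ X, g z ∈ Complex.slitPlane := fun z hz =>
    Complex.ball_one_subset_slitPlane (by simpa [dist_eq_norm] using h z hz)
  exact ⟨fun z => Complex.log (g z), hg.clog hs,
    fun z hz => Complex.exp_log (Complex.slitPlane_ne_zero (hs z hz))⟩

lemma HasContinuousLog.mul {g₁ g₂ : ℂ → ℂ} {X : Set ℂ} (h₁ : HasContinuousLog g₁ X)
    (h₂ : HasContinuousLog g₂ X) : HasContinuousLog (fun z => g₁ z * g₂ z) X := by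
  obtain ⟨k₁, c₁, e₁⟩ := h₁
  obtain ⟨k₂, c₂, e₂⟩ := h₂
  exact ⟨fun z => k₁ z + k₂ z, c₁.add c₂, fun z hz => by rw [Complex.exp_add, e₁ z hz, e₂ z hz]⟩

lemma HasContinuousLog.inv {g : ℂ → ℂ} {X : Set ℂ} (h : HasContinuousLog g X) :
    HasContinuousLog (fun z => (g z)⁻¹) X := by
  obtain ⟨k, c, e⟩ := h
  exact ⟨fun z => - k z, c.neg, fun z hz => by rw [Complex.exp_neg, e z hz]⟩

lemma HasContinuousLog.congr {g g' : ℂ → ℂ} {X : Set ℂ} (h : HasContinuousLog g X)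
    (hg : ∀ z ∈ X, g z = g' z) : HasContinuousLog g' X := by
  obtain ⟨k, c, e⟩ := h
  exact ⟨k, c, fun z hz => by rw [e z hz, hg z hz]⟩

/-- A point outside a ball containing `X` has a continuous logarithm of `z - w` on `X`. -/
lemma hasContinuousLog_sub_of_subset_closedBall {X : Set ℂ} {a w : ℂ} {r : ℝ}
    (hX : X ⊆ closedBall a r) (hw : w ∉ closedBall a r) :
    HasContinuousLog (fun z => z - w) X := by
  have hr : r < ‖w - a‖ := by simpa [dist_eq_norm] using hw
  by_cases hne : X = ∅
  · subst hne; exact ⟨0, continuousOn_empty _, by simp⟩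
  obtain ⟨x, hx⟩ := nonempty_iff_ne_empty.2 hne
  have hr0 : 0 ≤ r := dist_nonneg.trans (hX hx)
  have haw : a - w ≠ 0 := by
    rw [← norm_pos_iff, norm_sub_rev]; linarith
  have h1 : HasContinuousLog (fun z => (z - w) / (a - w)) X := by
    apply HasContinuousLog.of_norm_sub_one_lt
    · fun_prop
    · intro z hz
      have : (z - w) / (a - w) - 1 = (z - a) / (a - w) := by field_simp; ring
      rw [this, norm_div, div_lt_one (norm_pos_iff.2 haw), norm_sub_rev a w]
      have := hX hz
      rw [mem_closedBall, dist_eq_norm] at this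
      linarith
  have h2 : HasContinuousLog (fun _ => a - w) X :=
    ⟨fun _ => Complex.log (a - w), continuousOn_const, fun _ _ => Complex.exp_log haw⟩
  exact (h1.mul h2).congr fun z _ => by field_simp

/-- Points in the same connected set off the closed set `X` are not separated by `X`, in terms of
logarithms. -/
lemma hasContinuousLog_div_of_isPreconnected {X V : Set ℂ} (hX : IsClosed X)
    (hV : IsPreconnected V) (hVX : Disjoint V X) {a b : ℂ} (ha : a ∈ V) (hb : b ∈ V) :
    HasContinuousLog (fun z => (z - a) / (z - b)) X := by
  have hne : ∀ a ∈ V, ∀ z ∈ X, z - a ≠ 0 := fun a ha z hz h =>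
    hVX.ne_of_mem ha hz (sub_eq_zero.1 h).symm
  -- The relation is symmetric and transitive, and it holds between nearby points: if y is closer to
  -- x than X is, then (z - y) / (z - x) stays within distance 1 of 1 on X. On a connected set it
  -- then holds between any two points.
  refine hV.induction₂ (fun a b => HasContinuousLog (fun z => (z - a) / (z - b)) X) ?_ ?_ ?_ ha hb
  · intro x hx
    have hxX : Xᶜ ∈ 𝓝 x := hX.isOpen_compl.mem_nhds (disjoint_left.1 hVX hx)
    obtain ⟨r, hr, hball⟩ := Metric.mem_nhds_iff.1 hxX
    filter_upwards [self_mem_nhdsWithin, mem_nhdsWithin_of_mem_nhds (ball_mem_nhds x hr)]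
      with y hy hyr
    have : HasContinuousLog (fun z => (z - y) / (z - x)) X := by
      apply HasContinuousLog.of_norm_sub_one_lt
      · exact ContinuousOn.div (by fun_prop) (by fun_prop) (hne x hx)
      · intro z hz
        have h1 := hne x hx z hz
        have : (z - y) / (z - x) - 1 = (x - y) / (z - x) := by field_simp; ring
        rw [this, norm_div, div_lt_one (norm_pos_iff.2 h1)]
        have h2 : z ∉ ball x r := fun h => hball h hz
        rw [mem_ball, dist_eq_norm] at hyr h2
        rw [norm_sub_rev]
        linarith
    exact this.inv.congr fun z _ => by rw [inv_div]
  · intro x y z hx hy hz h1 h2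
    exact (h1.mul h2).congr fun u hu => by
      have := hne y hy u hu
      have := hne z hz u hu
      field_simp
  · intro x y _ _ h
    exact h.inv.congr fun z _ => by rw [inv_div]

/-- Eilenberg's gluing of logarithms along a connected intersection. -/
lemma HasContinuousLog.union {g : ℂ → ℂ} {A B : Set ℂ} (hA : IsClosed A) (hB : IsClosed B)
    (hAB : IsPreconnected (A ∩ B)) (h₁ : HasContinuousLog g A) (h₂ : HasContinuousLog g B) :
    HasContinuousLog g (A ∪ B) := by
  classical
  obtain ⟨k, ck, ek⟩ := h₁
  obtain ⟨l, cl, el⟩ := h₂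
  -- Two logarithms differ by an integer multiple of 2πi. The integer depends continuously on the
  -- point, so it is constant on the connected intersection, and shifting one logarithm makes them
  -- agree there.
  have hex : ∃ n : ℤ, ∀ z ∈ A ∩ B, k z = l z + n * (2 * Real.pi * Complex.I) := by
    have : ∀ z ∈ A ∩ B, ∃ n : ℤ, k z = l z + n * (2 * Real.pi * Complex.I) := fun z hz =>
      Complex.exp_eq_exp_iff_exists_int.1 (by rw [ek z hz.1, el z hz.2])
    choose! m hm using this
    by_cases hne : (A ∩ B).Nonempty
    · obtain ⟨x, hx⟩ := hne
      have hc : ContinuousOn (fun z => ((k z - l z) / (2 * Real.pi * Complex.I)).re) (A ∩ B) := by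
        apply Complex.continuous_re.comp_continuousOn
        exact ((ck.mono inter_subset_left).sub (cl.mono inter_subset_right)).div_const _
      have hI : (2 * Real.pi * Complex.I : ℂ) ≠ 0 := Complex.two_pi_I_ne_zero
      have hcm : ∀ z ∈ A ∩ B, ((k z - l z) / (2 * Real.pi * Complex.I)).re = m z := by
        intro z hz
        rw [hm z hz, add_sub_cancel_left, mul_div_cancel_right₀ _ hI]
        simp
      refine ⟨m x, fun z hz => ?_⟩
      have hmc : ContinuousOn m (A ∩ B) := by
        have h1 : ContinuousOn (fun z => ((m z : ℤ) : ℝ)) (A ∩ B) :=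
          hc.congr fun z hz => (hcm z hz).symm
        exact Int.isClosedEmbedding_coe_real.isEmbedding.isInducing.continuousOn_iff.2 h1
      rw [hAB.constant hmc hx hz, hm z hz]
    · exact ⟨0, fun z hz => (hne ⟨z, hz⟩).elim⟩
  obtain ⟨n, hn⟩ := hex
  let l' : ℂ → ℂ := fun z => l z + n * (2 * Real.pi * Complex.I)
  have e' : ∀ z ∈ B, Complex.exp (l' z) = g z := fun z hz => by
    rw [← el z hz]
    exact Complex.exp_eq_exp_iff_exists_int.2 ⟨n, rfl⟩
  have c' : ContinuousOn l' B := cl.add continuousOn_const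
  refine ⟨fun z => if z ∈ A then k z else l' z, ?_, ?_⟩
  · apply ContinuousOn.union_of_isClosed _ _ hA hB
    · exact ck.congr fun z hz => by simp [hz]
    · refine c'.congr fun z hz => ?_
      by_cases hzA : z ∈ A
      · simp [hzA, hn z ⟨hzA, hz⟩, l']
      · simp [hzA]
  · rintro z (hz | hz)
    · simp [hz, ek z hz]
    · by_cases hzA : z ∈ A
      · simp [hzA, ek z hzA]
      · simp [hzA, e' z hz]

/-- There is no nonvanishing continuous map of the plane which agrees with `z - w` near `∞`. -/
lemma not_continuous_ne_zero_eq_sub {G : ℂ → ℂ} (hG : Continuous G) (h0 : ∀ z, G z ≠ 0)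
    {w : ℂ} {R : ℝ} (hR : ∀ z, R ≤ ‖z - w‖ → G z = z - w) : False := by
  have hsc : IsSimplyConnected (univ : Set ℂ) := by
    have : ContractibleSpace (univ : Set ℂ) :=
      (convex_univ (𝕜 := ℝ) (E := ℂ)).contractibleSpace ⟨0, mem_univ _⟩
    exact SimplyConnectedSpace.ofContractible _
  -- The plane is simply connected, so G would have a logarithm l. On a large circle about w it
  -- equals log r + iθ + 2πi n with n constant, which contradicts the periodicity of the circle in
  -- θ.
  obtain ⟨l, lc, le⟩ := Complex.exists_continuousOn_eqOn_exp_comp hsc isOpen_univ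
    hG.continuousOn (by simpa using fun z => h0 z)
  rw [continuousOn_univ] at lc
  set r : ℝ := max R 1
  have hr : 0 < r := lt_of_lt_of_le one_pos (le_max_right _ _)
  let c : ℝ → ℂ := fun θ => w + r * Complex.exp (θ * Complex.I)
  have hcn : ∀ θ, c θ - w = r * Complex.exp (θ * Complex.I) := fun θ => by simp [c]
  have hGc : ∀ θ : ℝ, Complex.exp (l (c θ)) = r * Complex.exp (θ * Complex.I) := fun θ => by
    have h1 : ‖c θ - w‖ = r := by
      rw [hcn, norm_mul, Complex.norm_exp_ofReal_mul_I]; simp [abs_of_pos hr]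
    have := le (mem_univ (c θ))
    simp only [Function.comp] at this
    rw [this, hR _ (by rw [h1]; exact le_max_left _ _), hcn]
  have hcc : Continuous c := by fun_prop
  have hint : ∀ θ : ℝ, ∃ n : ℤ, l (c θ) = Complex.log r + θ * Complex.I
      + n * (2 * Real.pi * Complex.I) := fun θ => by
    apply Complex.exp_eq_exp_iff_exists_int.1
    rw [hGc, Complex.exp_add, Complex.exp_log (by exact_mod_cast hr.ne')]
  choose n hn using hint
  have hnc : Continuous n := by
    have h1 : Continuous fun θ : ℝ => ((n θ : ℤ) : ℝ) := by
      have h2 : (fun θ : ℝ => ((n θ : ℤ) : ℝ)) = fun θ : ℝ =>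
          ((l (c θ) - Complex.log r - θ * Complex.I) / (2 * Real.pi * Complex.I)).re := by
        funext θ
        rw [hn θ]
        have : (Complex.log r + θ * Complex.I + n θ * (2 * Real.pi * Complex.I) - Complex.log r
          - θ * Complex.I) = n θ * (2 * Real.pi * Complex.I) := by ring
        rw [this, mul_div_cancel_right₀ _ Complex.two_pi_I_ne_zero]
        simp
      rw [h2]
      have := lc.comp hcc
      simp only [Function.comp_def] at this
      fun_prop
    exact Int.isClosedEmbedding_coe_real.isEmbedding.isInducing.continuous_iff.2 h1
  have hconst : n (2 * Real.pi) = n 0 :=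
    isPreconnected_univ.constant hnc.continuousOn (mem_univ _) (mem_univ _)
  have hper : c (2 * Real.pi) = c 0 := by
    simp [c, Complex.exp_two_pi_mul_I]
  have h1 := hn (2 * Real.pi)
  rw [hper, hn 0, hconst] at h1
  simp at h1

/-- If `(z - w) / (z - w₀)` has a continuous logarithm on the closed set `X`, and the component of
`w` off `X` is bounded, then this component contains `w₀`. -/
lemma mem_connectedComponentIn_of_hasContinuousLog {X : Set ℂ} (hX : IsClosed X) {w w₀ : ℂ}
    (hw : w ∉ X) (hw₀ : w₀ ∉ X) (hlog : HasContinuousLog (fun z => (z - w) / (z - w₀)) X)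
    (hb : Bornology.IsBounded (connectedComponentIn Xᶜ w)) :
    w₀ ∈ connectedComponentIn Xᶜ w := by
  classical
  by_contra hcon
  set V := connectedComponentIn Xᶜ w with hV
  have hVo : IsOpen V := hX.isOpen_compl.connectedComponentIn
  have hVX : V ⊆ Xᶜ := connectedComponentIn_subset _ _
  have hwV : w ∈ V := mem_connectedComponentIn hw
  have hfr : frontier V ⊆ X := by
    intro z hz
    by_contra hzX
    have hzc : z ∈ closure V := frontier_subset_closure hz
    have hW : connectedComponentIn Xᶜ z ∈ 𝓝 z :=
      connectedComponentIn_mem_nhds (hX.isOpen_compl.mem_nhds hzX)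
    obtain ⟨u, hu1, hu2⟩ := mem_closure_iff_nhds.1 hzc _ hW
    have e1 := connectedComponentIn_eq hu1
    have e2 := connectedComponentIn_eq hu2
    have : z ∈ V := by
      rw [hV, e2, ← e1]; exact mem_connectedComponentIn hzX
    rw [hVo.frontier_eq] at hz
    exact hz.2 this
  obtain ⟨h, hc, he⟩ := hlog
  -- Tietze's theorem extends the logarithm from X to the whole plane.
  obtain ⟨H, hH⟩ := ContinuousMap.exists_restrict_eq hX ⟨X.domRestrict h, hc.domRestrict⟩
  have hHX : ∀ z ∈ X, H z = h z := fun z hz => by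
    have := congrArg (fun F => F ⟨z, hz⟩) hH
    simpa using this
  -- On the frontier of V, which lies in X, the two formulas agree. If w₀ is outside V, then G
  -- vanishes nowhere, since its two possible zeros w₀ and w each fall in the region where the other
  -- formula applies; as V is bounded, G is z - w near infinity.
  let G : ℂ → ℂ := fun z => if z ∈ V then (z - w₀) * Complex.exp (H z) else z - w
  have hG : Continuous G := by
    have hcont : Continuous (fun z => (z - w₀) * Complex.exp (H z)) := by
      have := H.continuous
      fun_prop
    have := Continuous.piecewise (s := V) (f := fun z => (z - w₀) * Complex.exp (H z))
      (g := fun z => z - w) (fun z hz => by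
      have hzX := hfr hz
      have : z - w₀ ≠ 0 := fun h => hw₀ (by rwa [sub_eq_zero.1 h] at hzX)
      show (z - w₀) * Complex.exp (H z) = z - w
      rw [hHX z hzX, he z hzX]
      field_simp) hcont (by fun_prop)
    exact this
  obtain ⟨R, hR⟩ := hb.subset_ball w
  refine not_continuous_ne_zero_eq_sub hG (w := w) (R := R) (fun z => ?_) (fun z hz => ?_)
  · by_cases hz : z ∈ V
    · simp only [G, hz, if_true]
      refine mul_ne_zero (fun h => hcon ?_) (Complex.exp_ne_zero _)
      rwa [← sub_eq_zero.1 h]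
    · simp only [G, hz, if_false]
      exact fun h => hz (by rwa [sub_eq_zero.1 h])
  · have : z ∉ V := fun h => by
      have := hR h
      rw [mem_ball, dist_eq_norm] at this
      linarith
    simp [G, this]

/-- Janiszewski's theorem, in the form used below. -/
theorem mem_connectedComponentIn_union {A B : Set ℂ} (hA : IsClosed A) (hB : IsClosed B)
    (hAB : IsPreconnected (A ∩ B)) {V : Set ℂ} (hV : IsPreconnected V) (hVA : Disjoint V A)
    {w w₀ a : ℂ} {r : ℝ} (hw : w ∈ V) (hw₀ : w₀ ∈ V) (hBr : B ⊆ closedBall a r)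
    (hwr : w ∉ closedBall a r) (hw₀r : w₀ ∉ closedBall a r)
    (hb : Bornology.IsBounded (connectedComponentIn (A ∪ B)ᶜ w)) :
    w₀ ∈ connectedComponentIn (A ∪ B)ᶜ w := by
  -- Neither closed set separates the two points: they are joined off A by V, and both lie outside a
  -- ball that contains B. The logarithms of the quotient are then glued along the connected
  -- intersection.
  have h1 := hasContinuousLog_div_of_isPreconnected hA hV hVA hw hw₀
  have h2 : HasContinuousLog (fun z => (z - w) / (z - w₀)) B :=
    ((hasContinuousLog_sub_of_subset_closedBall hBr hwr).mul
      (hasContinuousLog_sub_of_subset_closedBall hBr hw₀r).inv).congr fun z _ => by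
        rw [div_eq_mul_inv]
  refine mem_connectedComponentIn_of_hasContinuousLog (hA.union hB) ?_ ?_ (h1.union hA hB hAB h2) hb
  · rintro (h | h)
    · exact hVA.ne_of_mem hw h rfl
    · exact hwr (hBr h)
  · rintro (h | h)
    · exact hVA.ne_of_mem hw₀ h rfl
    · exact hw₀r (hBr h)

/-! ### The length-area estimate. -/

lemma abs_det_restrictScalars_toSpanSingleton (c : ℂ) :
    |((c • (1 : ℂ →L[ℝ] ℂ)) : ℂ →L[ℝ] ℂ).det| = ‖c‖ ^ 2 := by
  have h1 : ((c • (1 : ℂ →L[ℝ] ℂ)) : ℂ →L[ℝ] ℂ).det = Algebra.norm ℝ c := by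
    rw [Algebra.norm_apply]
    rfl
  rw [h1, Algebra.norm_complex_apply, Complex.normSq_eq_norm_sq, abs_of_nonneg (sq_nonneg _)]

/-- The area of the image under an injective holomorphic map. -/
lemma lintegral_enorm_deriv_sq_eq_volume_image {ψ : ℂ → ℂ} {Ω : Set ℂ} (hΩ : IsOpen Ω)
    (hψ : DifferentiableOn ℂ ψ Ω) (hinj : InjOn ψ Ω) :
    ∫⁻ z in Ω, ‖deriv ψ z‖ₑ ^ 2 = volume (ψ '' Ω) := by
  rw [← lintegral_abs_det_fderiv_eq_addHaar_image volume hΩ.measurableSet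
    (f' := fun z => deriv ψ z • (1 : ℂ →L[ℝ] ℂ)) (fun z hz => ?_) hinj]
  · refine lintegral_congr fun z => ?_
    rw [abs_det_restrictScalars_toSpanSingleton, ENNReal.ofReal_pow (norm_nonneg _),
      ofReal_norm]
  · exact ((hψ.differentiableAt (hΩ.mem_nhds hz)).hasDerivAt.complexToReal_fderiv).hasFDerivWithinAt

/-- Cauchy–Schwarz against the constant 1. It serves both the length-area estimate and the bound of
the squared oscillations by the energy. -/
lemma sq_lintegral_le_mul_lintegral_sq {α : Type*} [MeasurableSpace α] (μ : Measure α)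
    {f : α → ENNReal} (hf : AEMeasurable f μ) :
    (∫⁻ x, f x ∂μ) ^ 2 ≤ μ univ * ∫⁻ x, f x ^ 2 ∂μ := by
  have h := ENNReal.lintegral_mul_le_Lp_mul_Lq μ (Real.HolderConjugate.two_two)
    (aemeasurable_const (b := (1 : ENNReal))) hf
  simp only [Pi.mul_apply, one_mul, ENNReal.one_rpow, lintegral_const] at h
  calc (∫⁻ x, f x ∂μ) ^ 2 ≤ (μ univ ^ (1 / 2 : ℝ) * (∫⁻ x, f x ^ (2 : ℝ) ∂μ) ^ (1 / 2 : ℝ)) ^ 2 := by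
        gcongr
    _ = μ univ * ∫⁻ x, f x ^ 2 ∂μ := by
        rw [mul_pow, ← ENNReal.rpow_natCast, ← ENNReal.rpow_natCast, ← ENNReal.rpow_mul,
          ← ENNReal.rpow_mul]
        simp

/-- This divergence at 0 is what forces small circles of small oscillation to exist. -/
lemma lintegral_inv_eq_top {δ : ℝ} (hδ : 0 < δ) :
    ∫⁻ ρ in Ioo 0 δ, ENNReal.ofReal ρ⁻¹ = ⊤ := by
  by_contra h
  have : ¬ IntervalIntegrable (fun x : ℝ => x⁻¹) volume 0 δ := by
    rw [intervalIntegrable_inv_iff]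
    simp [hδ.ne]
  apply this
  rw [intervalIntegrable_iff_integrableOn_Ioo_of_le hδ.le]
  refine ⟨by fun_prop, ?_⟩
  rw [hasFiniteIntegral_iff_enorm, lt_top_iff_ne_top]
  have e : ∫⁻ x in Ioo 0 δ, ‖x⁻¹‖ₑ = ∫⁻ ρ in Ioo 0 δ, ENNReal.ofReal ρ⁻¹ := by
    refine setLIntegral_congr_fun measurableSet_Ioo fun x (hx : x ∈ Ioo 0 δ) => ?_
    rw [← ofReal_norm, Real.norm_of_nonneg (inv_nonneg.2 hx.1.le)]
  rwa [e]

/-- The circle of radius `ρ` about `0`, at angle `θ`, lies in the disk with centre `1` and radius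
`1` exactly if `ρ < 2 cos θ`. -/
lemma polar_mem_ball_one_iff {ρ θ : ℝ} (hρ : 0 < ρ) :
    (ρ : ℂ) * Complex.exp (θ * Complex.I) ∈ ball (1 : ℂ) 1 ↔ ρ < 2 * Real.cos θ := by
  have h : ‖(ρ : ℂ) * Complex.exp (θ * Complex.I) - 1‖ ^ 2 = 1 + ρ * (ρ - 2 * Real.cos θ) := by
    rw [← Complex.normSq_eq_norm_sq, Complex.normSq_apply, Complex.exp_mul_I]
    simp [← Complex.ofReal_cos, ← Complex.ofReal_sin]
    linear_combination ρ ^ 2 * Real.sin_sq_add_cos_sq θ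
  rw [mem_ball, dist_eq_norm, ← abs_of_nonneg (norm_nonneg ((ρ : ℂ) * _ - 1)),
    ← sq_lt_one_iff_abs_lt_one, h]
  constructor
  · intro h; by_contra hc; nlinarith
  · intro h; nlinarith

/-- The length-area estimate: there are arbitrarily small circles about the boundary point `0` of
the disk with centre `1` and radius `1`, on which an injective holomorphic map with bounded image
has small oscillation. -/
lemma exists_small_arc_oscillation {ψ : ℂ → ℂ} (hψ : DifferentiableOn ℂ ψ (ball 1 1))
    (hinj : InjOn ψ (ball 1 1)) (hb : Bornology.IsBounded (ψ '' ball 1 1)) {ε δ : ℝ}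
    (hε : 0 < ε) (hδ : 0 < δ) :
    ∃ ρ, 0 < ρ ∧ ρ < δ ∧ ∀ z₁ ∈ ball (1 : ℂ) 1, ∀ z₂ ∈ ball (1 : ℂ) 1, ‖z₁‖ = ρ → ‖z₂‖ = ρ →
      ‖ψ z₁ - ψ z₂‖ ≤ ε := by
  -- If every circle of radius ρ < δ has oscillation above ε, then ε ≤ ∫ ρ|ψ'| dθ. By
  -- Cauchy–Schwarz, ε²/(2πρ) ≤ ∫ |ψ'|² ρ dθ. Integration over ρ makes the left side infinite,
  -- whereas the right side gives at most the area of the bounded image.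
  by_contra! hcon
  let F : ℂ → ENNReal := (ball (1 : ℂ) 1).indicator fun z => ‖deriv ψ z‖ₑ
  have hF : Measurable F := (measurable_deriv ψ).enorm.indicator isOpen_ball.measurableSet
  have hfin : ∫⁻ z, F z ^ 2 < ⊤ := by
    have : ∀ z, F z ^ 2 = (ball (1 : ℂ) 1).indicator (fun z => ‖deriv ψ z‖ₑ ^ 2) z := fun z => by
      by_cases hz : z ∈ ball (1 : ℂ) 1 <;> simp [F, hz]
    simp_rw [this]
    rw [lintegral_indicator isOpen_ball.measurableSet,
      lintegral_enorm_deriv_sq_eq_volume_image isOpen_ball hψ hinj]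
    exact hb.measure_lt_top
  let e : ℝ → ℝ → ℂ := fun ρ θ => (ρ : ℂ) * Complex.exp (θ * Complex.I)
  have hem : Measurable (fun p : ℝ × ℝ => e p.1 p.2) := by
    apply Continuous.measurable; fun_prop
  have hpolar : ∫⁻ ρ in Ioi (0 : ℝ), ∫⁻ θ in Ioo (-Real.pi) Real.pi,
      ENNReal.ofReal ρ * F (e ρ θ) ^ 2 = ∫⁻ z, F z ^ 2 := by
    rw [← Complex.lintegral_comp_polarCoord_symm, polarCoord_target, Measure.volume_eq_prod,
      ← Measure.prod_restrict, lintegral_prod]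
    · refine lintegral_congr fun ρ => lintegral_congr fun θ => ?_
      simp [e, Complex.exp_mul_I]
    · apply Measurable.aemeasurable
      simp only [smul_eq_mul]
      have : Measurable fun p : ℝ × ℝ => Complex.polarCoord.symm p := by
        have : (fun p : ℝ × ℝ => Complex.polarCoord.symm p) = fun p => e p.1 p.2 := by
          funext p; simp [e, Complex.exp_mul_I]
        rw [this]; exact hem
      exact (ENNReal.measurable_ofReal.comp measurable_fst).mul ((hF.comp this).pow_const 2)
  have hlow : ∀ ρ ∈ Ioo 0 δ, ENNReal.ofReal (ε ^ 2 / (2 * Real.pi)) * ENNReal.ofReal ρ⁻¹ ≤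
      ∫⁻ θ in Ioo (-Real.pi) Real.pi, ENNReal.ofReal ρ * F (e ρ θ) ^ 2 := by
    intro ρ hρ
    obtain ⟨z₁, hz₁, z₂, hz₂, hn₁, hn₂, hlt⟩ := hcon ρ hρ.1 hρ.2
    have harg : ∀ z ∈ ball (1 : ℂ) 1, ‖z‖ = ρ → e ρ z.arg = z := fun z _ hn => by
      simp only [e]; rw [← hn]; exact Complex.norm_mul_exp_arg_mul_I z
    -- The two points are joined along their circle. The angles with ρ < 2 cos θ form an interval
    -- around 0, so the arc stays in the disk, and the increment of ψ is at most the integral of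
    -- |ψ'| over the arc.
    have main : ∀ s t : ℝ, s ≤ t → e ρ s ∈ ball (1 : ℂ) 1 → e ρ t ∈ ball (1 : ℂ) 1 →
        -Real.pi < s → t < Real.pi →
        ENNReal.ofReal ‖ψ (e ρ t) - ψ (e ρ s)‖ ≤
        ∫⁻ θ in Ioo (-Real.pi) Real.pi, ENNReal.ofReal ρ * F (e ρ θ) := by
      intro s t hst hs ht hs' ht'
      have hin : ∀ θ ∈ Icc s t, e ρ θ ∈ ball (1 : ℂ) 1 := by
        intro θ hθ
        rw [polar_mem_ball_one_iff hρ.1] at hs ht ⊢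
        rcases le_total 0 θ with h0 | h0
        · have := Real.cos_le_cos_of_nonneg_of_le_pi h0 ht'.le hθ.2
          linarith
        · have := Real.cos_le_cos_of_nonneg_of_le_pi (x := -θ) (y := -s) (by linarith)
            (by linarith) (by linarith [hθ.1])
          rw [Real.cos_neg, Real.cos_neg] at this
          linarith
      have hder : ∀ θ ∈ Icc s t, HasDerivAt (fun θ => ψ (e ρ θ))
          (deriv ψ (e ρ θ) * (e ρ θ * Complex.I)) θ := by
        intro θ hθ
        have h1 := (hψ.differentiableAt (isOpen_ball.mem_nhds (hin θ hθ))).hasDerivAt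
        have h2 : HasDerivAt (fun θ : ℝ => e ρ θ) (e ρ θ * Complex.I) θ := by
          have h3 : HasDerivAt (fun w : ℂ => (ρ : ℂ) * Complex.exp (w * Complex.I))
              (ρ * (Complex.exp (θ * Complex.I) * Complex.I)) θ := by
            have := ((hasDerivAt_id (θ : ℂ)).mul_const Complex.I).cexp.const_mul (ρ : ℂ)
            simpa using this
          have := h3.comp_ofReal
          convert! this using 1
          simp only [e]; ring
        exact h1.comp_of_eq θ h2 rfl |>.congr_deriv (by ring)
      have hcd : ContinuousOn (fun θ => deriv ψ (e ρ θ) * (e ρ θ * Complex.I)) (Icc s t) := by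
        have h1 : ContinuousOn (deriv ψ) (ball 1 1) := (hψ.deriv isOpen_ball).continuousOn
        have h2 : Continuous (e ρ) := by fun_prop
        exact (h1.comp h2.continuousOn hin).mul (by fun_prop)
      have hftc := intervalIntegral.integral_eq_sub_of_hasDerivAt
        (fun θ hθ => hder θ (by rwa [uIcc_of_le hst] at hθ))
        ((hcd.mono (by rw [uIcc_of_le hst])).intervalIntegrable)
      rw [← hftc, intervalIntegral.integral_of_le hst, ofReal_norm]
      refine (enorm_integral_le_lintegral_enorm _).trans ?_
      calc ∫⁻ θ in Ioc s t, ‖deriv ψ (e ρ θ) * (e ρ θ * Complex.I)‖ₑ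
          = ∫⁻ θ in Ioc s t, ENNReal.ofReal ρ * F (e ρ θ) := by
            refine setLIntegral_congr_fun measurableSet_Ioc fun θ hθ => ?_
            have h1 := hin θ ⟨hθ.1.le, hθ.2⟩
            simp only [F, indicator_of_mem h1]
            rw [enorm_mul, mul_comm]
            congr 1
            rw [← ofReal_norm]
            congr 1
            simp [e, Complex.norm_exp_ofReal_mul_I, abs_of_pos hρ.1]
        _ ≤ _ := lintegral_mono_set fun θ (hθ : θ ∈ Ioc s t) =>
            (⟨hs'.trans hθ.1, hθ.2.trans_lt ht'⟩ : θ ∈ Ioo (-Real.pi) Real.pi)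
    have hargIoo : ∀ z ∈ ball (1 : ℂ) 1, z.arg ∈ Ioo (-Real.pi) Real.pi := fun z hz => by
      have := Complex.ball_one_subset_slitPlane hz
      rw [Complex.mem_slitPlane_iff_arg] at this
      exact ⟨Complex.neg_pi_lt_arg z, lt_of_le_of_ne (Complex.arg_le_pi z) this.1⟩
    have hL : ENNReal.ofReal ε ≤ ∫⁻ θ in Ioo (-Real.pi) Real.pi,
        ENNReal.ofReal ρ * F (e ρ θ) := by
      have ha := hargIoo z₁ hz₁
      have hb := hargIoo z₂ hz₂
      refine (ENNReal.ofReal_le_ofReal hlt.le).trans ?_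
      rcases le_total z₁.arg z₂.arg with h | h
      · have := main _ _ h (by rwa [harg z₁ hz₁ hn₁]) (by rwa [harg z₂ hz₂ hn₂]) ha.1 hb.2
        rwa [harg z₁ hz₁ hn₁, harg z₂ hz₂ hn₂, norm_sub_rev] at this
      · have := main _ _ h (by rwa [harg z₂ hz₂ hn₂]) (by rwa [harg z₁ hz₁ hn₁]) hb.1 ha.2
        rwa [harg z₁ hz₁ hn₁, harg z₂ hz₂ hn₂] at this
    have hmeas : Measurable fun θ => F (e ρ θ) := by
      have : Continuous (e ρ) := by fun_prop
      exact hF.comp this.measurable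
    have hcs := sq_lintegral_le_mul_lintegral_sq (volume.restrict (Ioo (-Real.pi) Real.pi))
      (f := fun θ => ENNReal.ofReal ρ * F (e ρ θ)) (hmeas.const_mul _).aemeasurable
    have h2 : ENNReal.ofReal ε ^ 2 ≤ ENNReal.ofReal (2 * Real.pi) * (ENNReal.ofReal ρ *
        ∫⁻ θ in Ioo (-Real.pi) Real.pi, ENNReal.ofReal ρ * F (e ρ θ) ^ 2) := by
      calc ENNReal.ofReal ε ^ 2 ≤ _ := pow_le_pow_left' hL 2
        _ ≤ _ := hcs
        _ = _ := by
          rw [Measure.restrict_apply_univ, Real.volume_Ioo,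
            ← lintegral_const_mul _ ((hmeas.pow_const 2).const_mul _)]
          congr 1
          · congr 1; ring
          · refine lintegral_congr fun θ => by ring
    have hpi : 0 < 2 * Real.pi := Real.two_pi_pos
    calc ENNReal.ofReal (ε ^ 2 / (2 * Real.pi)) * ENNReal.ofReal ρ⁻¹
        = ENNReal.ofReal (2 * Real.pi)⁻¹ * ENNReal.ofReal ρ⁻¹ * ENNReal.ofReal ε ^ 2 := by
          rw [← ENNReal.ofReal_pow hε.le, ← ENNReal.ofReal_mul (by positivity),
            ← ENNReal.ofReal_mul (by positivity), ← ENNReal.ofReal_mul]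
          · congr 1; field_simp
          · have := hρ.1; positivity
      _ ≤ ENNReal.ofReal (2 * Real.pi)⁻¹ * ENNReal.ofReal ρ⁻¹ * (ENNReal.ofReal (2 * Real.pi) *
          (ENNReal.ofReal ρ * ∫⁻ θ in Ioo (-Real.pi) Real.pi, ENNReal.ofReal ρ * F (e ρ θ) ^ 2)) := by
          gcongr
      _ = (ENNReal.ofReal (2 * Real.pi)⁻¹ * ENNReal.ofReal (2 * Real.pi)) *
          (ENNReal.ofReal ρ⁻¹ * ENNReal.ofReal ρ) *
          ∫⁻ θ in Ioo (-Real.pi) Real.pi, ENNReal.ofReal ρ * F (e ρ θ) ^ 2 := by ring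
      _ = _ := by
          rw [← ENNReal.ofReal_mul (by positivity), ← ENNReal.ofReal_mul (inv_nonneg.2 hρ.1.le),
            inv_mul_cancel₀ hpi.ne', inv_mul_cancel₀ hρ.1.ne']
          simp
  have htop : ∫⁻ ρ in Ioo 0 δ, ENNReal.ofReal (ε ^ 2 / (2 * Real.pi)) * ENNReal.ofReal ρ⁻¹ = ⊤ := by
    rw [lintegral_const_mul _ (by fun_prop), lintegral_inv_eq_top hδ, ENNReal.mul_top]
    simp only [ne_eq, ENNReal.ofReal_eq_zero, not_le]
    have := Real.pi_pos
    positivity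
  have : (⊤ : ENNReal) ≤ ∫⁻ z, F z ^ 2 := by
    rw [← htop, ← hpolar]
    exact (setLIntegral_mono' measurableSet_Ioo hlow).trans
      (lintegral_mono_set Ioo_subset_Ioi_self)
  exact absurd hfin (not_lt.2 this)

/-! ### Jordan curves and Carathéodory's theorem. -/

/-- Local connectedness of a Jordan curve: small subsets lie in small connected subsets. -/
lemma exists_small_connected_of_jordanCurve {S : Set ℂ} {c : Circle → ℂ} (hc : Continuous c)
    (hinj : Function.Injective c) (hS : range c = S) {ε : ℝ} (hε : 0 < ε) :
    ∃ η > 0, ∀ (E : Set ℂ) (a : ℂ), E ⊆ S → E ⊆ closedBall a η →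
      ∃ σ, IsCompact σ ∧ IsPreconnected σ ∧ σ ⊆ S ∧ E ⊆ σ ∧ σ ⊆ closedBall a ε := by
  -- The constants are chosen backwards: c moves points less than ε/2 over distances below τ,
  -- rotations by angles up to τ' move points less than τ, unit numbers within κ of 1 have argument
  -- at most τ', and images closer than η come from points closer than κ.
  obtain ⟨τ, hτ, hτc⟩ : ∃ τ > 0, ∀ x y : Circle, dist x y < τ → dist (c x) (c y) < ε / 2 :=
    Metric.uniformContinuous_iff.1 (CompactSpace.uniformContinuous_of_continuous hc) _ (half_pos hε)
      |>.imp fun τ h => ⟨h.1, fun x y hxy => h.2 hxy⟩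
  obtain ⟨τ', hτ', hexp⟩ : ∃ τ' > 0, ∀ s : ℝ, |s| ≤ τ' → dist (Circle.exp s) 1 < τ := by
    have h1 : ContinuousAt (fun s : ℝ => Circle.exp s) 0 := by fun_prop
    obtain ⟨r, hr, h⟩ := Metric.continuousAt_iff.1 h1 τ hτ
    refine ⟨r / 2, half_pos hr, fun s hs => ?_⟩
    have := h (x := s) (by rw [dist_zero_right, Real.norm_eq_abs]; linarith)
    simpa using this
  obtain ⟨κ, hκ, harg⟩ : ∃ κ > 0, ∀ z : Circle, dist z 1 < κ → |Complex.arg z| ≤ τ' := by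
    have h1 : ContinuousAt Complex.arg 1 := Complex.continuousAt_arg (by simp)
    obtain ⟨r, hr, h⟩ := Metric.continuousAt_iff.1 h1 τ' hτ'
    refine ⟨r, hr, fun z hz => ?_⟩
    have := h (x := (z : ℂ)) hz
    rw [Complex.arg_one, dist_zero_right, Real.norm_eq_abs] at this
    exact this.le
  -- Uniform continuity of the inverse of c: on the compact set of pairs at distance at least κ the
  -- distance of the images attains its minimum, which is positive by injectivity.
  obtain ⟨η, hη, hηc⟩ : ∃ η > 0, ∀ x y : Circle, dist (c x) (c y) < η → dist x y < κ := by
    let K : Set (Circle × Circle) := {p | κ ≤ dist p.1 p.2}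
    have hK : IsCompact K := (isClosed_le continuous_const (by fun_prop)).isCompact
    by_cases hne : K.Nonempty
    · obtain ⟨p, hp, hmin⟩ := hK.exists_isMinOn hne
        (f := fun p => dist (c p.1) (c p.2)) (by fun_prop)
      refine ⟨dist (c p.1) (c p.2), ?_, fun x y h => ?_⟩
      · rw [gt_iff_lt, dist_pos]
        intro h
        have : κ ≤ dist p.1 p.2 := hp
        rw [hinj h, dist_self] at this
        linarith
      · by_contra hcon
        have := hmin (show (x, y) ∈ K from not_lt.1 hcon)
        exact absurd h (not_lt.2 this)
    · refine ⟨1, one_pos, fun x y _ => ?_⟩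
      by_contra hcon
      exact hne ⟨(x, y), not_lt.1 hcon⟩
  -- With η/4, any two points of E are less than η apart. With ε/2, a point of E is within ε/2 of a,
  -- which leaves ε/2 for the arc around it.
  refine ⟨min (η / 4) (ε / 2), by positivity, fun E a hES hEa => ?_⟩
  by_cases hE : E = ∅
  · subst hE
    exact ⟨∅, isCompact_empty, isPreconnected_empty, empty_subset _, subset_rfl, empty_subset _⟩
  obtain ⟨e, he⟩ := nonempty_iff_ne_empty.2 hE
  obtain ⟨x, rfl⟩ : e ∈ range c := hS ▸ hES he
  have hcont : Continuous fun s : ℝ => c (x * Circle.exp s) := by fun_prop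
  refine ⟨(fun s : ℝ => c (x * Circle.exp s)) '' Icc (-τ') τ', isCompact_Icc.image hcont,
    isPreconnected_Icc.image _ hcont.continuousOn, ?_, ?_, ?_⟩
  · rintro _ ⟨s, -, rfl⟩
    exact hS ▸ mem_range_self _
  · intro e' he'
    obtain ⟨y, rfl⟩ : e' ∈ range c := hS ▸ hES he'
    have h1 : dist (c y) (c x) < η := by
      have h2 := hEa he'
      have h3 := hEa he
      rw [mem_closedBall] at h2 h3
      have h4 := dist_triangle_right (c y) (c x) a
      have := min_le_left (η / 4) (ε / 2)
      linarith
    have h2 := hηc _ _ h1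
    have h3 : dist (y / x) 1 < κ := by
      have : dist (y / x) 1 = dist y x := by
        change dist ((y / x : Circle) : ℂ) ((1 : Circle) : ℂ) = dist (y : ℂ) x
        simp only [Circle.coe_div, Circle.coe_one, dist_eq_norm]
        have hx : (x : ℂ) ≠ 0 := Circle.coe_ne_zero x
        have : (y : ℂ) - x = (y / x - 1) * x := by field_simp
        rw [this, norm_mul, Circle.norm_coe, mul_one]
      rwa [this]
    have h4 := abs_le.1 (harg _ h3)
    refine ⟨Complex.arg ((y / x : Circle) : ℂ), h4, ?_⟩
    simp only [Circle.exp_arg, mul_div_cancel]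
  · rintro _ ⟨s, hs, rfl⟩
    have h1 : dist (x * Circle.exp s) x < τ := by
      have h2 := hexp s (abs_le.2 hs)
      have : dist (x * Circle.exp s) x = dist (Circle.exp s) 1 := by
        change dist ((x * Circle.exp s : Circle) : ℂ) (x : ℂ) =
          dist ((Circle.exp s : Circle) : ℂ) ((1 : Circle) : ℂ)
        simp only [Circle.coe_mul, Circle.coe_one, dist_eq_norm]
        have : (x : ℂ) * Circle.exp s - x = x * (Circle.exp s - 1) := by ring
        rw [this, norm_mul, Circle.norm_coe, one_mul]
      rwa [this]
    have h2 := hτc _ _ h1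
    have h3 := hEa he
    rw [mem_closedBall] at h3 ⊢
    have := min_le_right (η / 4) (ε / 2)
    have := dist_triangle (c (x * Circle.exp s)) (c x) a
    linarith

lemma IsPreconnected.subset_of_disjoint_frontier {P D : Set ℂ} (hP : IsPreconnected P)
    (hD : IsOpen D) (hf : Disjoint P (frontier D)) (hne : (P ∩ D).Nonempty) : P ⊆ D := by
  refine hP.subset_of_closure_inter_subset hD hne fun z hz => ?_
  by_contra h
  exact hf.ne_of_mem hz.2 (hD.frontier_eq ▸ ⟨hz.1, h⟩ : z ∈ frontier D) rfl

/-- A conformal map onto a Jordan domain maps small neighbourhoods of a boundary point of the disk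
to small sets. -/
lemma exists_image_subset_closedBall {D : Set ℂ} (hD : IsJordanDomain D) {φ : ℂ → ℂ}
    (hφ : IsConformalFromDisk φ D) {ζ : ℂ} (hζ : ‖ζ‖ = 1) {ε : ℝ} (hε : 0 < ε)
    (hε' : 2 * ε < dist (φ 0) (φ (-ζ / 2))) :
    ∃ a, ∃ ρ > 0, ∀ z ∈ ball (0 : ℂ) 1, dist z ζ < ρ → φ z ∈ closedBall a ε := by
  obtain ⟨hDo, hDc, hDb, c, hc, hcinj, hcr⟩ := hD
  obtain ⟨hφd, hφb⟩ := hφ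
  obtain ⟨η, hη, hησ⟩ := exists_small_connected_of_jordanCurve hc hcinj hcr hε
  have hζ0 : ζ ≠ 0 := by rw [← norm_pos_iff, hζ]; exact one_pos
  have hmap : ∀ z, ζ * (1 - z) ∈ ball (0 : ℂ) 1 ↔ z ∈ ball (1 : ℂ) 1 := fun z => by
    simp [dist_eq_norm, hζ, norm_sub_rev]
  -- The disk is moved so that ζ becomes the boundary point 0 of the disk with centre 1; circles
  -- about ζ become circles about 0 of the same radius.
  let ψ : ℂ → ℂ := fun z => φ (ζ * (1 - z))
  have hψd : DifferentiableOn ℂ ψ (ball 1 1) :=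
    hφd.comp (by fun_prop) fun z hz => (hmap z).2 hz
  have hψi : InjOn ψ (ball 1 1) := fun z hz w hw h => by
    have := hφb.injOn ((hmap z).2 hz) ((hmap w).2 hw) h
    have := mul_left_cancel₀ hζ0 this
    linear_combination -this
  have hψb : Bornology.IsBounded (ψ '' ball 1 1) := hDb.subset <| by
    rintro _ ⟨z, hz, rfl⟩
    exact hφb.mapsTo ((hmap z).2 hz)
  obtain ⟨ρ, hρ, hρ2, hosc⟩ := exists_small_arc_oscillation hψd hψi hψb (lt_min hη hε) one_half_pos
  have hosc' : ∀ z₁ ∈ ball (0 : ℂ) 1, ∀ z₂ ∈ ball (0 : ℂ) 1, dist z₁ ζ = ρ → dist z₂ ζ = ρ →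
      ‖φ z₁ - φ z₂‖ ≤ min η ε := by
    intro z₁ h₁ z₂ h₂ e₁ e₂
    have hz : ∀ z, ζ * (1 - (1 - z / ζ)) = z := fun z => by field_simp; ring
    have hn : ∀ z, ‖1 - z / ζ‖ = dist z ζ := fun z => by
      have : 1 - z / ζ = (ζ - z) / ζ := by field_simp
      rw [this, norm_div, hζ, div_one, dist_eq_norm, norm_sub_rev]
    have := hosc (1 - z₁ / ζ) (by rw [← hmap, hz]; exact h₁) (1 - z₂ / ζ)
      (by rw [← hmap, hz]; exact h₂) (by rw [hn, e₁]) (by rw [hn, e₂])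
    simpa only [ψ, hz] using this
  let N : Set ℂ := ball 0 1 ∩ {z | dist z ζ = ρ}
  let C : Set ℂ := φ '' N
  have hp : ζ * (1 - ρ) ∈ N := by
    refine ⟨(hmap _).2 ?_, ?_⟩
    · rw [mem_ball, dist_eq_norm]
      have : (ρ : ℂ) - 1 = ((ρ - 1 : ℝ) : ℂ) := by push_cast; ring
      rw [this, Complex.norm_real, Real.norm_eq_abs, abs_lt]
      constructor <;> linarith
    · show dist _ _ = _
      have : ζ * (1 - ρ) - ζ = -(ζ * ρ) := by ring
      rw [dist_eq_norm, this, norm_neg, norm_mul, hζ, one_mul, Complex.norm_real, Real.norm_eq_abs,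
        abs_of_pos hρ]
  let a : ℂ := φ (ζ * (1 - ρ))
  have hCa : closure C ⊆ closedBall a (min η ε) := by
    refine closure_minimal ?_ isClosed_closedBall
    rintro _ ⟨z, hz, rfl⟩
    rw [mem_closedBall, dist_eq_norm]
    exact hosc' z hz.1 _ hp.1 hz.2 hp.2
  -- C is the image of a circular crosscut around ζ and has small diameter. The boundary points in
  -- its closure are captured by a small connected piece σ of the Jordan curve, so that C together
  -- with σ acts as a small barrier.
  obtain ⟨σ, hσc, hσp, hσD, hCσ, hσa⟩ := hησ (closure C ∩ frontier D) a inter_subset_right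
    (inter_subset_left.trans (hCa.trans (closedBall_subset_closedBall (min_le_left _ _))))
  refine ⟨a, ρ, hρ, fun z hz hzρ => ?_⟩
  by_contra hza
  have h0 : (0 : ℂ) ∈ ball (0 : ℂ) 1 := by simp
  have h1 : -ζ / 2 ∈ ball (0 : ℂ) 1 := by
    rw [mem_ball_zero_iff, norm_div, norm_neg, hζ]; norm_num
  -- A reference point beyond the crosscut whose image lies outside the ball. Since the images of 0
  -- and -ζ/2 are more than 2ε apart, one of the two points will do; both are farther than 1/2 > ρ
  -- from ζ.
  obtain ⟨z₀, hz₀, hz₀ρ, hz₀a⟩ : ∃ z₀ ∈ ball (0 : ℂ) 1, ρ < dist z₀ ζ ∧ φ z₀ ∉ closedBall a ε := by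
    by_cases h : φ 0 ∈ closedBall a ε
    · refine ⟨-ζ / 2, h1, ?_, fun h' => ?_⟩
      · have : -ζ / 2 - ζ = -(3 / 2) * ζ := by ring
        rw [dist_eq_norm, this, norm_mul, hζ]
        norm_num
        linarith
      · rw [mem_closedBall] at h h'
        have := dist_triangle_right (φ 0) (φ (-ζ / 2)) a
        linarith
    · refine ⟨0, h0, ?_, h⟩
      rw [dist_zero_left, hζ]; linarith
  have hVf : Disjoint D (frontier D) := by
    rw [hDo.frontier_eq]; exact disjoint_sdiff_right
  let B : Set ℂ := closure C ∪ σ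
  have hBcl : IsClosed B := isClosed_closure.union hσc.isClosed
  have hBa : B ⊆ closedBall a ε :=
    union_subset (hCa.trans (closedBall_subset_closedBall (min_le_right _ _))) hσa
  have hAB : frontier D ∩ B = σ := by
    apply Subset.antisymm
    · rintro x ⟨hx, hx' | hx'⟩
      · exact hCσ ⟨hx', hx⟩
      · exact hx'
    · exact fun x hx => ⟨hσD hx, Or.inr hx⟩
  have hwD : φ z ∈ D := hφb.mapsTo hz
  have hw0D : φ z₀ ∈ D := hφb.mapsTo hz₀
  set P := connectedComponentIn (frontier D ∪ B)ᶜ (φ z) with hP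
  have hPX : P ⊆ (frontier D ∪ B)ᶜ := connectedComponentIn_subset _ _
  have hwP : φ z ∈ P := mem_connectedComponentIn fun h => h.elim
    (fun h => hVf.ne_of_mem hwD h rfl) fun h => hza (hBa h)
  have hPp : IsPreconnected P := isPreconnected_connectedComponentIn
  have hPD : P ⊆ D := by
    refine hPp.subset_of_disjoint_frontier hDo ?_ ⟨_, hwP, hwD⟩
    exact disjoint_left.2 fun x hx hx' => hPX hx (Or.inl hx')
  -- Janiszewski's theorem applies because the barrier meets ∂D exactly in the connected set σ. So
  -- the images of z and z₀ are connected inside D off the barrier, although the crosscut separates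
  -- z from z₀ in the disk; this is the contradiction.
  have hw0P : φ z₀ ∈ P := mem_connectedComponentIn_union isClosed_frontier hBcl
    (by rw [hAB]; exact hσp) hDc.isPreconnected hVf hwD hw0D hBa hza hz₀a (hDb.subset hPD)
  have hopen : ∀ s ⊆ ball (0 : ℂ) 1, IsOpen s → IsOpen (φ '' s) := by
    have := (hφd.analyticOnNhd isOpen_ball).is_constant_or_isOpen
      (convex_ball (0 : ℂ) 1).isPreconnected
    refine this.resolve_left ?_
    rintro ⟨w, hw⟩
    rw [hw 0 h0, hw _ h1, dist_self] at hε'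
    linarith
  let D₁ := φ '' (ball 0 1 ∩ {z | dist z ζ < ρ})
  let D₂ := φ '' (ball 0 1 ∩ {z | ρ < dist z ζ})
  have hD₁ : IsOpen D₁ := hopen _ inter_subset_left
    (isOpen_ball.inter (isOpen_lt (by fun_prop) continuous_const))
  have hD₂ : IsOpen D₂ := hopen _ inter_subset_left
    (isOpen_ball.inter (isOpen_lt continuous_const (by fun_prop)))
  have hcov : P ⊆ D₁ ∪ D₂ := by
    intro x hx
    obtain ⟨u, hu, rfl⟩ := hφb.surjOn (hPD hx)
    rcases lt_trichotomy (dist u ζ) ρ with h | h | h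
    · exact Or.inl ⟨u, ⟨hu, h⟩, rfl⟩
    · exact (hPX hx (Or.inr (Or.inl (subset_closure ⟨u, ⟨hu, h⟩, rfl⟩)))).elim
    · exact Or.inr ⟨u, ⟨hu, h⟩, rfl⟩
  obtain ⟨x, -, ⟨u, hu, rfl⟩, ⟨v, hv, hvu⟩⟩ := hPp D₁ D₂ hD₁ hD₂ hcov
    ⟨_, hwP, ⟨z, ⟨hz, hzρ⟩, rfl⟩⟩ ⟨_, hw0P, ⟨z₀, ⟨hz₀, hz₀ρ⟩, rfl⟩⟩
  have := hφb.injOn hv.1 hu.1 hvu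
  subst this
  exact lt_asymm (show dist _ ζ < ρ from hu.2) hv.2

/-- Carathéodory's theorem: a conformal map onto a Jordan domain has limits at all boundary points
of the disk. -/
theorem exists_tendsto_of_isJordanDomain {D : Set ℂ} (hD : IsJordanDomain D) {φ : ℂ → ℂ}
    (hφ : IsConformalFromDisk φ D) {ζ : ℂ} (hζ : ‖ζ‖ = 1) :
    ∃ w, Tendsto φ (𝓝[ball 0 1] ζ) (𝓝 w) := by
  have hne : (𝓝[ball (0 : ℂ) 1] ζ).NeBot := by
    rw [← mem_closure_iff_nhdsWithin_neBot, closure_ball _ one_ne_zero]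
    simp [hζ]
  have hd : 0 < dist (φ 0) (φ (-ζ / 2)) := by
    rw [dist_pos]
    intro h
    have := hφ.2.injOn (by simp) (by rw [mem_ball_zero_iff, norm_div, norm_neg, hζ]; norm_num) h
    have : ζ = 0 := by linear_combination 2 * this
    rw [this, norm_zero] at hζ
    exact zero_ne_one hζ
  apply cauchy_map_iff_exists_tendsto.1
  rw [Metric.cauchy_iff]
  refine ⟨inferInstance, fun ε hε => ?_⟩
  -- Two points of a ball of radius ε/3 are less than ε apart, as the Cauchy criterion requires. The
  -- other bound keeps the images of the two reference points from both lying in the ball.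
  obtain ⟨a, ρ, hρ, h⟩ := exists_image_subset_closedBall hD hφ hζ
    (ε := min (ε / 3) (dist (φ 0) (φ (-ζ / 2)) / 3)) (by positivity)
    (by have := min_le_right (ε / 3) (dist (φ 0) (φ (-ζ / 2)) / 3); linarith)
  refine ⟨closedBall a (min (ε / 3) (dist (φ 0) (φ (-ζ / 2)) / 3)), ?_, fun x hx y hy => ?_⟩
  · rw [mem_map]
    filter_upwards [self_mem_nhdsWithin, mem_nhdsWithin_of_mem_nhds (ball_mem_nhds ζ hρ)]
      with z hz hz' using h z hz hz'
  · rw [mem_closedBall] at hx hy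
    have := dist_triangle_right x y a
    have := min_le_left (ε / 3) (dist (φ 0) (φ (-ζ / 2)) / 3)
    linarith

/-- Every boundary point of a Jordan domain is the endpoint of the image of a radius. -/
theorem exists_radial_limit_of_mem_frontier {D : Set ℂ} (hD : IsJordanDomain D) {φ : ℂ → ℂ}
    (hφ : IsConformalFromDisk φ D) {x : ℂ} (hx : x ∈ frontier D) :
    ∃ ζ : ℂ, ‖ζ‖ = 1 ∧ Tendsto (fun r : ℝ => φ (r * ζ)) (𝓝[<] 1) (𝓝 x) := by
  have hDo := hD.1
  obtain ⟨y, hyD, hy⟩ := mem_closure_iff_seq_limit.1 (frontier_subset_closure hx)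
  have hsurj : ∀ n, ∃ z ∈ ball (0 : ℂ) 1, φ z = y n := fun n => hφ.2.surjOn (hyD n)
  choose z hz hzy using hsurj
  -- Preimages of points tending to x accumulate at some ζ, which cannot lie in the open disk
  -- because x is not in D. The full limit of φ at ζ must then be x, and in particular the radial
  -- limit.
  obtain ⟨ζ, hζ, k, hk, hlim⟩ := (isCompact_closedBall (0 : ℂ) 1).tendsto_subseq
    fun n => ball_subset_closedBall (hz n)
  have hyk : Tendsto (fun n => φ (z (k n))) atTop (𝓝 x) := by
    simp_rw [hzy]; exact hy.comp hk.tendsto_atTop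
  have hζ1 : ‖ζ‖ = 1 := by
    by_contra hne
    have hlt : ζ ∈ ball (0 : ℂ) 1 := by
      rw [mem_ball_zero_iff]
      exact lt_of_le_of_ne (by simpa using hζ) hne
    have hc := (hφ.1.differentiableAt (isOpen_ball.mem_nhds hlt)).continuousAt
    have := tendsto_nhds_unique (hc.tendsto.comp hlim) hyk
    rw [hDo.frontier_eq] at hx
    exact hx.2 (this ▸ hφ.2.mapsTo hlt)
  obtain ⟨w, hw⟩ := exists_tendsto_of_isJordanDomain hD hφ hζ1
  have hwx : w = x := tendsto_nhds_unique (hw.comp (tendsto_nhdsWithin_iff.2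
    ⟨hlim, Eventually.of_forall fun n => hz (k n)⟩)) hyk
  refine ⟨ζ, hζ1, hwx ▸ hw.comp (tendsto_nhdsWithin_iff.2 ⟨?_, ?_⟩)⟩
  · have : Continuous fun r : ℝ => (r : ℂ) * ζ := by fun_prop
    have := this.tendsto 1
    simp only [Complex.ofReal_one, one_mul] at this
    exact this.mono_left nhdsWithin_le_nhds
  · filter_upwards [Ioo_mem_nhdsLT (zero_lt_one' ℝ)] with r hr
    rw [mem_ball_zero_iff, norm_mul, hζ1, mul_one, Complex.norm_real, Real.norm_eq_abs,
      abs_of_pos hr.1]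
    exact hr.2

/-! ### Primitives across closed null sets of the line. -/

/-- A function of one variable whose increments are controlled by the integral of `k` maps an open
set to a set of measure at most the integral of `k` over it. -/
lemma volume_image_le_lintegral {O : Set ℝ} (hO : IsOpen O) {q : ℝ → ℝ} {k : ℝ → ENNReal}
    (h : ∀ c d, c ≤ d → Icc c d ⊆ O → ENNReal.ofReal |q d - q c| ≤ ∫⁻ x in Icc c d, k x) :
    volume (q '' O) ≤ ∫⁻ x in O, k x := by
  -- The open set splits into countably many open intervals, and the image of each has diameter at
  -- most the integral of k over it.
  let 𝒞 : Set (Set ℝ) := (fun x => connectedComponentIn O x) '' O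
  have hopen : ∀ I ∈ 𝒞, IsOpen I := by
    rintro _ ⟨x, -, rfl⟩; exact hO.connectedComponentIn
  have hdisj : 𝒞.PairwiseDisjoint id := by
    rintro _ ⟨x, -, rfl⟩ _ ⟨y, -, rfl⟩ hne
    refine disjoint_left.2 fun z hz hz' => hne ?_
    simp only [id] at hz hz' ⊢
    rw [connectedComponentIn_eq hz, connectedComponentIn_eq hz']
  have hcount : 𝒞.Countable := hdisj.countable_of_isOpen hopen (by
    rintro _ ⟨x, hx, rfl⟩; exact ⟨x, mem_connectedComponentIn hx⟩)
  have hU : O = ⋃ I ∈ 𝒞, I := by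
    apply Subset.antisymm
    · intro x hx
      exact mem_biUnion (mem_image_of_mem _ hx) (mem_connectedComponentIn hx)
    · refine iUnion₂_subset ?_
      rintro _ ⟨x, -, rfl⟩; exact connectedComponentIn_subset _ _
  have hI : ∀ I ∈ 𝒞, volume (q '' I) ≤ ∫⁻ x in I, k x := by
    rintro _ ⟨x, hx, rfl⟩
    have hoc : OrdConnected (connectedComponentIn O x) :=
      isPreconnected_connectedComponentIn.ordConnected
    refine (Real.volume_le_diam _).trans (Metric.ediam_le ?_)
    have key : ∀ c ∈ connectedComponentIn O x, ∀ d ∈ connectedComponentIn O x, c ≤ d →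
        edist (q d) (q c) ≤ ∫⁻ x in connectedComponentIn O x, k x := by
      intro c hc d hd hcd
      rw [edist_dist, Real.dist_eq]
      exact (h c d hcd ((hoc.out hc hd).trans (connectedComponentIn_subset _ _))).trans
        (lintegral_mono_set (hoc.out hc hd))
    rintro _ ⟨c, hc, rfl⟩ _ ⟨d, hd, rfl⟩
    rcases le_total c d with hcd | hcd
    · rw [edist_comm]; exact key c hc d hd hcd
    · exact key d hd c hc hcd
  calc volume (q '' O) = volume (⋃ I ∈ 𝒞, q '' I) := by rw [← image_iUnion₂, ← hU]
    _ ≤ ∑' I : 𝒞, volume (q '' (I : Set ℝ)) := measure_biUnion_le _ hcount _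
    _ ≤ ∑' I : 𝒞, ∫⁻ x in (I : Set ℝ), k x := ENNReal.tsum_le_tsum fun I => hI I I.2
    _ = ∫⁻ x in ⋃ I ∈ 𝒞, I, k x :=
      (lintegral_biUnion hcount (fun I hI => (hopen I hI).measurableSet) hdisj k).symm
    _ = ∫⁻ x in O, k x := by rw [← hU]

/-- By the intermediate value theorem the image contains the interval between the two end values. -/
lemma ofReal_abs_sub_le_volume_image {q : ℝ → ℝ} (hq : Continuous q) {c d : ℝ} (hcd : c ≤ d) :
    ENNReal.ofReal |q d - q c| ≤ volume (q '' Icc c d) := by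
  rw [← Real.volume_interval]
  refine measure_mono ?_
  have := intermediate_value_uIcc (a := c) (b := d) (f := q) hq.continuousOn
  rwa [uIcc_of_le hcd] at this

/-- Discarding the two end points costs nothing and leaves, off a closed E, an open set to which
`volume_image_le_lintegral` applies. -/
lemma volume_image_Icc_le {q : ℝ → ℝ} {E : Set ℝ} {a b : ℝ} :
    volume (q '' Icc a b) ≤ volume (q '' (E ∩ Icc a b)) + volume (q '' (Ioo a b \ E)) := by
  have hsub : q '' Icc a b ⊆ (q '' (E ∩ Icc a b) ∪ q '' (Ioo a b \ E)) ∪ {q a, q b} := by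
    rintro _ ⟨x, hx, rfl⟩
    by_cases hE : x ∈ E
    · exact Or.inl (Or.inl ⟨x, ⟨hE, hx⟩, rfl⟩)
    · rcases eq_or_lt_of_le hx.1 with h1 | h1
      · right; left; rw [h1]
      · rcases eq_or_lt_of_le hx.2 with h2 | h2
        · right; right; rw [h2]; rfl
        · exact Or.inl (Or.inr ⟨x, ⟨⟨h1, h2⟩, hE⟩, rfl⟩)
  have h0 : volume ({q a, q b} : Set ℝ) = 0 := ((finite_singleton _).insert _).measure_zero _
  calc _ ≤ _ := measure_mono hsub
    _ ≤ _ := measure_union_le _ _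
    _ ≤ _ := by rw [h0, add_zero]; exact measure_union_le _ _

lemma ofReal_abs_intervalIntegral_le {g : ℝ → ℝ} {c d : ℝ} (hcd : c ≤ d) :
    ENNReal.ofReal |∫ x in c..d, g x| ≤ ∫⁻ x in Icc c d, ‖g x‖ₑ := by
  rw [intervalIntegral.integral_of_le hcd, ← Real.norm_eq_abs, ofReal_norm]
  exact (enorm_integral_le_lintegral_enorm _).trans (lintegral_mono_set Ioc_subset_Icc_self)

/-- A continuous function which is a primitive of `g` off a closed null set `E` is a primitive of
`g` everywhere, provided that the image of `E` is a null set. -/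
theorem sub_eq_intervalIntegral_of_volume_image_eq_zero {q g : ℝ → ℝ} {E : Set ℝ}
    (hq : Continuous q) (hg : LocallyIntegrable g) (hE : IsClosed E) (hE0 : volume E = 0)
    (hqE : volume (q '' E) = 0)
    (h : ∀ c d, c ≤ d → Disjoint (Icc c d) E → q d - q c = ∫ x in c..d, g x)
    {a b : ℝ} (hab : a ≤ b) : q b - q a = ∫ x in a..b, g x := by
  have hii : ∀ c d, IntervalIntegrable g volume c d := fun c d =>
    (hg.integrableOn_isCompact isCompact_uIcc).intervalIntegrable
  have hsub : ∀ {c d c' d' : ℝ}, Icc c d ⊆ Ioo c' d' \ E → Disjoint (Icc c d) E := fun h =>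
    disjoint_left.2 fun x hx => (h hx).2
  -- The image of E contributes nothing and the rest is estimated component by component, so the
  -- increments of q are bounded by ∫ |g| even across E.
  have step1 : ∀ c d, c ≤ d → ENNReal.ofReal |q d - q c| ≤ ∫⁻ x in Icc c d, ‖g x‖ₑ := by
    intro c d hcd
    refine (ofReal_abs_sub_le_volume_image hq hcd).trans ((volume_image_Icc_le (E := E)).trans ?_)
    rw [measure_mono_null (image_mono inter_subset_left) hqE, zero_add]
    refine (volume_image_le_lintegral (k := fun x => ‖g x‖ₑ) (isOpen_Ioo.sdiff hE) ?_).trans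
      (lintegral_mono_set (sdiff_subset.trans Ioo_subset_Icc_self))
    intro c' d' hcd' hs
    rw [h c' d' hcd' (hsub hs)]
    exact ofReal_abs_intervalIntegral_le hcd'
  -- H is constant on each component of the complement of E. It remains to see that H(E) is null as
  -- well: then H maps the interval to a null set and has equal end values.
  let H : ℝ → ℝ := fun x => q x - ∫ t in (0 : ℝ)..x, g t
  have hHc : Continuous H := hq.sub (intervalIntegral.continuous_primitive hii 0)
  have hHsub : ∀ c d, H d - H c = (q d - q c) - ∫ x in c..d, g x := fun c d => by
    have := intervalIntegral.integral_interval_sub_left (hii 0 d) (hii 0 c)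
    simp only [H]; rw [← this]; ring
  have step2 : ∀ c d, c ≤ d → ENNReal.ofReal |H d - H c| ≤ ∫⁻ x in Icc c d, 2 * ‖g x‖ₑ := by
    intro c d hcd
    rw [lintegral_const_mul' _ _ (by simp), two_mul, hHsub]
    refine (ENNReal.ofReal_le_ofReal (abs_sub _ _)).trans ?_
    rw [ENNReal.ofReal_add (abs_nonneg _) (abs_nonneg _)]
    exact add_le_add (step1 c d hcd) (ofReal_abs_intervalIntegral_le hcd)
  -- Here |E| = 0 is used: E lies in open sets of small measure, over which the integral of 2|g| is
  -- small, and this integral bounds the measure of the image under H.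
  have hHE : volume (H '' (E ∩ Icc a b)) = 0 := by
    have hint : ∫⁻ x in Ioo (a - 1) (b + 1), 2 * ‖g x‖ₑ ≠ ⊤ := by
      rw [lintegral_const_mul' _ _ (by simp)]
      refine ENNReal.mul_ne_top (by simp) ?_
      exact ((hg.integrableOn_isCompact isCompact_Icc).mono_set Ioo_subset_Icc_self).2.ne
    by_contra hne
    obtain ⟨δ, hδ, hδ'⟩ := exists_pos_setLIntegral_lt_of_measure_lt hint hne
    obtain ⟨O, hEO, hO, hOδ⟩ := E.exists_isOpen_lt_of_lt δ (by rw [hE0]; exact hδ)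
    have hO' : IsOpen (O ∩ Ioo (a - 1) (b + 1)) := hO.inter isOpen_Ioo
    have h1 : volume (H '' (O ∩ Ioo (a - 1) (b + 1))) < volume (H '' (E ∩ Icc a b)) := by
      refine (volume_image_le_lintegral hO' fun c d hcd _ => step2 c d hcd).trans_lt ?_
      rw [← Measure.restrict_restrict hO.measurableSet]
      exact hδ' O ((Measure.restrict_apply_le _ _).trans_lt hOδ)
    refine absurd h1 (not_lt.2 (measure_mono (image_mono ?_)))
    rintro x ⟨hx, hx'⟩
    exact ⟨hEO hx, by linarith [hx'.1], by linarith [hx'.2]⟩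
  have hHoff : volume (H '' (Ioo a b \ E)) = 0 := by
    have := volume_image_le_lintegral (q := H) (k := fun _ => 0) (isOpen_Ioo.sdiff hE) (O := Ioo a b \ E) ?_
    · simpa using this
    · intro c d hcd hs
      rw [hHsub, h c d hcd (hsub hs)]
      simp
  have h0 : ENNReal.ofReal |H b - H a| ≤ 0 := by
    refine (ofReal_abs_sub_le_volume_image hHc hab).trans ((volume_image_Icc_le (E := E)).trans ?_)
    rw [hHE, hHoff, zero_add]
  rw [nonpos_iff_eq_zero, ENNReal.ofReal_eq_zero] at h0
  have := abs_eq_zero.1 (le_antisymm h0 (abs_nonneg _))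
  rw [hHsub] at this
  linarith

/-- The complex-valued version. -/
theorem sub_eq_intervalIntegral_of_volume_image_eq_zero' {F g : ℝ → ℂ} {E : Set ℝ}
    (hF : Continuous F) (hg : LocallyIntegrable g) (hE : IsClosed E) (hE0 : volume E = 0)
    (hre : volume ((fun x => (F x).re) '' E) = 0) (him : volume ((fun x => (F x).im) '' E) = 0)
    (h : ∀ c d, c ≤ d → Disjoint (Icc c d) E → F d - F c = ∫ x in c..d, g x)
    {a b : ℝ} (hab : a ≤ b) : F b - F a = ∫ x in a..b, g x := by
  have hi : ∀ c d, IntervalIntegrable g volume c d := fun c d =>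
    (hg.integrableOn_isCompact isCompact_uIcc).intervalIntegrable
  have hreI : ∀ c d, (∫ x in c..d, g x).re = ∫ x in c..d, (g x).re := fun c d =>
    (Complex.reCLM.intervalIntegral_comp_comm (hi c d)).symm
  have himI : ∀ c d, (∫ x in c..d, g x).im = ∫ x in c..d, (g x).im := fun c d =>
    (Complex.imCLM.intervalIntegral_comp_comm (hi c d)).symm
  apply Complex.ext
  · rw [hreI, Complex.sub_re]
    refine sub_eq_intervalIntegral_of_volume_image_eq_zero (q := fun x => (F x).re)
      (Complex.continuous_re.comp hF) (fun x => (hg x).imp fun s hs => ⟨hs.1, hs.2.re⟩) hE hE0 hre (fun c d hcd hd => ?_) hab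
    rw [← hreI, ← h c d hcd hd, Complex.sub_re]
  · rw [himI, Complex.sub_im]
    refine sub_eq_intervalIntegral_of_volume_image_eq_zero (q := fun x => (F x).im)
      (Complex.continuous_im.comp hF) (fun x => (hg x).imp fun s hs => ⟨hs.1, hs.2.im⟩) hE hE0 him (fun c d hcd hd => ?_) hab
    rw [← himI, ← h c d hcd hd, Complex.sub_im]

/-! ### Fubini's theorem in the coordinates of the complex plane. -/

section Fubini

variable {E : Type*} [NormedAddCommGroup E]

lemma integrable_comp_equivRealProd_symm_iff {h : ℂ → E} :
    Integrable (fun p : ℝ × ℝ => h ⟨p.1, p.2⟩) (volume.prod volume) ↔ Integrable h :=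
  (Complex.volume_preserving_equiv_real_prod.symm _).integrable_comp_emb
    Complex.measurableEquivRealProd.symm.measurableEmbedding

lemma integral_eq_integral_integral_mk [NormedSpace ℝ E] {h : ℂ → E} (hh : Integrable h) :
    ∫ z, h z = ∫ y : ℝ, ∫ x : ℝ, h ⟨x, y⟩ := by
  rw [← integral_prod_symm _ (integrable_comp_equivRealProd_symm_iff.2 hh)]
  exact ((Complex.volume_preserving_equiv_real_prod.symm _).integral_comp
    Complex.measurableEquivRealProd.symm.measurableEmbedding h).symm

lemma ae_integrable_mk {h : ℂ → E} (hh : Integrable h) :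
    ∀ᵐ y : ℝ, Integrable fun x : ℝ => h ⟨x, y⟩ :=
  (integrable_comp_equivRealProd_symm_iff.2 hh).prod_left_ae

lemma integrable_integral_mk [NormedSpace ℝ E] {h : ℂ → E} (hh : Integrable h) :
    Integrable fun y : ℝ => ∫ x : ℝ, h ⟨x, y⟩ :=
  (integrable_comp_equivRealProd_symm_iff.2 hh).integral_prod_right

lemma measurable_complex_mk : Measurable fun p : ℝ × ℝ => (⟨p.1, p.2⟩ : ℂ) :=
  Complex.measurableEquivRealProd.symm.measurable

lemma lintegral_eq_lintegral_lintegral_mk {h : ℂ → ENNReal} (hh : AEMeasurable h) :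
    ∫⁻ z, h z = ∫⁻ y : ℝ, ∫⁻ x : ℝ, h ⟨x, y⟩ := by
  have hp := Complex.volume_preserving_equiv_real_prod.symm
  have h1 : AEMeasurable (fun p : ℝ × ℝ => h ⟨p.1, p.2⟩) (volume.prod volume) :=
    hh.comp_quasiMeasurePreserving hp.quasiMeasurePreserving
  rw [← lintegral_prod_symm _ h1]
  exact (hp.lintegral_comp_emb Complex.measurableEquivRealProd.symm.measurableEmbedding h).symm

end Fubini

/-! ### Smooth approximations of indicator functions of intervals. -/

section SmoothStep

lemma continuous_deriv_smoothTransition : Continuous (deriv Real.smoothTransition) :=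
  (Real.smoothTransition.contDiff (n := 1)).continuous_deriv le_rfl

lemma deriv_smoothTransition_eq_zero {x : ℝ} (hx : x ∉ Icc (0 : ℝ) 1) :
    deriv Real.smoothTransition x = 0 := by
  rcases not_and_or.1 hx with h | h
  · have : Real.smoothTransition =ᶠ[𝓝 x] fun _ => 0 := by
      filter_upwards [Iio_mem_nhds (not_le.1 h)] with y hy
      exact Real.smoothTransition.zero_of_nonpos (le_of_lt hy)
    rw [this.deriv_eq, deriv_const]
  · have : Real.smoothTransition =ᶠ[𝓝 x] fun _ => 1 := by
      filter_upwards [Ioi_mem_nhds (not_le.1 h)] with y hy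
      exact Real.smoothTransition.one_of_one_le (le_of_lt hy)
    rw [this.deriv_eq, deriv_const]

lemma integrable_deriv_smoothTransition : Integrable (deriv Real.smoothTransition) :=
  continuous_deriv_smoothTransition.integrable_of_hasCompactSupport
    (HasCompactSupport.intro isCompact_Icc fun _ hx => deriv_smoothTransition_eq_zero hx)

lemma integral_deriv_smoothTransition : ∫ x, deriv Real.smoothTransition x = 1 := by
  have h : ∫ x in (0 : ℝ)..1, deriv Real.smoothTransition x = 1 := by
    rw [intervalIntegral.integral_deriv_eq_sub
      (fun x _ => (Real.smoothTransition.contDiff (n := 1)).differentiable one_ne_zero x)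
      (continuous_deriv_smoothTransition.intervalIntegrable _ _)]
    simp
  rw [← h, intervalIntegral.integral_of_le zero_le_one, ← integral_Icc_eq_integral_Ioc]
  exact (setIntegral_eq_integral_of_forall_compl_eq_zero
    fun x hx => deriv_smoothTransition_eq_zero hx).symm

/-- The substitution x = a + εu. The derivative of a steep step acts as an average of h near a, of
total weight 1, which tends to h(a) as ε tends to 0. -/
lemma integral_deriv_smoothTransition_comp_smul {h : ℝ → ℂ} (a : ℝ) {ε : ℝ} (hε : 0 < ε) :
    ∫ x, (deriv Real.smoothTransition ((x - a) / ε) / ε) • h x =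
      ∫ u, deriv Real.smoothTransition u • h (a + ε * u) := by
  have h1 := Measure.integral_comp_mul_left
    (fun x => (deriv Real.smoothTransition (x / ε) / ε) • h (a + x)) ε
  have h2 := integral_sub_right_eq_self (μ := volume)
    (fun x => (deriv Real.smoothTransition (x / ε) / ε) • h (a + x)) a
  simp only [add_sub_cancel] at h2
  rw [h2]
  have h3 : ∀ x, (deriv Real.smoothTransition (ε * x / ε) / ε) • h (a + ε * x) =
      ε⁻¹ • (deriv Real.smoothTransition x • h (a + ε * x)) := fun x => by
    rw [mul_div_cancel_left₀ _ hε.ne', smul_smul, div_eq_inv_mul]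
  simp_rw [h3] at h1
  rw [integral_smul, abs_of_pos (inv_pos.2 hε)] at h1
  exact (smul_right_injective ℂ (inv_pos.2 hε).ne' h1).symm

lemma norm_integral_deriv_smoothTransition_smul_le {h : ℝ → ℂ} {M : ℝ} (hM : ∀ x, ‖h x‖ ≤ M) :
    ‖∫ u, deriv Real.smoothTransition u • h u‖ ≤
      (∫ u, ‖deriv Real.smoothTransition u‖) * M := by
  rw [← integral_mul_const]
  refine norm_integral_le_of_norm_le (integrable_deriv_smoothTransition.norm.mul_const M) ?_
  exact Eventually.of_forall fun u => by
    rw [norm_smul]; exact mul_le_mul_of_nonneg_left (hM u) (norm_nonneg _)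

lemma tendsto_integral_deriv_smoothTransition_smul {h : ℝ → ℂ} (hc : Continuous h) {M : ℝ}
    (hM : ∀ x, ‖h x‖ ≤ M) (a : ℝ) {ε : ℕ → ℝ} (hε : Tendsto ε atTop (𝓝 0)) :
    Tendsto (fun n => ∫ u, deriv Real.smoothTransition u • h (a + ε n * u)) atTop (𝓝 (h a)) := by
  have h1 : ∫ u, deriv Real.smoothTransition u • h a = h a := by
    rw [integral_smul_const, integral_deriv_smoothTransition, one_smul]
  rw [← h1]
  refine tendsto_integral_of_dominated_convergence
    (fun u => ‖deriv Real.smoothTransition u‖ * M) (fun n => ?_)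
    (integrable_deriv_smoothTransition.norm.mul_const M) (fun n => ?_) ?_
  · have := continuous_deriv_smoothTransition
    exact Continuous.aestronglyMeasurable (by fun_prop)
  · exact Eventually.of_forall fun u => by
      rw [norm_smul]; exact mul_le_mul_of_nonneg_left (hM _) (norm_nonneg _)
  · refine Eventually.of_forall fun u => ?_
    refine Tendsto.const_smul ?_ _
    refine (hc.tendsto a).comp ?_
    simpa using (hε.mul_const u).const_add a

/-- A smooth approximation of the indicator function of `[a, b]`. -/
noncomputable def smoothStep (a b ε x : ℝ) : ℝ :=
  Real.smoothTransition ((x - a) / ε) - Real.smoothTransition ((x - b) / ε)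

lemma contDiff_smoothStep (a b ε : ℝ) : ContDiff ℝ ∞ (smoothStep a b ε) := by
  unfold smoothStep
  have h : ContDiff ℝ ∞ Real.smoothTransition := Real.smoothTransition.contDiff
  exact (h.comp (by fun_prop)).sub (h.comp (by fun_prop))

lemma smoothStep_eq_zero {a b ε x : ℝ} (hε : 0 < ε) (hab : a ≤ b) (hx : x ∉ Icc a (b + ε)) :
    smoothStep a b ε x = 0 := by
  unfold smoothStep
  rcases not_and_or.1 hx with h | h
  · rw [Real.smoothTransition.zero_of_nonpos, Real.smoothTransition.zero_of_nonpos, sub_zero]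
    · exact div_nonpos_of_nonpos_of_nonneg (by linarith) hε.le
    · exact div_nonpos_of_nonpos_of_nonneg (by linarith) hε.le
  · rw [Real.smoothTransition.one_of_one_le, Real.smoothTransition.one_of_one_le, sub_self]
    · rw [le_div_iff₀ hε]; linarith
    · rw [le_div_iff₀ hε]; linarith

lemma abs_smoothStep_le_one (a b ε x : ℝ) : |smoothStep a b ε x| ≤ 1 := by
  unfold smoothStep
  rw [abs_le]
  constructor <;>
  linarith [Real.smoothTransition.nonneg ((x - a) / ε), Real.smoothTransition.le_one ((x - a) / ε),
    Real.smoothTransition.nonneg ((x - b) / ε), Real.smoothTransition.le_one ((x - b) / ε)]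

lemma deriv_smoothStep (a b ε x : ℝ) : deriv (smoothStep a b ε) x =
    deriv Real.smoothTransition ((x - a) / ε) / ε - deriv Real.smoothTransition ((x - b) / ε) / ε := by
  have h : ∀ y, HasDerivAt Real.smoothTransition (deriv Real.smoothTransition y) y := fun y =>
    ((Real.smoothTransition.contDiff (n := 1)).differentiable one_ne_zero y).hasDerivAt
  have h2 : ∀ a, HasDerivAt (fun x => Real.smoothTransition ((x - a) / ε))
      (deriv Real.smoothTransition ((x - a) / ε) / ε) x := fun a => by
    have := (h ((x - a) / ε)).comp x (((hasDerivAt_id x).sub_const a).div_const ε)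
    simpa [Function.comp_def, div_eq_mul_inv] using this
  exact ((h2 a).sub (h2 b)).deriv

/-- The limit is half open because `Real.smoothTransition` vanishes at 0: at x = a both terms
vanish, and at x = b the subtracted one still does. -/
lemma tendsto_smoothStep {a b : ℝ} (hab : a < b) {ε : ℕ → ℝ} (hε0 : ∀ n, 0 < ε n)
    (hε : Tendsto ε atTop (𝓝 0)) (x : ℝ) :
    Tendsto (fun n => smoothStep a b (ε n) x) atTop (𝓝 ((Ioc a b).indicator (fun _ => 1) x)) := by
  refine tendsto_const_nhds.congr' ?_
  have hz : ∀ c, x ≤ c → ∀ n, Real.smoothTransition ((x - c) / ε n) = 0 := fun c hc n =>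
    Real.smoothTransition.zero_of_nonpos
      (div_nonpos_of_nonpos_of_nonneg (by linarith) (hε0 n).le)
  have ho : ∀ c, c < x → ∀ᶠ n in atTop, Real.smoothTransition ((x - c) / ε n) = 1 := fun c hc => by
    filter_upwards [hε.eventually (gt_mem_nhds (sub_pos.2 hc))] with n hn
    exact Real.smoothTransition.one_of_one_le (by rw [le_div_iff₀ (hε0 n)]; linarith)
  unfold smoothStep
  rcases le_or_gt x a with h | h
  · refine Eventually.of_forall fun n => ?_
    simp only
    rw [hz a h, hz b (h.trans hab.le), indicator_of_notMem (fun h' => absurd h'.1 (not_lt.2 h)),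
      sub_zero]
  · rcases le_or_gt x b with h' | h'
    · have hmem : x ∈ Ioc a b := ⟨h, h'⟩
      filter_upwards [ho a h] with n hn
      rw [hn, hz b h', indicator_of_mem hmem, sub_zero]
    · filter_upwards [ho a h, ho b h'] with n hn hn'
      rw [hn, hn', indicator_of_notMem (fun h'' => absurd h''.2 (not_le.2 h')), sub_self]

end SmoothStep

/-! ### Weak derivatives and primitives on lines. -/

lemma continuous_complex_mk : Continuous fun p : ℝ × ℝ => (⟨p.1, p.2⟩ : ℂ) :=
  Complex.equivRealProdCLM.symm.continuous

lemma continuous_mk_left (y : ℝ) : Continuous fun x : ℝ => (⟨x, y⟩ : ℂ) :=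
  continuous_complex_mk.comp (by fun_prop : Continuous fun x : ℝ => (x, y))

lemma continuous_mk_right (x : ℝ) : Continuous fun y : ℝ => (⟨x, y⟩ : ℂ) :=
  continuous_complex_mk.comp (by fun_prop : Continuous fun y : ℝ => (x, y))

lemma hasFDerivAt_mul_re_im {α β : ℝ → ℝ} (hα : Differentiable ℝ α) (hβ : Differentiable ℝ β)
    (z : ℂ) : fderiv ℝ (fun z : ℂ => α z.re * β z.im) z 1 = deriv α z.re * β z.im := by
  have h1 : HasFDerivAt (fun z : ℂ => α z.re) (deriv α z.re • Complex.reCLM) z :=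
    (hα z.re).hasDerivAt.comp_hasFDerivAt z Complex.reCLM.hasFDerivAt
  have h2 : HasFDerivAt (fun z : ℂ => β z.im) (deriv β z.im • Complex.imCLM) z :=
    (hβ z.im).hasDerivAt.comp_hasFDerivAt z Complex.imCLM.hasFDerivAt
  have h3 : HasFDerivAt (fun z : ℂ => α z.re * β z.im) _ z := h1.mul h2
  rw [h3.fderiv]
  simp [mul_comm]

/-- Testing a weak derivative against products of a function of the ordinate and the indicator
function of an interval of abscissae. -/
lemma IsWeakDeriv.integral_rectangle {F g : ℂ → ℂ} {Ω : Set ℂ} (hF : Continuous F)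
    (hFs : HasCompactSupport F) (hg : Integrable g) (h : IsWeakDeriv F g 1 Ω)
    {x₀ x₁ x₂ y₀ y₁ : ℝ} (h01 : x₀ < x₁) (h12 : x₁ < x₂)
    (hR : ∀ x ∈ Icc x₀ x₂, ∀ y ∈ Icc y₀ y₁, (⟨x, y⟩ : ℂ) ∈ Ω)
    {β : ℝ → ℝ} (hβ : ContDiff ℝ ∞ β) (hβs : HasCompactSupport β) (hβR : tsupport β ⊆ Ioo y₀ y₁) :
    ∫ y, β y • (F ⟨x₁, y⟩ - F ⟨x₀, y⟩ - ∫ x in x₀..x₁, g ⟨x, y⟩) = 0 := by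
  obtain ⟨M, hM⟩ := hF.bounded_above_of_compact_support hFs
  obtain ⟨B, hB⟩ := hβ.continuous.bounded_above_of_compact_support hβs
  have hMh : ∀ y, ∀ x, ‖F ⟨x, y⟩‖ ≤ M := fun y x => hM _
  have hFy : ∀ y, Continuous fun x : ℝ => F ⟨x, y⟩ := fun y => hF.comp (continuous_mk_left y)
  have hFx : ∀ x, Continuous fun y : ℝ => F ⟨x, y⟩ := fun x => hF.comp (continuous_mk_right x)
  have hβi : Integrable β := hβ.continuous.integrable_of_hasCompactSupport hβs
  let ε : ℕ → ℝ := fun n => (x₂ - x₁) / (n + 1)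
  have hε0 : ∀ n, 0 < ε n := fun n => div_pos (by linarith) (by positivity)
  have hεle : ∀ n, ε n ≤ x₂ - x₁ := fun n =>
    div_le_self (by linarith) (by linarith [n.cast_nonneg (α := ℝ)])
  have hε : Tendsto ε atTop (𝓝 0) := by
    have := (tendsto_one_div_add_atTop_nhds_zero_nat (𝕜 := ℝ)).const_mul (x₂ - x₁)
    simpa [ε, div_eq_mul_inv] using this
  -- The smoothed indicator of (x₀, x₁] spills over to the right by at most ε n ≤ x₂ - x₁. The room
  -- between x₁ and x₂ therefore keeps the support in the rectangle.
  let η : ℕ → ℂ → ℝ := fun n z => smoothStep x₀ x₁ (ε n) z.re * β z.im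
  have hηc : ∀ n, ContDiff ℝ ∞ (η n) := fun n =>
    ((contDiff_smoothStep _ _ _).comp Complex.reCLM.contDiff).mul (hβ.comp Complex.imCLM.contDiff)
  have hK : IsCompact (Icc x₀ x₂ ×ℂ tsupport β) := isCompact_Icc.reProdIm hβs
  have hη0 : ∀ n, ∀ z ∉ Icc x₀ x₂ ×ℂ tsupport β, η n z = 0 := by
    intro n z hz
    by_contra hne
    refine hz (Complex.mem_reProdIm.2 ⟨?_, ?_⟩)
    · by_contra h'
      exact hne (by
        simp only [η]
        rw [smoothStep_eq_zero (hε0 n) h01.le, zero_mul]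
        exact fun h'' => h' ⟨h''.1, by linarith [h''.2, hεle n]⟩)
    · by_contra h'
      exact hne (by simp only [η]; rw [image_eq_zero_of_notMem_tsupport h', mul_zero])
  have hηs : ∀ n, HasCompactSupport (η n) := fun n => HasCompactSupport.intro hK (hη0 n)
  have hηts : ∀ n, tsupport (η n) ⊆ Icc x₀ x₂ ×ℂ tsupport β := fun n =>
    closure_minimal (fun z hz => by by_contra h'; exact hz (hη0 n z h')) hK.isClosed
  have hηΩ : ∀ n, tsupport (η n) ⊆ Ω := fun n z hz => by
    have := Complex.mem_reProdIm.1 (hηts n hz)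
    exact hR z.re this.1 z.im (Ioo_subset_Icc_self (hβR this.2))
  have hstep : ∀ n, Differentiable ℝ (smoothStep x₀ x₁ (ε n)) := fun n =>
    (contDiff_smoothStep _ _ _).differentiable (by simp)
  have hfd : ∀ n z, fderiv ℝ (η n) z 1 = deriv (smoothStep x₀ x₁ (ε n)) z.re * β z.im := fun n z =>
    hasFDerivAt_mul_re_im (hstep n) (hβ.differentiable (by simp)) z
  have hweak : ∀ n, ∫ z, (fderiv ℝ (η n) z 1) • F z = - ∫ z, η n z • g z := by
    intro n
    have := h (η n) (hηc n) (hηs n) (hηΩ n)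
    rwa [setIntegral_eq_integral_of_forall_compl_eq_zero, setIntegral_eq_integral_of_forall_compl_eq_zero]
      at this
    · intro z hz
      rw [image_eq_zero_of_notMem_tsupport fun h' => hz (hηΩ n h'), zero_smul]
    · intro z hz
      rw [fderiv_of_notMem_tsupport (𝕜 := ℝ) fun h' => hz (hηΩ n h')]
      simp
  have hB0 : 0 ≤ B := (norm_nonneg _).trans (hB 0)
  -- the right hand side
  have hηle : ∀ n z, ‖η n z‖ ≤ B := fun n z => by
    simp only [η]
    rw [norm_mul]
    calc _ ≤ 1 * B := mul_le_mul (abs_smoothStep_le_one _ _ _ _) (hB _) (norm_nonneg _) zero_le_one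
      _ = B := one_mul B
  have hrhs : Tendsto (fun n => ∫ z, η n z • g z) atTop
      (𝓝 (∫ z : ℂ, ((Ioc x₀ x₁).indicator (fun _ => 1) z.re * β z.im) • g z)) := by
    refine tendsto_integral_of_dominated_convergence (fun z => B * ‖g z‖) (fun n => ?_)
      (hg.norm.const_mul B) (fun n => ?_) ?_
    · exact (hηc n).continuous.aestronglyMeasurable.smul hg.aestronglyMeasurable
    · exact Eventually.of_forall fun z => by
        rw [norm_smul]; exact mul_le_mul_of_nonneg_right (hηle n z) (norm_nonneg _)
    · exact Eventually.of_forall fun z =>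
        ((tendsto_smoothStep h01 hε0 hε z.re).mul_const _).smul_const _
  have hind : Measurable fun z : ℂ => (Ioc x₀ x₁).indicator (fun _ => (1 : ℝ)) z.re :=
    (measurable_const.indicator measurableSet_Ioc).comp Complex.measurable_re
  have hgI : Integrable fun z : ℂ => ((Ioc x₀ x₁).indicator (fun _ => 1) z.re * β z.im) • g z := by
    refine (hg.norm.const_mul B).mono' ?_ ?_
    · exact (hind.mul (hβ.continuous.measurable.comp Complex.measurable_im)).aestronglyMeasurable.smul
        hg.aestronglyMeasurable
    · refine Eventually.of_forall fun z => ?_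
      rw [norm_smul, norm_mul]
      refine mul_le_mul_of_nonneg_right ?_ (norm_nonneg _)
      calc _ ≤ 1 * B := mul_le_mul (by
              by_cases hz : z.re ∈ Ioc x₀ x₁ <;> simp [hz]) (hB _) (norm_nonneg _) zero_le_one
        _ = B := one_mul B
  have hslice : ∀ y : ℝ, ∫ x : ℝ, ((Ioc x₀ x₁).indicator (fun _ => 1) x * β y) • g ⟨x, y⟩ =
      β y • ∫ x in x₀..x₁, g ⟨x, y⟩ := fun y => by
    rw [intervalIntegral.integral_of_le h01.le, ← integral_smul, ← integral_indicator measurableSet_Ioc]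
    congr 1
    funext x
    by_cases hx : x ∈ Ioc x₀ x₁ <;> simp [hx]
  have hrhs' : ∫ z : ℂ, ((Ioc x₀ x₁).indicator (fun _ => 1) z.re * β z.im) • g z =
      ∫ y, β y • ∫ x in x₀..x₁, g ⟨x, y⟩ := by
    rw [integral_eq_integral_integral_mk hgI]
    exact integral_congr_ae (Eventually.of_forall fun y => hslice y)
  have hgI' : Integrable fun y => β y • ∫ x in x₀..x₁, g ⟨x, y⟩ := by
    refine (integrable_integral_mk hgI).congr (Eventually.of_forall fun y => hslice y)
  -- the left hand side
  have hlhs : ∀ n, ∫ z, (fderiv ℝ (η n) z 1) • F z = ∫ y, β y •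
      ((∫ u, deriv Real.smoothTransition u • F ⟨x₀ + ε n * u, y⟩) -
        ∫ u, deriv Real.smoothTransition u • F ⟨x₁ + ε n * u, y⟩) := by
    intro n
    have hi : Integrable fun z => (fderiv ℝ (η n) z 1) • F z := by
      have hc : Continuous fun z => fderiv ℝ (η n) z 1 :=
        ((hηc n).continuous_fderiv (by simp)).clm_apply continuous_const
      exact (hc.smul hF).integrable_of_hasCompactSupport (hFs.smul_left)
    rw [integral_eq_integral_integral_mk hi]
    refine integral_congr_ae (Eventually.of_forall fun y => ?_)
    simp only [hfd]
    have hint : ∀ a, Integrable fun x => (deriv Real.smoothTransition ((x - a) / ε n) / ε n) •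
        F ⟨x, y⟩ := fun a => by
      exact (((integrable_deriv_smoothTransition.comp_div (hε0 n).ne').comp_sub_right
        a).div_const _).smul_bdd M (hFy y).aestronglyMeasurable
        (Eventually.of_forall fun x => hMh y x)
    rw [← integral_deriv_smoothTransition_comp_smul (h := fun x => F ⟨x, y⟩) x₀ (hε0 n),
      ← integral_deriv_smoothTransition_comp_smul (h := fun x => F ⟨x, y⟩) x₁ (hε0 n),
      ← integral_sub (hint x₀) (hint x₁), ← integral_smul]
    congr 1
    funext x
    rw [deriv_smoothStep, ← sub_smul, smul_smul, mul_comm]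
  -- The two edges of the smoothed indicator become point evaluations at x₀ and x₁, with opposite
  -- signs.
  have hlim : Tendsto (fun n => ∫ z, (fderiv ℝ (η n) z 1) • F z) atTop
      (𝓝 (∫ y, β y • (F ⟨x₀, y⟩ - F ⟨x₁, y⟩))) := by
    simp_rw [hlhs]
    set C := ∫ u, ‖deriv Real.smoothTransition u‖
    refine tendsto_integral_of_dominated_convergence (fun y => ‖β y‖ * (C * M + C * M)) (fun n => ?_)
      (hβi.norm.mul_const _) (fun n => ?_) ?_
    · refine hβ.continuous.aestronglyMeasurable.smul ?_
      refine AEStronglyMeasurable.sub ?_ ?_ <;>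
      · refine (Continuous.stronglyMeasurable ?_).aestronglyMeasurable
        refine continuous_of_dominated (bound := fun u => ‖deriv Real.smoothTransition u‖ * M)
          (fun y => ?_) (fun y => ?_) (integrable_deriv_smoothTransition.norm.mul_const M) ?_
        · have h1 := continuous_deriv_smoothTransition
          have h2 := hFy y
          exact (h1.smul (h2.comp (by fun_prop))).aestronglyMeasurable
        · exact Eventually.of_forall fun u => by
            rw [norm_smul]; exact mul_le_mul_of_nonneg_left (hM _) (norm_nonneg _)
        · exact Eventually.of_forall fun u => (hFx _).fun_const_smul _
    · refine Eventually.of_forall fun y => ?_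
      rw [norm_smul]
      refine mul_le_mul_of_nonneg_left ((norm_sub_le _ _).trans (add_le_add ?_ ?_)) (norm_nonneg _)
      · exact norm_integral_deriv_smoothTransition_smul_le fun u => hM _
      · exact norm_integral_deriv_smoothTransition_smul_le fun u => hM _
    · refine Eventually.of_forall fun y => Tendsto.const_smul (Tendsto.sub ?_ ?_) _
      · exact tendsto_integral_deriv_smoothTransition_smul (hFy y) (hMh y) x₀ hε
      · exact tendsto_integral_deriv_smoothTransition_smul (hFy y) (hMh y) x₁ hε
  have heq : ∫ y, β y • (F ⟨x₀, y⟩ - F ⟨x₁, y⟩) = - ∫ y, β y • ∫ x in x₀..x₁, g ⟨x, y⟩ := by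
    rw [← hrhs']
    refine tendsto_nhds_unique hlim ?_
    simp_rw [hweak]
    exact hrhs.neg
  have hFi : Integrable fun y => β y • (F ⟨x₀, y⟩ - F ⟨x₁, y⟩) :=
    Continuous.integrable_of_hasCompactSupport
      (hβ.continuous.smul ((hFx x₀).sub (hFx x₁))) hβs.smul_right
  have : ∀ y, β y • (F ⟨x₁, y⟩ - F ⟨x₀, y⟩ - ∫ x in x₀..x₁, g ⟨x, y⟩) =
      - (β y • (F ⟨x₀, y⟩ - F ⟨x₁, y⟩)) - β y • ∫ x in x₀..x₁, g ⟨x, y⟩ := fun y => by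
    rw [smul_sub, smul_sub, smul_sub]; abel
  simp_rw [this]
  rw [integral_sub (f := fun y => -(β y • (F ⟨x₀, y⟩ - F ⟨x₁, y⟩))) hFi.neg hgI', integral_neg, heq, neg_neg, sub_self]

/-- A continuous function is a primitive of its weak derivative on almost every horizontal line. -/
theorem IsWeakDeriv.ae_sub_eq_intervalIntegral {F g : ℂ → ℂ} {Ω : Set ℂ} (hΩ : IsOpen Ω)
    (hF : Continuous F) (hFs : HasCompactSupport F) (hg : Integrable g) (h : IsWeakDeriv F g 1 Ω) :
    ∀ᵐ y : ℝ, ∀ a b : ℝ, a ≤ b → (∀ x ∈ Icc a b, (⟨x, y⟩ : ℂ) ∈ Ω) →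
      F ⟨b, y⟩ - F ⟨a, y⟩ = ∫ x in a..b, g ⟨x, y⟩ := by
  -- Only countably many rectangles, those with rational data, are tested, so that one null set of
  -- ordinates serves all segments. For each rectangle the identity holds almost everywhere because
  -- its integral against every β vanishes.
  have hrat : ∀ q : (ℚ × ℚ × ℚ) × (ℚ × ℚ), ∀ᵐ y : ℝ, (q.1.1 : ℝ) < q.1.2.1 →
      (q.1.2.1 : ℝ) < q.1.2.2 →
      (∀ x ∈ Icc (q.1.1 : ℝ) q.1.2.2, ∀ y ∈ Icc (q.2.1 : ℝ) q.2.2, (⟨x, y⟩ : ℂ) ∈ Ω) →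
      y ∈ Ioo (q.2.1 : ℝ) q.2.2 →
      F ⟨q.1.2.1, y⟩ - F ⟨q.1.1, y⟩ - ∫ x in (q.1.1 : ℝ)..q.1.2.1, g ⟨x, y⟩ = 0 := by
    rintro ⟨⟨x₀, x₁, x₂⟩, ⟨y₀, y₁⟩⟩
    simp only
    by_cases h01 : (x₀ : ℝ) < x₁
    swap
    · exact Eventually.of_forall fun y h => absurd h h01
    by_cases h12 : (x₁ : ℝ) < x₂
    swap
    · exact Eventually.of_forall fun y _ h => absurd h h12
    by_cases hR : ∀ x ∈ Icc (x₀ : ℝ) x₂, ∀ y ∈ Icc (y₀ : ℝ) y₁, (⟨x, y⟩ : ℂ) ∈ Ω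
    swap
    · exact Eventually.of_forall fun y _ _ h => absurd h hR
    have := isOpen_Ioo.ae_eq_zero_of_integral_contDiff_smul_eq_zero (U := Ioo (y₀ : ℝ) y₁)
      (f := fun y => F ⟨x₁, y⟩ - F ⟨x₀, y⟩ - ∫ x in (x₀ : ℝ)..x₁, g ⟨x, y⟩) (μ := volume) ?_
      (fun β hβ hβs hβR => h.integral_rectangle hF hFs hg h01 h12 hR hβ hβs hβR)
    · filter_upwards [this] with y hy _ _ _ using hy
    · refine LocallyIntegrable.locallyIntegrableOn ?_ _
      refine LocallyIntegrable.sub ?_ ?_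
      · exact Continuous.locallyIntegrable
          ((hF.comp (continuous_mk_right _)).sub (hF.comp (continuous_mk_right _)))
      · refine Integrable.locallyIntegrable ?_
        have hi : Integrable ((Complex.re ⁻¹' Ioc (x₀ : ℝ) x₁).indicator g) :=
          hg.indicator (Complex.measurable_re measurableSet_Ioc)
        refine (integrable_integral_mk hi).congr (Eventually.of_forall fun y => ?_)
        simp only
        rw [intervalIntegral.integral_of_le h01.le, ← integral_indicator measurableSet_Ioc]
        rfl
  filter_upwards [ae_all_iff.2 hrat, ae_integrable_mk hg] with y hy hgy a b hab hseg
  have hii : ∀ c d, IntervalIntegrable (fun x : ℝ => g ⟨x, y⟩) volume c d := fun c d =>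
    hgy.intervalIntegrable
  -- a rectangle around the segment
  have hK : IsCompact ((fun x : ℝ => (⟨x, y⟩ : ℂ)) '' Icc a b) :=
    isCompact_Icc.image (continuous_mk_left y)
  obtain ⟨δ, hδ, hδΩ⟩ := hK.exists_cthickening_subset_open hΩ (by
    rintro _ ⟨x, hx, rfl⟩; exact hseg x hx)
  have hR : ∀ x ∈ Icc (a - δ / 2) (b + δ / 2), ∀ y' ∈ Icc (y - δ / 2) (y + δ / 2),
      (⟨x, y'⟩ : ℂ) ∈ Ω := by
    intro x hx y' hy'
    apply hδΩ
    obtain ⟨x', hx', hxx'⟩ : ∃ x' ∈ Icc a b, |x - x'| ≤ δ / 2 := by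
      rcases le_total x a with h1 | h1
      · exact ⟨a, ⟨le_rfl, hab⟩, by rw [abs_le]; constructor <;> linarith [hx.1]⟩
      · rcases le_total x b with h2 | h2
        · exact ⟨x, ⟨h1, h2⟩, by simp; positivity⟩
        · exact ⟨b, ⟨hab, le_rfl⟩, by rw [abs_le]; constructor <;> linarith [hx.2]⟩
    refine mem_cthickening_of_dist_le _ (⟨x', y⟩ : ℂ) _ _ (mem_image_of_mem _ hx') ?_
    rw [dist_eq_norm]
    refine (Complex.norm_le_abs_re_add_abs_im _).trans ?_
    have : |y' - y| ≤ δ / 2 := by rw [abs_le]; constructor <;> linarith [hy'.1, hy'.2]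
    simp only [Complex.sub_re, Complex.sub_im]
    linarith
  obtain ⟨p, hp1, hp2⟩ := exists_rat_btwn (show a - δ / 2 < a by linarith)
  obtain ⟨q, hq1, hq2⟩ := exists_rat_btwn (show b < b + δ / 2 by linarith)
  obtain ⟨s, hs1, hs2⟩ := exists_rat_btwn (show y - δ / 2 < y by linarith)
  obtain ⟨t, ht1, ht2⟩ := exists_rat_btwn (show y < y + δ / 2 by linarith)
  -- The identity is known for rational abscissae only. H is continuous, and its agreement with H(p)
  -- at rational points between p and q extends to all points between them, among them a and b.
  let H : ℝ → ℂ := fun x => F ⟨x, y⟩ - ∫ u in (p : ℝ)..x, g ⟨u, y⟩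
  have hH : Continuous H := (hF.comp (continuous_mk_left y)).sub
    (intervalIntegral.continuous_primitive hii _)
  have hHr : ∀ r : ℚ, (p : ℝ) < r → (r : ℝ) < q → H r = H p := by
    intro r hr1 hr2
    have := hy ((p, r, q), (s, t)) hr1 hr2 (fun x hx y' hy' =>
      hR x ⟨by linarith [hx.1], by linarith [hx.2]⟩ y' ⟨by linarith [hy'.1], by linarith [hy'.2]⟩)
      ⟨hs2, ht1⟩
    simp only at this
    simp only [H, intervalIntegral.integral_same, sub_zero]
    linear_combination this
  have hHx : ∀ x ∈ Ioo (p : ℝ) q, H x = H p := by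
    intro x hx
    have hcl : IsClosed {x | H x = H p} := isClosed_eq hH continuous_const
    have hd : x ∈ closure (Ioo (p : ℝ) q ∩ range ((↑) : ℚ → ℝ)) :=
      Rat.denseRange_cast.open_subset_closure_inter isOpen_Ioo hx
    refine closure_minimal ?_ hcl hd
    rintro _ ⟨hx, ⟨r, rfl⟩⟩
    exact hHr r hx.1 hx.2
  have h1 := hHx a ⟨hp2, by linarith⟩
  have h2 := hHx b ⟨by linarith, hq1⟩
  have h3 := intervalIntegral.integral_interval_sub_left (hii p b) (hii p a)
  simp only [H] at h1 h2
  rw [← h3]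
  linear_combination h2 - h1

/-- The isometry preserves area, and the chain rule turns direction v into e v. Applied to the
reflection in the diagonal, this reduces vertical lines to horizontal ones. -/
lemma IsWeakDeriv.comp_linearIsometryEquiv {f g : ℂ → ℂ} {v : ℂ} {Ω : Set ℂ} (e : ℂ ≃ₗᵢ[ℝ] ℂ)
    (h : IsWeakDeriv f g (e v) Ω) : IsWeakDeriv (f ∘ e) (g ∘ e) v (e ⁻¹' Ω) := by
  intro η hη hηs hηΩ
  have hemb : MeasurableEmbedding e := e.toHomeomorph.measurableEmbedding
  have hts : tsupport (η ∘ e.symm) = e '' tsupport η := by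
    have := tsupport_comp_eq_preimage η e.symm.toHomeomorph
    rw [e.image_eq_preimage_symm]
    exact this
  have key := h (η ∘ e.symm) (hη.comp e.symm.contDiff) (hηs.comp_homeomorph e.symm.toHomeomorph)
    (by rw [hts]; exact image_subset_iff.2 hηΩ)
  have e1 := e.measurePreserving.setIntegral_preimage_emb hemb
    (fun z => (fderiv ℝ (η ∘ e.symm) z) (e v) • f z) Ω
  have e2 := e.measurePreserving.setIntegral_preimage_emb hemb
    (fun z => (η ∘ e.symm) z • g z) Ω
  rw [← e1, ← e2] at key
  have hfd : ∀ z, (fderiv ℝ (η ∘ e.symm) (e z)) (e v) = fderiv ℝ η z v := fun z => by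
    have h1 : HasFDerivAt (η ∘ e.symm) ((fderiv ℝ η z).comp
        (e.symm.toContinuousLinearEquiv : ℂ →L[ℝ] ℂ)) (e z) := by
      refine HasFDerivAt.comp (e z) ?_ e.symm.toContinuousLinearEquiv.hasFDerivAt
      simpa using (hη.differentiable (by simp) z).hasFDerivAt
    rw [h1.fderiv]
    simp
  simpa [hfd] using key

/-- The reflection which exchanges the real and the imaginary part. -/
noncomputable def swapReIm : ℂ ≃ₗᵢ[ℝ] ℂ :=
  Complex.conjLIE.trans (rotation ⟨Complex.I, by simp [Submonoid.unitSphere]⟩)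

lemma swapReIm_apply (z : ℂ) : swapReIm z = Complex.I * (starRingEnd ℂ) z := rfl

@[simp] lemma swapReIm_mk (x y : ℝ) : swapReIm ⟨x, y⟩ = ⟨y, x⟩ := by
  apply Complex.ext <;> simp [swapReIm_apply]

@[simp] lemma swapReIm_one : swapReIm 1 = Complex.I := by
  apply Complex.ext <;> simp [swapReIm_apply]

@[simp] lemma swapReIm_I : swapReIm Complex.I = 1 := by
  apply Complex.ext <;> simp [swapReIm_apply]

@[simp] lemma swapReIm_swapReIm (z : ℂ) : swapReIm (swapReIm z) = z := by
  rw [← Complex.eta z, swapReIm_mk, swapReIm_mk]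

lemma integrable_comp_swapReIm {E : Type*} [NormedAddCommGroup E] {h : ℂ → E}
    (hh : Integrable h) : Integrable (h ∘ swapReIm) :=
  (swapReIm.measurePreserving.integrable_comp_emb
    swapReIm.toHomeomorph.measurableEmbedding).2 hh

lemma lintegral_comp_swapReIm (h : ℂ → ENNReal) :
    ∫⁻ z, h (swapReIm z) = ∫⁻ z, h z :=
  swapReIm.measurePreserving.lintegral_comp_emb swapReIm.toHomeomorph.measurableEmbedding h

/-- A continuous function is a primitive of its weak derivative on almost every vertical line. -/
theorem IsWeakDeriv.ae_sub_eq_intervalIntegral_vertical {F g : ℂ → ℂ} {Ω : Set ℂ} (hΩ : IsOpen Ω)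
    (hF : Continuous F) (hFs : HasCompactSupport F) (hg : Integrable g)
    (h : IsWeakDeriv F g Complex.I Ω) :
    ∀ᵐ x : ℝ, ∀ a b : ℝ, a ≤ b → (∀ y ∈ Icc a b, (⟨x, y⟩ : ℂ) ∈ Ω) →
      F ⟨x, b⟩ - F ⟨x, a⟩ = ∫ y in a..b, g ⟨x, y⟩ := by
  have h' : IsWeakDeriv (F ∘ swapReIm) (g ∘ swapReIm) 1 (swapReIm ⁻¹' Ω) :=
    IsWeakDeriv.comp_linearIsometryEquiv swapReIm (by rwa [swapReIm_one])
  have := h'.ae_sub_eq_intervalIntegral (hΩ.preimage swapReIm.continuous)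
    (hF.comp swapReIm.continuous) (hFs.comp_homeomorph swapReIm.toHomeomorph)
    (integrable_comp_swapReIm hg)
  simpa using this

/-! ### Squares and a Poincaré inequality. -/

lemma measurableSet_reProdIm {I J : Set ℝ} (hI : MeasurableSet I) (hJ : MeasurableSet J) :
    MeasurableSet (I ×ℂ J) :=
  (Complex.measurable_re hI).inter (Complex.measurable_im hJ)

lemma lintegral_reProdIm {I J : Set ℝ} (hI : MeasurableSet I) (hJ : MeasurableSet J)
    {h : ℂ → ENNReal} (hh : AEMeasurable h) :
    ∫⁻ z in I ×ℂ J, h z = ∫⁻ y in J, ∫⁻ x in I, h ⟨x, y⟩ := by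
  have hm : MeasurableSet (I ×ℂ J) := measurableSet_reProdIm hI hJ
  rw [← lintegral_indicator hm, lintegral_eq_lintegral_lintegral_mk (hh.indicator hm),
    ← lintegral_indicator hJ]
  refine lintegral_congr fun y => ?_
  by_cases hy : y ∈ J
  · rw [indicator_of_mem hy, ← lintegral_indicator hI]
    refine lintegral_congr fun x => ?_
    by_cases hx : x ∈ I
    · rw [indicator_of_mem hx, indicator_of_mem (Complex.mem_reProdIm.2 ⟨hx, hy⟩)]
    · rw [indicator_of_notMem hx, indicator_of_notMem fun h => hx (Complex.mem_reProdIm.1 h).1]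
  · rw [indicator_of_notMem hy]
    refine (lintegral_congr fun x => ?_).trans lintegral_zero
    exact indicator_of_notMem (fun h => hy (Complex.mem_reProdIm.1 h).2) _

lemma lintegral_reProdIm' {I J : Set ℝ} (hI : MeasurableSet I) (hJ : MeasurableSet J)
    {h : ℂ → ENNReal} (hh : AEMeasurable h) :
    ∫⁻ z in I ×ℂ J, h z = ∫⁻ x in I, ∫⁻ y in J, h ⟨x, y⟩ := by
  have h1 := lintegral_reProdIm hJ hI (h := h ∘ swapReIm)
    (hh.comp_quasiMeasurePreserving swapReIm.measurePreserving.quasiMeasurePreserving)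
  simp only [Function.comp, swapReIm_mk] at h1
  rw [← h1, ← lintegral_indicator (measurableSet_reProdIm hI hJ), ← lintegral_indicator (measurableSet_reProdIm hJ hI),
    ← lintegral_comp_swapReIm]
  refine lintegral_congr fun z => ?_
  have : swapReIm z ∈ I ×ℂ J ↔ z ∈ J ×ℂ I := by
    rw [← Complex.eta z, swapReIm_mk, Complex.mem_reProdIm, Complex.mem_reProdIm]
    exact and_comm
  by_cases hz : z ∈ J ×ℂ I
  · rw [indicator_of_mem hz, indicator_of_mem (this.2 hz)]
  · rw [indicator_of_notMem hz, indicator_of_notMem (mt this.1 hz)]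

lemma volume_closedSquare (a : ℂ) {L : ℝ} (hL : 0 ≤ L) :
    volume (closedSquare a L) = ENNReal.ofReal (L ^ 2) := by
  have h := lintegral_reProdIm (measurableSet_Icc (a := a.re) (b := a.re + L))
    (measurableSet_Icc (a := a.im) (b := a.im + L)) (h := fun _ => 1) aemeasurable_const
  simp only [lintegral_const, MeasurableSet.univ, Measure.restrict_apply, univ_inter, one_mul,
    Real.volume_Icc, add_sub_cancel_left] at h
  rw [closedSquare, h, ← ENNReal.ofReal_mul hL, sq]

lemma isCompact_closedSquare (a : ℂ) (L : ℝ) : IsCompact (closedSquare a L) :=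
  isCompact_Icc.reProdIm isCompact_Icc

lemma mem_closedSquare {a z : ℂ} {L : ℝ} : z ∈ closedSquare a L ↔
    (a.re ≤ z.re ∧ z.re ≤ a.re + L) ∧ (a.im ≤ z.im ∧ z.im ≤ a.im + L) := Iff.rfl

lemma closedSquare_subset_iff {p a : ℂ} {l R : ℝ} (hl : 0 ≤ l) :
    closedSquare p l ⊆ closedSquare a R ↔
      (a.re ≤ p.re ∧ p.re + l ≤ a.re + R) ∧ (a.im ≤ p.im ∧ p.im + l ≤ a.im + R) := by
  constructor
  · intro h
    have h1 := mem_closedSquare.1 (@h p (by rw [mem_closedSquare]; simp [hl]))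
    have h2 := mem_closedSquare.1 (@h ⟨p.re + l, p.im + l⟩ (by rw [mem_closedSquare]; simp [hl]))
    exact ⟨⟨h1.1.1, h2.1.2⟩, ⟨h1.2.1, h2.2.2⟩⟩
  · intro h z hz
    rw [mem_closedSquare] at hz ⊢
    refine ⟨⟨?_, ?_⟩, ?_, ?_⟩ <;> linarith [h.1.1, h.1.2, h.2.1, h.2.2, hz.1.1, hz.1.2, hz.2.1, hz.2.2]

/-- A Poincaré inequality: the mean values of a function over all subsquares of a given square are
close to a constant. -/
theorem exists_norm_average_sub_le {F g₁ g₂ : ℂ → ℂ} {Ω : Set ℂ} (hΩ : IsOpen Ω)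
    (hF : Continuous F) (hFs : HasCompactSupport F) (hg₁ : Integrable g₁) (hg₂ : Integrable g₂)
    (h₁ : IsWeakDeriv F g₁ 1 Ω) (h₂ : IsWeakDeriv F g₂ Complex.I Ω) {a : ℂ} {R : ℝ} (hR : 0 < R)
    (hS : closedSquare a R ⊆ Ω) :
    ∃ c : ℂ, ∀ (p : ℂ) (l : ℝ), 0 < l → closedSquare p l ⊆ closedSquare a R →
      ‖(⨍ z in closedSquare p l, F z) - c‖ ≤
        l⁻¹ * ∫ z in closedSquare a R, (‖g₁ z‖ + ‖g₂ z‖) := by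
  set I := Icc a.re (a.re + R)
  set J := Icc a.im (a.im + R)
  have hSmem : ∀ x ∈ I, ∀ y ∈ J, (⟨x, y⟩ : ℂ) ∈ Ω := fun x hx y hy => hS ⟨hx, hy⟩
  -- A and B bound the oscillation of F along the horizontal segment at height y and the vertical
  -- segment at abscissa x.
  let A : ℝ → ENNReal := fun y => ∫⁻ x in I, ‖g₁ ⟨x, y⟩‖ₑ
  let B : ℝ → ENNReal := fun x => ∫⁻ y in J, ‖g₂ ⟨x, y⟩‖ₑ
  have hA : ∀ᵐ y : ℝ, y ∈ J → ∀ x ∈ I, ∀ x' ∈ I, ‖F ⟨x, y⟩ - F ⟨x', y⟩‖ₑ ≤ A y := by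
    filter_upwards [h₁.ae_sub_eq_intervalIntegral hΩ hF hFs hg₁] with y hy hyJ
    have key : ∀ x ∈ I, ∀ x' ∈ I, x ≤ x' → ‖F ⟨x', y⟩ - F ⟨x, y⟩‖ₑ ≤ A y := by
      intro x hx x' hx' hxx'
      have hsub : Icc x x' ⊆ I := Icc_subset_Icc hx.1 hx'.2
      rw [hy x x' hxx' fun u hu => hSmem u (hsub hu) y hyJ, intervalIntegral.integral_of_le hxx']
      exact (enorm_integral_le_lintegral_enorm _).trans
        (lintegral_mono_set (Ioc_subset_Icc_self.trans hsub))
    intro x hx x' hx'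
    rcases le_total x x' with h | h
    · rw [← enorm_neg, neg_sub]; exact key x hx x' hx' h
    · exact key x' hx' x hx h
  have hB : ∀ᵐ x : ℝ, x ∈ I → ∀ y ∈ J, ∀ y' ∈ J, ‖F ⟨x, y⟩ - F ⟨x, y'⟩‖ₑ ≤ B x := by
    filter_upwards [h₂.ae_sub_eq_intervalIntegral_vertical hΩ hF hFs hg₂] with x hx hxI
    have key : ∀ y ∈ J, ∀ y' ∈ J, y ≤ y' → ‖F ⟨x, y'⟩ - F ⟨x, y⟩‖ₑ ≤ B x := by
      intro y hy y' hy' hyy'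
      have hsub : Icc y y' ⊆ J := Icc_subset_Icc hy.1 hy'.2
      rw [hx y y' hyy' fun u hu => hSmem x hxI u (hsub hu), intervalIntegral.integral_of_le hyy']
      exact (enorm_integral_le_lintegral_enorm _).trans
        (lintegral_mono_set (Ioc_subset_Icc_self.trans hsub))
    intro y hy y' hy'
    rcases le_total y y' with h | h
    · rw [← enorm_neg, neg_sub]; exact key y hy y' hy' h
    · exact key y' hy' y hy h
  set G₁ : ENNReal := ∫⁻ z in closedSquare a R, ‖g₁ z‖ₑ with hG₁
  set G₂ : ENNReal := ∫⁻ z in closedSquare a R, ‖g₂ z‖ₑ with hG₂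
  have hG₁A : G₁ = ∫⁻ y in J, A y :=
    lintegral_reProdIm measurableSet_Icc measurableSet_Icc hg₁.aestronglyMeasurable.enorm
  have hG₂B : G₂ = ∫⁻ x in I, B x :=
    lintegral_reProdIm' measurableSet_Icc measurableSet_Icc hg₂.aestronglyMeasurable.enorm
  have hIvol : volume I = ENNReal.ofReal R := by simp [I, Real.volume_Icc]
  have hIne : volume.restrict I ≠ 0 := by
    rw [Ne, Measure.restrict_eq_zero, hIvol]; simp [hR]
  -- A good vertical segment, on which B is at most its mean value. The constant c is the value of F
  -- at its lower end; every (x, y) on a good horizontal line is joined to it by a horizontal and a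
  -- vertical segment.
  obtain ⟨x₀, hx₀I, hx₀, hx₀B⟩ : ∃ x₀ ∈ I, (∀ y ∈ J, ∀ y' ∈ J, ‖F ⟨x₀, y⟩ - F ⟨x₀, y'⟩‖ₑ ≤ B x₀) ∧
      B x₀ ≤ G₂ / ENNReal.ofReal R := by
    have hBm : AEMeasurable B (volume.restrict I) := by
      have h1 := Complex.volume_preserving_equiv_real_prod.symm
      have h2 : AEMeasurable (fun p : ℝ × ℝ => ‖g₂ ⟨p.1, p.2⟩‖ₑ) (volume.prod volume) :=
        hg₂.aestronglyMeasurable.enorm.comp_quasiMeasurePreserving h1.quasiMeasurePreserving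
      have h3 : AEMeasurable (fun p : ℝ × ℝ => ‖g₂ ⟨p.1, p.2⟩‖ₑ)
          ((volume.restrict I).prod (volume.restrict J)) := by
        rw [Measure.prod_restrict]; exact h2.restrict
      exact h3.lintegral_prod_right'
    have hN : (volume.restrict I) {x | ¬ (x ∈ I ∧ ∀ y ∈ J, ∀ y' ∈ J,
        ‖F ⟨x, y⟩ - F ⟨x, y'⟩‖ₑ ≤ B x)} = 0 := by
      have : ∀ᵐ x ∂(volume.restrict I), x ∈ I ∧ ∀ y ∈ J, ∀ y' ∈ J,
          ‖F ⟨x, y⟩ - F ⟨x, y'⟩‖ₑ ≤ B x := by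
        filter_upwards [ae_restrict_mem measurableSet_Icc, ae_restrict_of_ae hB] with x hx hx'
        exact ⟨hx, hx' hx⟩
      exact this
    obtain ⟨x₀, hx₀, hle⟩ := exists_notMem_null_le_laverage hIne hBm hN
    simp only [mem_ofPred_eq, not_not] at hx₀
    refine ⟨x₀, hx₀.1, hx₀.2, ?_⟩
    rwa [setLAverage_eq, hIvol, ← hG₂B] at hle
  have haJ : a.im ∈ J := ⟨le_rfl, by linarith⟩
  refine ⟨F ⟨x₀, a.im⟩, fun p l hl hp => ?_⟩
  obtain ⟨⟨hp1, hp2⟩, hp3, hp4⟩ := (closedSquare_subset_iff hl.le).1 hp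
  have hlR : l ≤ R := by linarith
  have hpI : Icc p.re (p.re + l) ⊆ I := Icc_subset_Icc hp1 hp2
  have hpJ : Icc p.im (p.im + l) ⊆ J := Icc_subset_Icc hp3 hp4
  have hvol := volume_closedSquare p hl.le
  have hvolr : volume.real (closedSquare p l) = l ^ 2 := by
    rw [Measure.real, hvol, ENNReal.toReal_ofReal (sq_nonneg l)]
  have hFi : IntegrableOn F (closedSquare p l) :=
    hF.continuousOn.integrableOn_compact (isCompact_closedSquare _ _)
  have havg : (⨍ z in closedSquare p l, F z) - F ⟨x₀, a.im⟩ =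
      (l ^ 2)⁻¹ • ∫ z in closedSquare p l, (F z - F ⟨x₀, a.im⟩) := by
    rw [setAverage_eq, integral_sub hFi (integrableOn_const (by rw [hvol]; simp)),
      setIntegral_const, hvolr, smul_sub, inv_smul_smul₀ (by positivity)]
  -- The integrand is at most A(y) + G₂/R. Integration over x gives the factor l, and integration
  -- over y gives at most G₁ + G₂ since l ≤ R. Division by the area l² leaves the factor 1/l.
  have hlint : ∫⁻ z in closedSquare p l, ‖F z - F ⟨x₀, a.im⟩‖ₑ ≤
      ENNReal.ofReal l * (G₁ + G₂) := by
    have hpt : ∀ᵐ y : ℝ, y ∈ Icc p.im (p.im + l) →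
        ∫⁻ x in Icc p.re (p.re + l), ‖F ⟨x, y⟩ - F ⟨x₀, a.im⟩‖ₑ ≤
          ENNReal.ofReal l * (A y + G₂ / ENNReal.ofReal R) := by
      filter_upwards [hA] with y hy hyp
      calc ∫⁻ x in Icc p.re (p.re + l), ‖F ⟨x, y⟩ - F ⟨x₀, a.im⟩‖ₑ
          ≤ ∫⁻ x in Icc p.re (p.re + l), (A y + G₂ / ENNReal.ofReal R) := by
            refine setLIntegral_mono' measurableSet_Icc fun x hx => ?_
            have : F ⟨x, y⟩ - F ⟨x₀, a.im⟩ =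
              (F ⟨x, y⟩ - F ⟨x₀, y⟩) + (F ⟨x₀, y⟩ - F ⟨x₀, a.im⟩) := by ring
            rw [this]
            exact (enorm_add_le _ _).trans (add_le_add (hy (hpJ hyp) x (hpI hx) x₀ hx₀I)
              ((hx₀ y (hpJ hyp) _ haJ).trans hx₀B))
        _ = _ := by
            rw [setLIntegral_const, Real.volume_Icc, add_sub_cancel_left, mul_comm]
    calc ∫⁻ z in closedSquare p l, ‖F z - F ⟨x₀, a.im⟩‖ₑ
        = ∫⁻ y in Icc p.im (p.im + l), ∫⁻ x in Icc p.re (p.re + l), ‖F ⟨x, y⟩ - F ⟨x₀, a.im⟩‖ₑ :=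
          lintegral_reProdIm measurableSet_Icc measurableSet_Icc (by
            exact (hF.sub continuous_const).enorm.aemeasurable)
      _ ≤ ∫⁻ y in Icc p.im (p.im + l), ENNReal.ofReal l * (A y + G₂ / ENNReal.ofReal R) :=
          setLIntegral_mono_ae' measurableSet_Icc hpt
      _ = ENNReal.ofReal l * ((∫⁻ y in Icc p.im (p.im + l), A y) +
            G₂ / ENNReal.ofReal R * ENNReal.ofReal l) := by
          rw [lintegral_const_mul' _ _ ENNReal.ofReal_ne_top, lintegral_add_right _ measurable_const,
            setLIntegral_const, Real.volume_Icc, add_sub_cancel_left]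
      _ ≤ ENNReal.ofReal l * (G₁ + G₂) := by
          gcongr
          · rw [hG₁A]; exact lintegral_mono_set hpJ
          · calc G₂ / ENNReal.ofReal R * ENNReal.ofReal l
                ≤ G₂ / ENNReal.ofReal R * ENNReal.ofReal R := by gcongr
              _ = G₂ := ENNReal.div_mul_cancel (by simp [hR]) ENNReal.ofReal_ne_top
  have hG : ∫ z in closedSquare a R, (‖g₁ z‖ + ‖g₂ z‖) = (G₁ + G₂).toReal := by
    rw [integral_add hg₁.norm.integrableOn hg₂.norm.integrableOn,
      ENNReal.toReal_add hg₁.integrableOn.2.ne hg₂.integrableOn.2.ne,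
      integral_norm_eq_lintegral_enorm hg₁.aestronglyMeasurable.restrict,
      integral_norm_eq_lintegral_enorm hg₂.aestronglyMeasurable.restrict]
  have hGfin : G₁ + G₂ ≠ ⊤ := ENNReal.add_ne_top.2 ⟨hg₁.integrableOn.2.ne, hg₂.integrableOn.2.ne⟩
  have hnorm : ‖∫ z in closedSquare p l, (F z - F ⟨x₀, a.im⟩)‖ ≤ l * (G₁ + G₂).toReal := by
    have h1 := (enorm_integral_le_lintegral_enorm (μ := volume.restrict (closedSquare p l))
      (fun z => F z - F ⟨x₀, a.im⟩)).trans hlint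
    have h2 := ENNReal.toReal_mono (ENNReal.mul_ne_top ENNReal.ofReal_ne_top hGfin) h1
    rwa [toReal_enorm, ENNReal.toReal_mul, ENNReal.toReal_ofReal hl.le] at h2
  rw [havg, norm_smul, hG, Real.norm_of_nonneg (by positivity)]
  calc (l ^ 2)⁻¹ * ‖∫ z in closedSquare p l, (F z - F ⟨x₀, a.im⟩)‖
      ≤ (l ^ 2)⁻¹ * (l * (G₁ + G₂).toReal) := by gcongr
    _ = _ := by field_simp

/-! ### Whitney squares and their zones. -/

lemma mem_of_dist_lt_infDist_frontier {D : Set ℂ} (hD : IsOpen D) {p z : ℂ} (hp : p ∈ D)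
    (hz : dist z p < infDist p (frontier D)) : z ∈ D := by
  have h : ball p (infDist p (frontier D)) ⊆ D := by
    refine (convex_ball p _).isPreconnected.subset_of_disjoint_frontier hD ?_
      ⟨p, mem_ball_self (dist_nonneg.trans_lt hz), hp⟩
    refine disjoint_left.2 fun w hw hw' => ?_
    have := infDist_le_dist_of_mem (x := p) hw'
    rw [mem_ball, dist_comm] at hw
    linarith
  exact h hz

/-- The square with centre `p` and half side length `m`. -/
def centeredSquare (p : ℂ) (m : ℝ) : Set ℂ := closedSquare ⟨p.re - m, p.im - m⟩ (2 * m)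

lemma mem_centeredSquare {p z : ℂ} {m : ℝ} :
    z ∈ centeredSquare p m ↔ |z.re - p.re| ≤ m ∧ |z.im - p.im| ≤ m := by
  rw [centeredSquare, mem_closedSquare]
  simp only [abs_le]
  constructor
  · rintro ⟨⟨h1, h2⟩, h3, h4⟩
    refine ⟨⟨?_, ?_⟩, ?_, ?_⟩ <;> linarith
  · rintro ⟨⟨h1, h2⟩, h3, h4⟩
    refine ⟨⟨?_, ?_⟩, ?_, ?_⟩ <;> linarith

lemma dist_le_of_mem_centeredSquare {p z : ℂ} {m : ℝ} (h : z ∈ centeredSquare p m) :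
    dist z p ≤ 2 * m := by
  obtain ⟨h1, h2⟩ := mem_centeredSquare.1 h
  rw [dist_eq_norm]
  refine (Complex.norm_le_abs_re_add_abs_im _).trans ?_
  simp only [Complex.sub_re, Complex.sub_im]
  linarith

lemma closedSquare_subset_centeredSquare {p : ℂ} {l m : ℝ} (h : l ≤ m) :
    closedSquare p l ⊆ centeredSquare p m := by
  intro z hz
  obtain ⟨⟨h1, h2⟩, h3, h4⟩ := mem_closedSquare.1 hz
  rw [mem_centeredSquare, abs_le, abs_le]
  refine ⟨⟨?_, ?_⟩, ?_, ?_⟩ <;> linarith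

/-- The subsquare with indices `i`, `j` in the division of a square into `N * N` subsquares. -/
noncomputable def subsquareCorner (a : ℂ) (L : ℝ) (N : ℕ) (i j : ℕ) : ℂ :=
  ⟨a.re + i * (L / N), a.im + j * (L / N)⟩

lemma subsquare_subset {a : ℂ} {L : ℝ} (hL : 0 < L) {N : ℕ} (i j : Fin N) :
    closedSquare (subsquareCorner a L N i j) (L / N) ⊆ closedSquare a L := by
  have hN : (0 : ℝ) < N := by exact_mod_cast i.pos
  have hl : 0 < L / N := by positivity
  have key : ∀ i : Fin N, (i : ℝ) * (L / N) + L / N ≤ L := fun i => by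
    have : ((i : ℕ) : ℝ) + 1 ≤ N := by exact_mod_cast i.2
    calc (i : ℝ) * (L / N) + L / N = (i + 1) * (L / N) := by ring
      _ ≤ N * (L / N) := by gcongr
      _ = L := by field_simp
  have h0 : ∀ i : Fin N, 0 ≤ (i : ℝ) * (L / N) := fun i => by positivity
  rw [closedSquare_subset_iff hl.le]
  simp only [subsquareCorner]
  refine ⟨⟨?_, ?_⟩, ?_, ?_⟩ <;> linarith [key i, key j, h0 i, h0 j]

lemma exists_fin_mem_subinterval {x L : ℝ} (hL : 0 < L) {N : ℕ} (hN : 0 < N) (h0 : 0 ≤ x)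
    (hx : x ≤ L) : ∃ i : Fin N, (i : ℝ) * (L / N) ≤ x ∧ x ≤ (i : ℝ) * (L / N) + L / N := by
  have hN' : (0 : ℝ) < N := by exact_mod_cast hN
  have hl : 0 < L / N := by positivity
  rcases eq_or_lt_of_le hx with rfl | hlt
  · refine ⟨⟨N - 1, by omega⟩, ?_, ?_⟩
    · have : (((N - 1 : ℕ) : ℝ)) = N - 1 := by push_cast [Nat.cast_sub hN]; ring
      simp only [this]
      have : ((N : ℝ) - 1) * (x / N) = x - x / N := by field_simp
      linarith
    · have : (((N - 1 : ℕ) : ℝ)) = N - 1 := by push_cast [Nat.cast_sub hN]; ring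
      simp only [this]
      have : ((N : ℝ) - 1) * (x / N) = x - x / N := by field_simp
      linarith
  · have hdiv : 0 ≤ x / (L / N) := by positivity
    have hlt' : x / (L / N) < N := by
      rw [div_lt_iff₀ hl]
      have : (N : ℝ) * (L / N) = L := by field_simp
      linarith
    refine ⟨⟨⌊x / (L / N)⌋₊, (Nat.floor_lt hdiv).2 hlt'⟩, ?_, ?_⟩
    · have := Nat.floor_le hdiv
      rwa [le_div_iff₀ hl] at this
    · have := Nat.lt_floor_add_one (x / (L / N))
      rw [div_lt_iff₀ hl] at this
      simp only
      linarith

lemma exists_mem_subsquare {a z : ℂ} {L : ℝ} (hL : 0 < L) {N : ℕ} (hN : 0 < N)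
    (hz : z ∈ closedSquare a L) :
    ∃ i j : Fin N, z ∈ closedSquare (subsquareCorner a L N i j) (L / N) := by
  obtain ⟨⟨h1, h2⟩, h3, h4⟩ := mem_closedSquare.1 hz
  obtain ⟨i, hi⟩ := exists_fin_mem_subinterval hL hN (sub_nonneg.2 h1)
    (show z.re - a.re ≤ L by linarith)
  obtain ⟨j, hj⟩ := exists_fin_mem_subinterval hL hN (sub_nonneg.2 h3)
    (show z.im - a.im ≤ L by linarith)
  refine ⟨i, j, mem_closedSquare.2 ?_⟩
  simp only [subsquareCorner]
  refine ⟨⟨?_, ?_⟩, ?_, ?_⟩ <;> linarith [hi.1, hi.2, hj.1, hj.2]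

lemma interior_closedSquare (a : ℂ) (L : ℝ) :
    interior (closedSquare a L) = Ioo a.re (a.re + L) ×ℂ Ioo a.im (a.im + L) := by
  rw [closedSquare, Complex.interior_reProdIm, interior_Icc, interior_Icc]

lemma volume_interior_closedSquare (a : ℂ) {L : ℝ} (hL : 0 ≤ L) :
    volume (interior (closedSquare a L)) = ENNReal.ofReal (L ^ 2) := by
  have h := lintegral_reProdIm (measurableSet_Ioo (a := a.re) (b := a.re + L))
    (measurableSet_Ioo (a := a.im) (b := a.im + L)) (h := fun _ => 1) aemeasurable_const
  simp only [lintegral_const, MeasurableSet.univ, Measure.restrict_apply, univ_inter, one_mul,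
    Real.volume_Ioo, add_sub_cancel_left] at h
  rw [interior_closedSquare, h, ← ENNReal.ofReal_mul hL, sq]

/-- A Whitney decomposition with chosen corners `a Q`, side lengths `L Q`, and a constant `C ≥ 1`. -/
structure WhitneyData (W : Set (Set ℂ)) (D : Set ℂ) where
  C : ℝ
  one_le_C : 1 ≤ C
  a : W → ℂ
  L : W → ℝ
  L_pos : ∀ Q, 0 < L Q
  eq_square : ∀ Q : W, (Q : Set ℂ) = closedSquare (a Q) (L Q)
  L_le : ∀ (Q : W), ∀ z ∈ (Q : Set ℂ), L Q ≤ C * infDist z (frontier D)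
  le_L : ∀ (Q : W), ∀ z ∈ (Q : Set ℂ), infDist z (frontier D) ≤ C * L Q

lemma IsWhitneyDecomposition.exists_data {W : Set (Set ℂ)} {D : Set ℂ}
    (h : IsWhitneyDecomposition W D) : Nonempty (WhitneyData W D) := by
  obtain ⟨-, -, C, hC, hW⟩ := h
  choose a L hL he hd using fun Q : W => hW Q Q.2
  refine ⟨⟨max C 1, le_max_right _ _, a, L, hL, he, fun Q z hz => ?_, fun Q z hz => ?_⟩⟩
  · refine (hd Q z hz).1.trans ?_
    gcongr
    · exact infDist_nonneg
    · exact le_max_left _ _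
  · refine (hd Q z hz).2.trans ?_
    gcongr
    · exact (hL Q).le
    · exact le_max_left _ _

lemma IsWhitneyDecomposition.countable {W : Set (Set ℂ)} {D : Set ℂ}
    (h : IsWhitneyDecomposition W D) : W.Countable := by
  obtain ⟨d⟩ := h.exists_data
  refine Set.PairwiseDisjoint.countable_of_isOpen (s := fun Q => interior Q)
    (fun Q hQ Q' hQ' hne => h.2.1 hQ hQ' hne) (fun _ _ => isOpen_interior) fun Q hQ => ?_
  change (interior ((⟨Q, hQ⟩ : W) : Set ℂ)).Nonempty
  rw [d.eq_square, interior_closedSquare]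
  have := d.L_pos ⟨Q, hQ⟩
  refine ⟨⟨(d.a ⟨Q, hQ⟩).re + d.L ⟨Q, hQ⟩ / 2, (d.a ⟨Q, hQ⟩).im + d.L ⟨Q, hQ⟩ / 2⟩,
    Complex.mem_reProdIm.2 ⟨⟨?_, ?_⟩, ?_, ?_⟩⟩ <;> simp <;> linarith

namespace WhitneyData

variable {W : Set (Set ℂ)} {D : Set ℂ} (d : WhitneyData W D)

lemma mem_corner (Q : W) : d.a Q ∈ (Q : Set ℂ) := by
  rw [d.eq_square, mem_closedSquare]
  simp [(d.L_pos Q).le]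

lemma C_pos : 0 < d.C := one_pos.trans_le d.one_le_C

lemma dist_le (Q : W) {z w : ℂ} (hz : z ∈ (Q : Set ℂ)) (hw : w ∈ (Q : Set ℂ)) :
    dist z w ≤ 2 * d.L Q := by
  rw [d.eq_square, mem_closedSquare] at hz hw
  rw [dist_eq_norm]
  refine (Complex.norm_le_abs_re_add_abs_im _).trans ?_
  simp only [Complex.sub_re, Complex.sub_im]
  have h1 : |z.re - w.re| ≤ d.L Q := by rw [abs_le]; constructor <;> linarith [hz.1.1, hz.1.2, hw.1.1, hw.1.2]
  have h2 : |z.im - w.im| ≤ d.L Q := by rw [abs_le]; constructor <;> linarith [hz.2.1, hz.2.2, hw.2.1, hw.2.2]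
  linarith

/-- The points whose distances from the boundary and from `Q` are comparable to the size of `Q`. -/
def zone (Q : W) : Set ℂ :=
  {z | d.L Q ≤ 2 * d.C * infDist z (frontier D) ∧ infDist z (frontier D) ≤ 2 * d.C * d.L Q ∧
    dist z (d.a Q) ≤ 3 * d.L Q}

lemma isClosed_zone (Q : W) : IsClosed (d.zone Q) := by
  have h : Continuous fun z : ℂ => infDist z (frontier D) := continuous_infDist_pt _
  have h1 : IsClosed {z | d.L Q ≤ 2 * d.C * infDist z (frontier D)} :=
    isClosed_le continuous_const (by fun_prop)
  have h2 : IsClosed {z | infDist z (frontier D) ≤ 2 * d.C * d.L Q} :=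
    isClosed_le h continuous_const
  have h3 : IsClosed {z | dist z (d.a Q) ≤ 3 * d.L Q} :=
    isClosed_le (by fun_prop) continuous_const
  exact h1.inter (h2.inter h3)

/-- The zones of the squares of a Whitney decomposition have bounded overlap. -/
lemma tsum_indicator_zone_le (hW : IsWhitneyDecomposition W D) (z : ℂ) :
    ∑' Q : W, (d.zone Q).indicator (fun _ => (1 : ENNReal)) z ≤ ENNReal.ofReal (1600 * d.C ^ 4) := by
  classical
  have hC := d.C_pos
  rw [ENNReal.tsum_eq_iSup_sum]
  refine iSup_le fun s => ?_
  let F : Finset W := s.filter fun Q => z ∈ d.zone Q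
  have hsum : ∑ Q ∈ s, (d.zone Q).indicator (fun _ => (1 : ENNReal)) z = (F.card : ENNReal) := by
    simp [F, indicator_apply]
  rw [hsum]
  by_cases hF : F = ∅
  · simp [hF]
  obtain ⟨Q₀, hQ₀⟩ := Finset.nonempty_iff_ne_empty.2 hF
  set r := infDist z (frontier D) with hr
  have hzone : ∀ Q ∈ F, z ∈ d.zone Q := fun Q hQ => (Finset.mem_filter.1 hQ).2
  have hr0 : 0 < r := by
    have h1 := (hzone Q₀ hQ₀).1
    have h2 := d.L_pos Q₀
    by_contra hcon
    have : r = 0 := le_antisymm (not_lt.1 hcon) infDist_nonneg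
    rw [← hr, this] at h1
    linarith
  -- A square with z in its zone has points at distance at most 2L + 3L from z, and 5L ≤ 10Cr. Its
  -- area is at least r²/(4C²). Since interiors are disjoint, the number of such squares is at most
  -- (2m)² · 4C²/r² = 1600 C⁴.
  set m := 10 * d.C * r with hm
  have hm0 : 0 < m := by positivity
  have hsub : ∀ Q ∈ F, interior (Q : Set ℂ) ⊆ centeredSquare z m := by
    intro Q hQ w hw
    have hwQ := interior_subset hw
    obtain ⟨h1, h2, h3⟩ := hzone Q hQ
    have h4 := d.dist_le Q hwQ (d.mem_corner Q)
    have h5 : dist w z ≤ m := by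
      have := dist_triangle_right w z (d.a Q)
      rw [hm]; linarith
    rw [dist_eq_norm] at h5
    rw [mem_centeredSquare]
    exact ⟨(Complex.abs_re_le_norm (w - z)).trans h5, (Complex.abs_im_le_norm (w - z)).trans h5⟩
  have hvol : ∑ Q ∈ F, volume (interior (Q : Set ℂ)) ≤ ENNReal.ofReal ((2 * m) ^ 2) := by
    rw [← volume_closedSquare ⟨z.re - m, z.im - m⟩ (by positivity : 0 ≤ 2 * m),
      ← measure_biUnion_finset (fun Q _ Q' _ hne => hW.2.1 Q.2 Q'.2 (Subtype.coe_injective.ne hne))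
        (fun Q _ => isOpen_interior.measurableSet)]
    exact measure_mono (iUnion₂_subset hsub)
  have hlow : ∀ Q ∈ F, ENNReal.ofReal (r ^ 2 / (4 * d.C ^ 2)) ≤ volume (interior (Q : Set ℂ)) := by
    intro Q hQ
    rw [d.eq_square, volume_interior_closedSquare _ (d.L_pos Q).le]
    apply ENNReal.ofReal_le_ofReal
    have h2 := (hzone Q hQ).2.1
    rw [div_le_iff₀ (by positivity)]
    calc r ^ 2 ≤ (2 * d.C * d.L Q) ^ 2 := by gcongr
      _ = _ := by ring
  have h1 : (F.card : ENNReal) * ENNReal.ofReal (r ^ 2 / (4 * d.C ^ 2)) ≤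
      ENNReal.ofReal ((2 * m) ^ 2) := by
    refine le_trans ?_ hvol
    rw [← nsmul_eq_mul]
    exact Finset.card_nsmul_le_sum _ _ _ hlow
  rw [← ENNReal.ofReal_natCast, ← ENNReal.ofReal_mul (by positivity),
    ENNReal.ofReal_le_ofReal_iff (by positivity)] at h1
  rw [← ENNReal.ofReal_natCast, ENNReal.ofReal_le_ofReal_iff (by positivity)]
  have h2 : (F.card : ℝ) * r ^ 2 ≤ 1600 * d.C ^ 4 * r ^ 2 := by
    rw [mul_div_assoc', div_le_iff₀ (by positivity)] at h1
    calc (F.card : ℝ) * r ^ 2 ≤ (2 * m) ^ 2 * (4 * d.C ^ 2) := h1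
      _ = _ := by rw [hm]; ring
  exact le_of_mul_le_mul_right h2 (by positivity)

/-- Summing the integrals over the zones multiplies the total integral by at most the overlap bound.
-/
lemma tsum_lintegral_zone_lt_top (hW : IsWhitneyDecomposition W D) {h : ℂ → ENNReal}
    (hm : AEMeasurable h) (hfin : ∫⁻ z, h z ≠ ⊤) : ∑' Q : W, ∫⁻ z in d.zone Q, h z ≠ ⊤ := by
  have := hW.countable.to_subtype
  have hind : ∀ Q, ∫⁻ z in d.zone Q, h z =
      ∫⁻ z, (d.zone Q).indicator (fun _ => 1) z * h z := fun Q => by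
    rw [← lintegral_indicator (d.isClosed_zone Q).measurableSet]
    refine lintegral_congr fun z => ?_
    by_cases hz : z ∈ d.zone Q <;> simp [hz]
  simp_rw [hind]
  rw [← lintegral_tsum fun Q => ?_]
  · refine ne_top_of_le_ne_top (ENNReal.mul_ne_top (ENNReal.ofReal_ne_top (r := 1600 * d.C ^ 4)) hfin)
      ?_
    rw [← lintegral_const_mul' _ _ ENNReal.ofReal_ne_top]
    refine lintegral_mono fun z => ?_
    rw [ENNReal.tsum_mul_right]
    gcongr
    exact d.tsum_indicator_zone_le hW z
  · exact (measurable_const.indicator (d.isClosed_zone Q).measurableSet).aemeasurable.mul hm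

end WhitneyData

/-! ### Cells, their means and their oscillations. -/

/-- A cover of `D` by countably many compact cells, each contained in a member `square i` of `W`,
with mean values `mean i` of `F` over the cells whose differences are controlled by `osc i` for
neighbouring cells. -/
structure CellCover (W : Set (Set ℂ)) (D : Set ℂ) (F : ℂ → ℂ) where
  ι : Type
  countable : Countable ι
  square : ι → W
  cell : ι → Set ℂ
  nbhd : ι → Set ℂ
  mean : ι → ℂ
  osc : ι → ℝ
  K : ℝ
  K_nonneg : 0 ≤ K
  osc_nonneg : ∀ i, 0 ≤ osc i
  cell_subset : ∀ i, cell i ⊆ (square i : Set ℂ)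
  isClosed_cell : ∀ i, IsClosed (cell i)
  isOpen_nbhd : ∀ i, IsOpen (nbhd i)
  cell_subset_nbhd : ∀ i, cell i ⊆ nbhd i
  exists_mem_cell : ∀ z ∈ D, ∃ i, z ∈ cell i
  norm_mean_sub_le : ∀ i j, (cell j ∩ nbhd i).Nonempty → ‖mean i - mean j‖ ≤ osc i
  norm_mean_sub_le_of_forall : ∀ i c r, (∀ z ∈ cell i, ‖F z - c‖ ≤ r) → ‖mean i - c‖ ≤ r
  dist_le : ∀ i, ∀ z ∈ cell i, ∀ w ∈ cell i, dist w z ≤ K * infDist z (frontier D)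
  tsum_lt_top : ∀ s : W → ENNReal, ∑' Q, s Q ^ 2 ≠ ⊤ →
    ∑' i, (ENNReal.ofReal (osc i) ^ 2 + s (square i) ^ 2) ≠ ⊤

namespace WhitneyData

variable {W : Set (Set ℂ)} {D : Set ℂ} (d : WhitneyData W D)

/-- The ratio of the size of a neighbourhood of a cell to the size of the cell. -/
noncomputable def κ : ℝ := 2 + d.C * (d.C + 4)

/-- The number of parts into which the sides of the squares are divided. -/
noncomputable def N : ℕ := ⌈8 * d.κ * d.C⌉₊

lemma two_le_κ : 2 ≤ d.κ := by
  have := d.C_pos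
  rw [κ]
  have : 0 ≤ d.C * (d.C + 4) := by positivity
  linarith

lemma le_N : 8 * d.κ * d.C ≤ d.N := Nat.le_ceil _

lemma N_pos : 0 < d.N := by
  have h1 := d.two_le_κ
  have h2 := d.C_pos
  rw [N, Nat.ceil_pos]
  positivity

/-- The lower left corner of a cell. -/
noncomputable def corner (i : W × Fin d.N × Fin d.N) : ℂ :=
  subsquareCorner (d.a i.1) (d.L i.1) d.N i.2.1 i.2.2

/-- The side length of a cell. -/
noncomputable def side (i : W × Fin d.N × Fin d.N) : ℝ := d.L i.1 / d.N

/-- A cell: one of the `N * N` equal subsquares of a square of the decomposition. -/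
noncomputable def cell (i : W × Fin d.N × Fin d.N) : Set ℂ := closedSquare (d.corner i) (d.side i)

/-- A square around a cell which contains all its neighbours. -/
noncomputable def bigCell (i : W × Fin d.N × Fin d.N) : Set ℂ :=
  centeredSquare (d.corner i) (d.κ * d.side i)

/-- An open neighbourhood of a cell. -/
noncomputable def cellNbhd (i : W × Fin d.N × Fin d.N) : Set ℂ :=
  {z | |z.re - (d.corner i).re| < 2 * d.side i ∧ |z.im - (d.corner i).im| < 2 * d.side i}

lemma side_pos (i) : 0 < d.side i :=
  div_pos (d.L_pos _) (by exact_mod_cast d.N_pos)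

lemma cell_subset (i) : d.cell i ⊆ (i.1 : Set ℂ) := by
  rw [d.eq_square]
  exact subsquare_subset (d.L_pos _) _ _

lemma corner_mem_cell (i) : d.corner i ∈ d.cell i := by
  rw [cell, mem_closedSquare]
  simp [(d.side_pos i).le]

/-- `N` is chosen for this inequality. It puts all points of the big cell within L/(4C) of the
corner of the cell, hence well inside D and at a distance from ∂D comparable to L. -/
lemma κ_mul_side_le (i) : 8 * (d.κ * d.side i) * d.C ≤ d.L i.1 := by
  have hN : (0 : ℝ) < d.N := by exact_mod_cast d.N_pos
  have h1 := d.le_N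
  have h2 := d.L_pos i.1
  calc 8 * (d.κ * d.side i) * d.C = (8 * d.κ * d.C) * d.L i.1 / d.N := by rw [side]; ring
    _ ≤ d.N * d.L i.1 / d.N := by gcongr
    _ = d.L i.1 := by field_simp

lemma isOpen_cellNbhd (i) : IsOpen (d.cellNbhd i) := by
  have h1 : IsOpen {z : ℂ | |z.re - (d.corner i).re| < 2 * d.side i} :=
    isOpen_lt (by fun_prop) continuous_const
  have h2 : IsOpen {z : ℂ | |z.im - (d.corner i).im| < 2 * d.side i} :=
    isOpen_lt (by fun_prop) continuous_const
  exact h1.inter h2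

lemma cell_subset_cellNbhd (i) : d.cell i ⊆ d.cellNbhd i := by
  intro z hz
  obtain ⟨⟨h1, h2⟩, h3, h4⟩ := mem_closedSquare.1 hz
  have := d.side_pos i
  constructor <;> rw [abs_lt] <;> constructor <;> linarith

/-- Distances from the boundary inside a neighbourhood of a cell. -/
lemma infDist_bigCell {i} {z : ℂ} (hz : z ∈ d.bigCell i) :
    d.L i.1 ≤ 2 * d.C * infDist z (frontier D) ∧ infDist z (frontier D) ≤ 2 * d.C * d.L i.1 ∧
      dist z (d.corner i) ≤ d.L i.1 / 4 ∧ dist z (d.corner i) < infDist (d.corner i) (frontier D) := by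
  have h1 := dist_le_of_mem_centeredSquare hz
  have h2 := d.κ_mul_side_le i
  have hC := d.one_le_C
  have hL := d.L_pos i.1
  have hp := d.cell_subset i (d.corner_mem_cell i)
  have h3 := d.L_le _ _ hp
  have h4 := d.le_L _ _ hp
  have h5 : infDist z (frontier D) ≤ infDist (d.corner i) (frontier D) + dist z (d.corner i) :=
    infDist_le_infDist_add_dist
  have h6 : infDist (d.corner i) (frontier D) ≤ infDist z (frontier D) + dist z (d.corner i) := by
    rw [dist_comm]; exact infDist_le_infDist_add_dist
  have hm : 0 ≤ d.κ * d.side i :=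
    mul_nonneg (by linarith [d.two_le_κ]) (d.side_pos i).le
  have h7 : 4 * dist z (d.corner i) * d.C ≤ d.L i.1 := by
    calc 4 * dist z (d.corner i) * d.C ≤ 4 * (2 * (d.κ * d.side i)) * d.C := by gcongr
      _ ≤ _ := by linarith
  have h8 : dist z (d.corner i) ≤ dist z (d.corner i) * d.C :=
    le_mul_of_one_le_right dist_nonneg hC
  refine ⟨?_, ?_, ?_, ?_⟩
  · nlinarith
  · nlinarith
  · linarith
  · by_contra hcon
    have : d.C * infDist (d.corner i) (frontier D) ≤ d.C * dist z (d.corner i) :=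
      mul_le_mul_of_nonneg_left (not_lt.1 hcon) d.C_pos.le
    linarith

lemma bigCell_subset (hD : IsOpen D) (hW : IsWhitneyDecomposition W D) (i) :
    d.bigCell i ⊆ D := fun _ hz =>
  mem_of_dist_lt_infDist_frontier hD
    (hW.1.subset ⟨i.1, i.1.2, d.cell_subset i (d.corner_mem_cell i)⟩) (d.infDist_bigCell hz).2.2.2

lemma bigCell_subset_zone (i) : d.bigCell i ⊆ d.zone i.1 := by
  intro z hz
  obtain ⟨h1, h2, h3, -⟩ := d.infDist_bigCell hz
  refine ⟨h1, h2, ?_⟩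
  have h4 := d.dist_le i.1 (d.cell_subset i (d.corner_mem_cell i)) (d.mem_corner i.1)
  have := dist_triangle z (d.corner i) (d.a i.1)
  linarith [d.L_pos i.1]

lemma cell_subset_bigCell (i) : d.cell i ⊆ d.bigCell i :=
  closedSquare_subset_centeredSquare (by
    have := d.two_le_κ; have := d.side_pos i; nlinarith)

/-- Neighbouring cells have comparable sizes. -/
lemma neighbour {i j} (h : (d.cell j ∩ d.cellNbhd i).Nonempty) :
    d.cell j ⊆ d.bigCell i ∧ d.side i ≤ 2 * d.C ^ 2 * d.side j := by
  obtain ⟨z, hzj, hzi⟩ := h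
  have hC := d.one_le_C
  have hN : (0 : ℝ) < d.N := by exact_mod_cast d.N_pos
  have hsi := d.side_pos i
  have hLi := d.L_pos i.1
  have hzb : z ∈ d.bigCell i := by
    rw [bigCell, mem_centeredSquare]
    have := d.two_le_κ
    have h2 : 2 * d.side i ≤ d.κ * d.side i := by gcongr
    exact ⟨hzi.1.le.trans h2, hzi.2.le.trans h2⟩
  obtain ⟨h1, -, h3, -⟩ := d.infDist_bigCell hzb
  have hzQ := d.cell_subset j hzj
  have h4 := d.L_le _ _ hzQ
  have h5 := d.le_L _ _ hzQ
  have hp := d.cell_subset i (d.corner_mem_cell i)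
  have h6 := d.le_L _ _ hp
  have h7 : infDist z (frontier D) ≤ infDist (d.corner i) (frontier D) + dist z (d.corner i) :=
    infDist_le_infDist_add_dist
  have h8 : d.L j.1 ≤ d.C * (d.C + 4) * d.L i.1 := by
    calc d.L j.1 ≤ d.C * infDist z (frontier D) := h4
      _ ≤ d.C * (d.C * d.L i.1 + 4 * d.L i.1) := by
        have := d.C_pos
        gcongr
        linarith
      _ = _ := by ring
  have h9 : d.side j ≤ d.C * (d.C + 4) * d.side i := by
    rw [side, side, ← mul_div_assoc]; gcongr
  have h10 : d.L i.1 ≤ 2 * d.C ^ 2 * d.L j.1 := by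
    calc d.L i.1 ≤ 2 * d.C * infDist z (frontier D) := h1
      _ ≤ 2 * d.C * (d.C * d.L j.1) := by
        have := d.C_pos
        gcongr
      _ = _ := by ring
  refine ⟨fun w hw => ?_, ?_⟩
  · obtain ⟨⟨a1, a2⟩, a3, a4⟩ := mem_closedSquare.1 hw
    obtain ⟨⟨b1, b2⟩, b3, b4⟩ := mem_closedSquare.1 hzj
    obtain ⟨c1, c2⟩ := hzi
    rw [abs_lt] at c1 c2
    -- This is where the value of `κ` comes from: two sides of the cell reach the common point z,
    -- and C(C + 4) sides bound the extent of the neighbouring cell from there.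
    have hk : d.κ * d.side i = 2 * d.side i + d.C * (d.C + 4) * d.side i := by rw [κ]; ring
    rw [bigCell, mem_centeredSquare, hk, abs_le, abs_le]
    refine ⟨⟨?_, ?_⟩, ?_, ?_⟩ <;> linarith [c1.1, c1.2, c2.1, c2.2]
  · rw [side, side, ← mul_div_assoc]; gcongr

/-- The cell cover associated with a Whitney decomposition and a function with square integrable
weak derivatives. -/
theorem _root_.IsWhitneyDecomposition.nonempty_cellCover {W : Set (Set ℂ)} {D : Set ℂ}
    (hW : IsWhitneyDecomposition W D) (hD : IsOpen D)
    {F g₁ g₂ : ℂ → ℂ} (hF : Continuous F) (hFs : HasCompactSupport F)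
    (hg₁ : Integrable g₁) (hg₂ : Integrable g₂) (hg₁' : MemLp g₁ 2) (hg₂' : MemLp g₂ 2)
    (h₁ : IsWeakDeriv F g₁ 1 D) (h₂ : IsWeakDeriv F g₂ Complex.I D) :
    Nonempty (CellCover W D F) := by
  obtain ⟨d⟩ := hW.exists_data
  have hWc := hW.countable.to_subtype
  have hC := d.C_pos
  have hκ := d.two_le_κ
  let h : ℂ → ℝ := fun z => ‖g₁ z‖ + ‖g₂ z‖
  have hh : Integrable h := hg₁.norm.add hg₂.norm
  have hh2 : MemLp h 2 := hg₁'.norm.add hg₂'.norm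
  have hh0 : ∀ z, 0 ≤ h z := fun z => by positivity
  let mean : W × Fin d.N × Fin d.N → ℂ := fun i => ⨍ z in d.cell i, F z
  -- The Poincaré inequality in the big cell compares the means of both cells with one constant, at
  -- the cost 1/side for each. The side of the neighbour is smaller by at most the factor 2C²,
  -- whence 1 + 2C².
  let osc : W × Fin d.N × Fin d.N → ℝ := fun i =>
    (1 + 2 * d.C ^ 2) / d.side i * ∫ z in d.bigCell i, h z
  have hosc : ∀ i, 0 ≤ osc i := fun i =>
    mul_nonneg (div_nonneg (by positivity) (d.side_pos i).le) (integral_nonneg hh0)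
  have hmean : ∀ i j, (d.cell j ∩ d.cellNbhd i).Nonempty → ‖mean i - mean j‖ ≤ osc i := by
    intro i j hij
    have hsi := d.side_pos i
    have hsj := d.side_pos j
    obtain ⟨hsub, hside⟩ := d.neighbour hij
    obtain ⟨c, hc⟩ := exists_norm_average_sub_le hD hF hFs hg₁ hg₂ h₁ h₂
      (a := ⟨(d.corner i).re - d.κ * d.side i, (d.corner i).im - d.κ * d.side i⟩)
      (R := 2 * (d.κ * d.side i)) (by positivity) (d.bigCell_subset hD hW i)
    have hi := hc _ _ hsi (d.cell_subset_bigCell i)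
    have hj := hc _ _ hsj hsub
    have hint : 0 ≤ ∫ z in d.bigCell i, h z := integral_nonneg hh0
    have hinv : (d.side j)⁻¹ ≤ 2 * d.C ^ 2 / d.side i := by
      rw [inv_eq_one_div, div_le_div_iff₀ hsj hsi]; linarith
    calc ‖mean i - mean j‖ = ‖(mean i - c) - (mean j - c)‖ := by congr 1; ring
      _ ≤ ‖mean i - c‖ + ‖mean j - c‖ := norm_sub_le _ _
      _ ≤ (d.side i)⁻¹ * (∫ z in d.bigCell i, h z) + (d.side j)⁻¹ * ∫ z in d.bigCell i, h z :=
          add_le_add hi hj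
      _ ≤ (d.side i)⁻¹ * (∫ z in d.bigCell i, h z) +
            2 * d.C ^ 2 / d.side i * ∫ z in d.bigCell i, h z := by gcongr
      _ = osc i := by simp only [osc]; ring
  have hvolc : ∀ i, volume (d.cell i) = ENNReal.ofReal (d.side i ^ 2) := fun i =>
    volume_closedSquare _ (d.side_pos i).le
  have hmean' : ∀ i c r, (∀ z ∈ d.cell i, ‖F z - c‖ ≤ r) → ‖mean i - c‖ ≤ r := by
    intro i c r hr
    have hsi := d.side_pos i
    have h1 : mean i ∈ closedBall c r := by
      refine (convex_closedBall c r).set_average_mem isClosed_closedBall ?_ ?_ ?_ ?_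
      · rw [hvolc]; simp; positivity
      · rw [hvolc]; simp
      · filter_upwards [ae_restrict_mem (isCompact_closedSquare _ _).measurableSet] with z hz
        rw [mem_closedBall, dist_eq_norm]
        exact hr z hz
      · exact hF.continuousOn.integrableOn_compact (isCompact_closedSquare _ _)
    rwa [mem_closedBall, dist_eq_norm] at h1
  -- In the square of osc the factor 1/side² cancels against the area (2κ · side)² that comes from
  -- Cauchy–Schwarz. The constant is therefore the same for all cells.
  set A : ENNReal := ENNReal.ofReal (((1 + 2 * d.C ^ 2) * (2 * d.κ)) ^ 2) with hA
  have hsq : ∀ i, ENNReal.ofReal (osc i) ^ 2 ≤ A * ∫⁻ z in d.zone i.1, ‖h z‖ₑ ^ 2 := by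
    intro i
    have hsi := d.side_pos i
    have e1 : ENNReal.ofReal (∫ z in d.bigCell i, h z) = ∫⁻ z in d.bigCell i, ‖h z‖ₑ := by
      rw [ofReal_integral_eq_lintegral_ofReal hh.integrableOn (Eventually.of_forall hh0)]
      refine lintegral_congr fun z => ?_
      rw [← ofReal_norm, Real.norm_of_nonneg (hh0 z)]
    have e2 : volume (d.bigCell i) = ENNReal.ofReal ((2 * (d.κ * d.side i)) ^ 2) :=
      volume_closedSquare _ (by positivity)
    have hcs := sq_lintegral_le_mul_lintegral_sq (volume.restrict (d.bigCell i))
      (f := fun z => ‖h z‖ₑ) hh.aestronglyMeasurable.enorm.restrict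
    rw [Measure.restrict_apply_univ, e2] at hcs
    calc ENNReal.ofReal (osc i) ^ 2
        = ENNReal.ofReal (((1 + 2 * d.C ^ 2) / d.side i) ^ 2) *
            (∫⁻ z in d.bigCell i, ‖h z‖ₑ) ^ 2 := by
          simp only [osc]
          rw [ENNReal.ofReal_mul (by positivity), mul_pow, e1, ← ENNReal.ofReal_pow (by positivity)]
      _ ≤ ENNReal.ofReal (((1 + 2 * d.C ^ 2) / d.side i) ^ 2) *
            (ENNReal.ofReal ((2 * (d.κ * d.side i)) ^ 2) * ∫⁻ z in d.bigCell i, ‖h z‖ₑ ^ 2) := by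
          gcongr
      _ = A * ∫⁻ z in d.bigCell i, ‖h z‖ₑ ^ 2 := by
          rw [← mul_assoc, ← ENNReal.ofReal_mul (by positivity), hA]
          congr 2
          field_simp
      _ ≤ _ := by gcongr; exact d.bigCell_subset_zone i
  refine ⟨{ ι := W × Fin d.N × Fin d.N
            countable := inferInstance
            square := fun i => i.1
            cell := d.cell
            nbhd := d.cellNbhd
            mean := mean
            osc := osc
            K := 2 * d.C
            K_nonneg := by positivity
            osc_nonneg := hosc
            cell_subset := d.cell_subset
            isClosed_cell := fun i => (isCompact_closedSquare _ _).isClosed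
            isOpen_nbhd := d.isOpen_cellNbhd
            cell_subset_nbhd := d.cell_subset_cellNbhd
            exists_mem_cell := fun z hz => ?_
            norm_mean_sub_le := hmean
            norm_mean_sub_le_of_forall := hmean'
            dist_le := fun i z hz w hw => ?_
            tsum_lt_top := fun s hs => ?_ }⟩
  · rw [← hW.1] at hz
    obtain ⟨Q, hQ, hzQ⟩ := hz
    have := d.eq_square ⟨Q, hQ⟩
    simp only at this
    rw [this] at hzQ
    obtain ⟨i, j, hij⟩ := exists_mem_subsquare (d.L_pos ⟨Q, hQ⟩) d.N_pos hzQ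
    exact ⟨(⟨Q, hQ⟩, i, j), hij⟩
  · have h1 := d.dist_le i.1 (d.cell_subset i hw) (d.cell_subset i hz)
    have h2 := d.L_le i.1 z (d.cell_subset i hz)
    linarith
  · have hfin : ∑' Q : W, ∫⁻ z in d.zone Q, ‖h z‖ₑ ^ 2 ≠ ⊤ := by
      refine d.tsum_lintegral_zone_lt_top hW (hh2.1.enorm.pow_const 2) ?_
      have := hh2.eLpNorm_lt_top
      have h3 := (eLpNorm_lt_top_iff_lintegral_rpow_enorm_lt_top (by norm_num) (by norm_num)).1 this
      simpa using h3.ne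
    -- All cells of a square are charged to the zone of that square, so the sum over cells is at
    -- most N² times a sum over squares.
    have hle : ∑' i : W × Fin d.N × Fin d.N, (ENNReal.ofReal (osc i) ^ 2 + s i.1 ^ 2) ≤
        ∑' Q : W, ∑' _ : Fin d.N × Fin d.N,
          (A * (∫⁻ z in d.zone Q, ‖h z‖ₑ ^ 2) + s Q ^ 2) := by
      rw [ENNReal.tsum_prod' (α := W)]
      exact ENNReal.tsum_le_tsum fun Q => ENNReal.tsum_le_tsum fun k =>
        add_le_add (hsq (Q, k)) le_rfl
    refine ne_top_of_le_ne_top ?_ hle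
    have : ∀ Q : W, ∑' _ : Fin d.N × Fin d.N, (A * (∫⁻ z in d.zone Q, ‖h z‖ₑ ^ 2) + s Q ^ 2) =
        (Fintype.card (Fin d.N × Fin d.N) : ENNReal) *
          (A * (∫⁻ z in d.zone Q, ‖h z‖ₑ ^ 2) + s Q ^ 2) := fun Q => by
      rw [tsum_fintype, Finset.sum_const, nsmul_eq_mul, Finset.card_univ]
    simp_rw [this]
    rw [ENNReal.tsum_mul_left, ENNReal.tsum_add, ENNReal.tsum_mul_left]
    refine ENNReal.mul_ne_top (ENNReal.natCast_ne_top _) (ENNReal.add_ne_top.2 ⟨?_, hs⟩)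
    exact ENNReal.mul_ne_top ENNReal.ofReal_ne_top hfin

end WhitneyData

/-! ### The boundary and its image on almost every line. -/

namespace CellCover

variable {W : Set (Set ℂ)} {D : Set ℂ} {F : ℂ → ℂ} (cc : CellCover W D F)

/-- If the value `t` is avoided by the ranges of all cells that meet a connected set, then it is
on the same side of all these ranges. -/
lemma forall_lt_or_forall_gt {ρ : ℂ → ℝ} (hρ : ∀ z w, |ρ z - ρ w| ≤ ‖z - w‖) {X : Set ℂ}
    (hX : IsPreconnected X) (hXD : X ⊆ D) {t : ℝ}
    (ht : ∀ i, (cc.cell i ∩ X).Nonempty →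
      t ∉ Icc (ρ (cc.mean i) - cc.osc i) (ρ (cc.mean i) + cc.osc i)) :
    (∀ i, (cc.cell i ∩ X).Nonempty → t < ρ (cc.mean i)) ∨
      (∀ i, (cc.cell i ∩ X).Nonempty → ρ (cc.mean i) < t) := by
  by_contra! hcon
  obtain ⟨⟨i, hi, hit⟩, j, hj, hjt⟩ := hcon
  have hcase : ∀ i, (cc.cell i ∩ X).Nonempty →
      ρ (cc.mean i) + cc.osc i < t ∨ t < ρ (cc.mean i) - cc.osc i := fun i hi => by
    by_contra! h
    exact ht i hi ⟨h.2, h.1⟩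
  -- The neighbourhoods of the cells with range below t and of those with range above t are two open
  -- sets covering X. If both meet X, they share a point of X, and the mean over a cell at that
  -- point would be both below and above t.
  let A : Set ℂ := ⋃ i ∈ {i | ρ (cc.mean i) + cc.osc i < t ∧ (cc.cell i ∩ X).Nonempty}, cc.nbhd i
  let B : Set ℂ := ⋃ i ∈ {i | t < ρ (cc.mean i) - cc.osc i ∧ (cc.cell i ∩ X).Nonempty}, cc.nbhd i
  have hA : IsOpen A := isOpen_biUnion fun i _ => cc.isOpen_nbhd i
  have hB : IsOpen B := isOpen_biUnion fun i _ => cc.isOpen_nbhd i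
  have hcov : X ⊆ A ∪ B := by
    intro z hz
    obtain ⟨k, hk⟩ := cc.exists_mem_cell z (hXD hz)
    have hne : (cc.cell k ∩ X).Nonempty := ⟨z, hk, hz⟩
    rcases hcase k hne with h | h
    · exact Or.inl (mem_biUnion (show k ∈ {i | _ ∧ _} from ⟨h, hne⟩) (cc.cell_subset_nbhd k hk))
    · exact Or.inr (mem_biUnion (show k ∈ {i | _ ∧ _} from ⟨h, hne⟩) (cc.cell_subset_nbhd k hk))
  have h0i := cc.osc_nonneg i
  have h0j := cc.osc_nonneg j
  have hXA : (X ∩ A).Nonempty := by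
    obtain ⟨z, hz, hzX⟩ := hi
    refine ⟨z, hzX, mem_biUnion (show i ∈ {i | _ ∧ _} from ⟨?_, z, hz, hzX⟩)
      (cc.cell_subset_nbhd i hz)⟩
    exact (hcase i ⟨z, hz, hzX⟩).resolve_right (by linarith)
  have hXB : (X ∩ B).Nonempty := by
    obtain ⟨z, hz, hzX⟩ := hj
    refine ⟨z, hzX, mem_biUnion (show j ∈ {i | _ ∧ _} from ⟨?_, z, hz, hzX⟩)
      (cc.cell_subset_nbhd j hz)⟩
    exact (hcase j ⟨z, hz, hzX⟩).resolve_left (by linarith)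
  obtain ⟨z, hzX, hzA, hzB⟩ := hX A B hA hB hcov hXA hXB
  obtain ⟨k, hk⟩ := cc.exists_mem_cell z (hXD hzX)
  have hne : (cc.cell k ∩ X).Nonempty := ⟨z, hk, hzX⟩
  obtain ⟨m, ⟨hm, -⟩, hmz⟩ := mem_iUnion₂.1 hzA
  obtain ⟨n, ⟨hn, -⟩, hnz⟩ := mem_iUnion₂.1 hzB
  have h1 := (hρ _ _).trans (cc.norm_mean_sub_le m k ⟨z, hk, hmz⟩)
  have h2 := (hρ _ _).trans (cc.norm_mean_sub_le n k ⟨z, hk, hnz⟩)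
  rw [abs_le] at h1 h2
  rcases hcase k hne with h | h <;> linarith [cc.osc_nonneg k, h1.1, h2.2]

/-- The mean values over cells close to a boundary point are close to the value there. -/
lemma exists_forall_norm_mean_sub_le (hF : Continuous F) {x : ℂ} (hx : x ∈ frontier D) {ε : ℝ}
    (hε : 0 < ε) : ∃ δ > 0, ∀ i, ∀ z ∈ cc.cell i, dist z x < δ → ‖cc.mean i - F x‖ ≤ ε := by
  obtain ⟨δ, hδ, h⟩ := Metric.continuous_iff.1 hF x ε hε
  have hK := cc.K_nonneg
  -- Cells shrink near the boundary: their points are within K · dist z x of z, so within (K + 1) ·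
  -- dist z x of x.
  refine ⟨δ / (cc.K + 1), by positivity, fun i z hz hzx => ?_⟩
  refine cc.norm_mean_sub_le_of_forall i _ _ fun w hw => ?_
  have h1 := cc.dist_le i z hz w hw
  have h2 : infDist z (frontier D) ≤ dist z x := infDist_le_dist_of_mem hx
  have h3 : dist w x < δ := by
    calc dist w x ≤ dist w z + dist z x := dist_triangle _ _ _
      _ ≤ cc.K * dist z x + dist z x := by
        refine add_le_add (h1.trans ?_) le_rfl
        gcongr
      _ = dist z x * (cc.K + 1) := by ring
      _ < δ := by rwa [lt_div_iff₀ (by positivity)] at hzx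
  rw [← dist_eq_norm]
  exact (h w h3).le

/-- The set of points of `V` which are endpoints of intervals contained in the complement. -/
lemma countable_isolated (V : Set ℝ) :
    ({t | t ∈ V ∧ 𝓝[V ∩ Ioi t] t = ⊥} ∪ {t | t ∈ V ∧ 𝓝[V ∩ Iio t] t = ⊥}).Countable :=
  countable_setOfPred_isolated_right_within.union countable_setOfPred_isolated_left_within

lemma nhdsWithin_compl_inter_Ioi_eq_bot {V : Set ℝ} {t u : ℝ} (h : t < u) (hV : Ioo t u ⊆ V) :
    𝓝[Vᶜ ∩ Ioi t] t = ⊥ := by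
  rw [← mem_closure_iff_nhdsWithin_neBot.not.trans not_neBot, mem_closure_iff_nhds]
  intro hcon
  obtain ⟨z, hz, hzV, hzt⟩ := hcon _ (Iio_mem_nhds h)
  exact hzV (hV ⟨hzt, hz⟩)

lemma nhdsWithin_compl_inter_Iio_eq_bot {V : Set ℝ} {t u : ℝ} (h : u < t) (hV : Ioo u t ⊆ V) :
    𝓝[Vᶜ ∩ Iio t] t = ⊥ := by
  rw [← mem_closure_iff_nhdsWithin_neBot.not.trans not_neBot, mem_closure_iff_nhds]
  intro hcon
  obtain ⟨z, hz, hzV, hzt⟩ := hcon _ (Ioi_mem_nhds h)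
  exact hzV (hV ⟨hz, hzt⟩)

/-- A final part of a radius avoids finitely many cells. -/
lemma exists_radius_avoiding {φ : ℂ → ℂ} (hφ : IsConformalFromDisk φ D) (hD : IsOpen D)
    (hWD : ∀ Q ∈ W, Q ⊆ D) {x ζ : ℂ} (hx : x ∈ frontier D) (hζ : ‖ζ‖ = 1)
    (hlim : Tendsto (fun r : ℝ => φ (r * ζ)) (𝓝[<] 1) (𝓝 x)) (s : Finset cc.ι) :
    ∃ X ⊆ D, IsPreconnected X ∧ (∀ δ > 0, ∃ z ∈ X, dist z x < δ) ∧
      ∀ i, (cc.cell i ∩ X).Nonempty → i ∉ s ∧ x ∈ shadow φ D (cc.square i) := by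
  -- Finitely many cells form a closed subset of D, which stays away from the boundary point x. The
  -- end of the radius near x therefore misses them.
  have hcl : IsClosed (⋃ i ∈ s, cc.cell i) := isClosed_biUnion_finset fun i _ => cc.isClosed_cell i
  have hxn : x ∈ (⋃ i ∈ s, cc.cell i)ᶜ := by
    intro h
    obtain ⟨i, -, hi⟩ := mem_iUnion₂.1 h
    rw [hD.frontier_eq] at hx
    exact hx.2 (hWD _ (cc.square i).2 (cc.cell_subset i hi))
  have hev : ∀ᶠ r : ℝ in 𝓝[<] 1, φ (r * ζ) ∈ (⋃ i ∈ s, cc.cell i)ᶜ :=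
    hlim (hcl.isOpen_compl.mem_nhds hxn)
  obtain ⟨r₀', hr₀', hsub⟩ := (mem_nhdsLT_iff_exists_Ioo_subset).1 hev
  set r₀ := max r₀' 0
  have hr₀ : r₀ < 1 := max_lt hr₀' one_pos
  have hball : ∀ r ∈ Ioo r₀ 1, (r : ℂ) * ζ ∈ ball (0 : ℂ) 1 := fun r hr => by
    have : 0 < r := (le_max_right _ _).trans_lt hr.1
    rw [mem_ball_zero_iff, norm_mul, hζ, mul_one, Complex.norm_real, Real.norm_of_nonneg this.le]
    exact hr.2
  refine ⟨(fun r : ℝ => φ (r * ζ)) '' Ioo r₀ 1, ?_, ?_, fun δ hδ => ?_, ?_⟩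
  · rintro _ ⟨r, hr, rfl⟩
    exact hφ.2.mapsTo (hball r hr)
  · refine isPreconnected_Ioo.image _ ?_
    exact hφ.1.continuousOn.comp (by fun_prop) hball
  · have h1 : ∀ᶠ r : ℝ in 𝓝[<] 1, dist (φ (r * ζ)) x < δ := hlim (ball_mem_nhds x hδ)
    obtain ⟨r, hr, hr'⟩ := (h1.and (Ioo_mem_nhdsLT hr₀)).exists
    exact ⟨_, mem_image_of_mem _ hr', hr⟩
  · rintro i ⟨_, hi, ⟨r, hr, rfl⟩⟩
    have hr' : r ∈ Ioo r₀' 1 := ⟨(le_max_left _ _).trans_lt hr.1, hr.2⟩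
    refine ⟨fun his => ?_, hx, ζ, hζ, hlim, r, (le_max_right r₀' 0).trans hr.1.le, hr.2,
      cc.cell_subset i hi⟩
    exact hsub hr' (mem_biUnion his hi)

/-- The values of `F` at boundary points are covered, up to a countable set, by the ranges of the
cells in whose shadows these points lie. -/
lemma mem_union_isolated (hF : Continuous F) {φ : ℂ → ℂ} (hφ : IsConformalFromDisk φ D)
    (hD : IsJordanDomain D) (hWD : ∀ Q ∈ W, Q ⊆ D)
    {ρ : ℂ → ℝ} (hρ : ∀ z w, |ρ z - ρ w| ≤ ‖z - w‖) {V : Set ℝ} {x : ℂ} (hx : x ∈ frontier D)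
    (s : Finset cc.ι)
    (hV : ∀ i, i ∉ s → x ∈ shadow φ D (cc.square i) →
      Icc (ρ (cc.mean i) - cc.osc i) (ρ (cc.mean i) + cc.osc i) ⊆ V) :
    ρ (F x) ∈ V ∪
      ({t | t ∈ Vᶜ ∧ 𝓝[Vᶜ ∩ Ioi t] t = ⊥} ∪ {t | t ∈ Vᶜ ∧ 𝓝[Vᶜ ∩ Iio t] t = ⊥}) := by
  obtain ⟨ζ, hζ, hlim⟩ := exists_radial_limit_of_mem_frontier hD hφ hx
  obtain ⟨X, hXD, hXp, hXx, hXs⟩ := cc.exists_radius_avoiding hφ hD.1 hWD hx hζ hlim s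
  by_cases htV : ρ (F x) ∈ V
  · exact Or.inl htV
  right
  have hcells : ∀ i, (cc.cell i ∩ X).Nonempty →
      Icc (ρ (cc.mean i) - cc.osc i) (ρ (cc.mean i) + cc.osc i) ⊆ V := fun i hi =>
    hV i (hXs i hi).1 (hXs i hi).2
  have hnear : ∀ ε > 0, ∃ i, (cc.cell i ∩ X).Nonempty ∧ |ρ (cc.mean i) - ρ (F x)| ≤ ε := by
    intro ε hε
    obtain ⟨δ, hδ, h⟩ := cc.exists_forall_norm_mean_sub_le hF hx hε
    obtain ⟨z, hz, hzx⟩ := hXx δ hδ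
    obtain ⟨i, hi⟩ := cc.exists_mem_cell z (hXD hz)
    exact ⟨i, ⟨z, hi, hz⟩, (hρ _ _).trans (h i z hi hzx)⟩
  -- A value outside V lies on one side of the means over all cells met by the curve. These means
  -- come arbitrarily close to ρ(F x), so no such value lies strictly between ρ(F x) and the mean
  -- over the fixed cell i₀. Hence ρ(F x) is isolated on one side in the complement of V.
  have hdich : ∀ t ∉ V, (∀ i, (cc.cell i ∩ X).Nonempty → t < ρ (cc.mean i)) ∨
      (∀ i, (cc.cell i ∩ X).Nonempty → ρ (cc.mean i) < t) := fun t ht =>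
    cc.forall_lt_or_forall_gt hρ hXp hXD fun i hi h => ht (hcells i hi h)
  obtain ⟨i₀, hi₀, -⟩ := hnear 1 one_pos
  rcases hdich _ htV with h | h
  · left
    refine ⟨htV, nhdsWithin_compl_inter_Ioi_eq_bot (h i₀ hi₀) fun t ht => ?_⟩
    by_contra htn
    obtain ⟨i, hi, hit⟩ := hnear ((t - ρ (F x)) / 2) (by linarith [ht.1])
    rw [abs_le] at hit
    rcases hdich t htn with h' | h'
    · linarith [h' i hi, ht.1]
    · linarith [h' i₀ hi₀, ht.2]
  · right
    refine ⟨htV, nhdsWithin_compl_inter_Iio_eq_bot (h i₀ hi₀) fun t ht => ?_⟩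
    by_contra htn
    obtain ⟨i, hi, hit⟩ := hnear ((ρ (F x) - t) / 2) (by linarith [ht.2])
    rw [abs_le] at hit
    rcases hdich t htn with h' | h'
    · linarith [h' i₀ hi₀, ht.1]
    · linarith [h' i hi, ht.2]

/-- Almost every fibre of a projection meets few shadows. -/
lemma ae_tsum_indicator_ne_top {φ : ℂ → ℂ} (hbd : Bornology.IsBounded (frontier D))
    (hs : Summable fun Q : W => diam (shadow φ D (Q : Set ℂ)) ^ 2)
    {p : ℂ → ℝ} (hp : ∀ z w, |p z - p w| ≤ ‖z - w‖) :
    ∀ᵐ y : ℝ, ∑' i, (toMeasurable volume (p '' shadow φ D (cc.square i))).indicator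
      (fun _ => ENNReal.ofReal (cc.osc i) + ENNReal.ofReal (diam (shadow φ D (cc.square i)))) y
        ≠ ⊤ := by
  have := cc.countable
  -- Passing to measurable hulls avoids the measurability of projected shadows and does not change
  -- their measure, which is at most the diameter of the shadow.
  set J : cc.ι → Set ℝ := fun i => toMeasurable volume (p '' shadow φ D (cc.square i))
  set σ : W → ENNReal := fun Q => ENNReal.ofReal (diam (shadow φ D (Q : Set ℂ)))
  have hσ : ∑' Q, σ Q ^ 2 ≠ ⊤ := by
    have : ∀ Q, σ Q ^ 2 = ENNReal.ofReal (diam (shadow φ D (Q : Set ℂ)) ^ 2) := fun Q =>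
      (ENNReal.ofReal_pow diam_nonneg 2).symm
    simp_rw [this]
    exact hs.tsum_ofReal_ne_top
  have hJm : ∀ i, MeasurableSet (J i) := fun i => measurableSet_toMeasurable _ _
  have hJ : ∀ i, volume (J i) ≤ σ (cc.square i) := by
    intro i
    rw [measure_toMeasurable]
    refine (Real.volume_le_diam _).trans (ediam_le ?_)
    rintro _ ⟨z, hz, rfl⟩ _ ⟨w, hw, rfl⟩
    rw [edist_dist, Real.dist_eq]
    refine ENNReal.ofReal_le_ofReal ((hp z w).trans ?_)
    rw [← dist_eq_norm]
    exact dist_le_diam_of_mem (hbd.subset fun u hu => hu.1) hz hw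
  have hmeas : ∀ i, Measurable ((J i).indicator
      (fun _ => ENNReal.ofReal (cc.osc i) + σ (cc.square i))) := fun i =>
    measurable_const.indicator (hJm i)
  have hlt : ∫⁻ y, ∑' i, (J i).indicator
      (fun _ => ENNReal.ofReal (cc.osc i) + σ (cc.square i)) y ≠ ⊤ := by
    rw [lintegral_tsum fun i => (hmeas i).aemeasurable]
    -- The integral over y gives at most (osc + s) · s ≤ 2(osc² + s²); this is the point where the
    -- square summability of the shadows enters.
    have hle : ∀ i, ∫⁻ y, (J i).indicator
        (fun _ => ENNReal.ofReal (cc.osc i) + σ (cc.square i)) y ≤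
        2 * (ENNReal.ofReal (cc.osc i) ^ 2 + σ (cc.square i) ^ 2) := by
      intro i
      rw [lintegral_indicator (hJm i), setLIntegral_const]
      calc (ENNReal.ofReal (cc.osc i) + σ (cc.square i)) * volume (J i)
          ≤ (ENNReal.ofReal (cc.osc i) + σ (cc.square i)) * σ (cc.square i) := by gcongr; exact hJ i
        _ ≤ _ := by
          simp only [σ]
          have h1 := cc.osc_nonneg i
          have h2 : 0 ≤ diam (shadow φ D (cc.square i)) := diam_nonneg
          rw [← ENNReal.ofReal_add h1 h2, ← ENNReal.ofReal_mul (by positivity),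
            ← ENNReal.ofReal_pow h1, ← ENNReal.ofReal_pow h2,
            ← ENNReal.ofReal_add (by positivity) (by positivity), ← ENNReal.ofReal_ofNat 2,
            ← ENNReal.ofReal_mul (by norm_num)]
          apply ENNReal.ofReal_le_ofReal
          nlinarith [sq_nonneg (cc.osc i - diam (shadow φ D (cc.square i)))]
    refine ne_top_of_le_ne_top ?_ (ENNReal.tsum_le_tsum hle)
    rw [ENNReal.tsum_mul_left]
    exact ENNReal.mul_ne_top (by simp) (cc.tsum_lt_top σ hσ)
  filter_upwards [ae_lt_top (Measurable.tsum hmeas) hlt] with y hy using hy.ne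

/-- On almost every fibre of a projection, the boundary has length zero and is mapped by `F` to a
set of length zero. -/
theorem ae_volume_image_eq_zero (cc : CellCover W D F) (hF : Continuous F) {φ : ℂ → ℂ} (hφ : IsConformalFromDisk φ D)
    (hD : IsJordanDomain D) (hWD : ∀ Q ∈ W, Q ⊆ D)
    (hs : Summable fun Q : W => diam (shadow φ D (Q : Set ℂ)) ^ 2)
    {p : ℂ → ℝ} (hp : ∀ z w, |p z - p w| ≤ ‖z - w‖) :
    ∀ᵐ y : ℝ, ∀ ρ : ℂ → ℝ, (∀ z w, |ρ z - ρ w| ≤ ‖z - w‖) →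
      volume (ρ '' (frontier D ∩ p ⁻¹' {y})) = 0 ∧
      volume ((fun z => ρ (F z)) '' (frontier D ∩ p ⁻¹' {y})) = 0 := by
  have := cc.countable
  have hbd : Bornology.IsBounded (frontier D) :=
    hD.2.2.1.closure.subset frontier_subset_closure
  -- The exceptional set of lines depends on p and the cells only, so ρ may be chosen afterwards.
  filter_upwards [cc.ae_tsum_indicator_ne_top hbd hs hp] with y hy ρ hρ
  set J : cc.ι → Set ℝ := fun i => toMeasurable volume (p '' shadow φ D (cc.square i))
  set c : cc.ι → ENNReal := fun i => (J i).indicator (fun _ =>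
    ENNReal.ofReal (cc.osc i) + ENNReal.ofReal (diam (shadow φ D (cc.square i)))) y
  -- Both images are covered using only cells outside an arbitrary finite set, so their measures are
  -- bounded by a tail. The factor 2 is the ratio of the length of [mean - osc, mean + osc] to osc.
  have htail : Tendsto (fun s : Finset cc.ι => 2 * ∑' i : {i // i ∉ s}, c i) atTop (𝓝 0) := by
    have := ENNReal.Tendsto.const_mul (a := 2) (ENNReal.tendsto_tsum_compl_atTop_zero hy)
      (Or.inr (by simp))
    simpa using this
  have hyJ : ∀ i x, p x = y → x ∈ shadow φ D (cc.square i) → y ∈ J i := fun i x hx h =>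
    subset_toMeasurable _ _ ⟨x, h, hx⟩
  constructor
  · refine le_antisymm (ge_of_tendsto' htail fun s => ?_) zero_le
    have hsub : ρ '' (frontier D ∩ p ⁻¹' {y}) ⊆
        ⋃ i : {i // i ∉ s}, {t | y ∈ J i ∧ t ∈ ρ '' shadow φ D (cc.square i)} := by
      rintro _ ⟨x, ⟨hx, hxy⟩, rfl⟩
      obtain ⟨ζ, hζ, hlim⟩ := exists_radial_limit_of_mem_frontier hD hφ hx
      obtain ⟨X, hXD, -, hXx, hXs⟩ := cc.exists_radius_avoiding hφ hD.1 hWD hx hζ hlim s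
      obtain ⟨z, hz, -⟩ := hXx 1 one_pos
      obtain ⟨i, hi⟩ := cc.exists_mem_cell z (hXD hz)
      obtain ⟨his, hsh⟩ := hXs i ⟨z, hi, hz⟩
      exact mem_iUnion.2 ⟨⟨i, his⟩, hyJ i x hxy hsh, x, hsh, rfl⟩
    refine (measure_mono hsub).trans ((measure_iUnion_le _).trans ?_)
    rw [← ENNReal.tsum_mul_left]
    refine ENNReal.tsum_le_tsum fun i => ?_
    by_cases hyi : y ∈ J i
    · simp only [hyi, true_and, c, indicator_of_mem]
      refine (Real.volume_le_diam _).trans (ediam_le ?_)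
      rintro _ ⟨z, hz, rfl⟩ _ ⟨w, hw, rfl⟩
      rw [edist_dist, Real.dist_eq, two_mul]
      refine le_trans ?_ (le_trans le_add_self le_self_add)
      refine ENNReal.ofReal_le_ofReal ((hρ z w).trans ?_)
      rw [← dist_eq_norm]
      exact dist_le_diam_of_mem (hbd.subset fun u hu => hu.1) hz hw
    · simp [hyi]
  · refine le_antisymm (ge_of_tendsto' htail fun s => ?_) zero_le
    let I : cc.ι → Set ℝ := fun i =>
      {t | y ∈ J i ∧ t ∈ Icc (ρ (cc.mean i) - cc.osc i) (ρ (cc.mean i) + cc.osc i)}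
    let V : Set ℝ := ⋃ i : {i // i ∉ s}, I i
    have hsub : (fun z => ρ (F z)) '' (frontier D ∩ p ⁻¹' {y}) ⊆ V ∪
        ({t | t ∈ Vᶜ ∧ 𝓝[Vᶜ ∩ Ioi t] t = ⊥} ∪ {t | t ∈ Vᶜ ∧ 𝓝[Vᶜ ∩ Iio t] t = ⊥}) := by
      rintro _ ⟨x, ⟨hx, hxy⟩, rfl⟩
      refine cc.mem_union_isolated hF hφ hD hWD hρ hx s fun i his hsh t ht => ?_
      exact mem_iUnion.2 ⟨⟨i, his⟩, hyJ i x hxy hsh, ht⟩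
    refine (measure_mono hsub).trans ((measure_union_le _ _).trans ?_)
    rw [(countable_isolated Vᶜ).measure_zero, add_zero, ← ENNReal.tsum_mul_left]
    refine (measure_iUnion_le _).trans (ENNReal.tsum_le_tsum fun i => ?_)
    by_cases hyi : y ∈ J i
    · simp only [I, hyi, true_and, c, indicator_of_mem]
      have h0 := cc.osc_nonneg i
      change volume (Icc _ _) ≤ _
      rw [Real.volume_Icc]
      calc ENNReal.ofReal (ρ (cc.mean i) + cc.osc i - (ρ (cc.mean i) - cc.osc i))
          = 2 * ENNReal.ofReal (cc.osc i) := by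
            rw [← ENNReal.ofReal_ofNat 2, ← ENNReal.ofReal_mul (by norm_num)]
            congr 1; ring
        _ ≤ _ := by gcongr; exact le_self_add
    · simp [I, hyi]

end CellCover

/-! ### Restriction of weak derivatives to subdomains. -/

section Restriction

/-- Both integrands vanish off the support of the test function, so the integrals may be taken over
the plane; the set then matters only as a constraint on supports. -/
lemma IsWeakDeriv.eq_integral {f g : ℂ → ℂ} {v : ℂ} {Ω : Set ℂ} (h : IsWeakDeriv f g v Ω)
    {η : ℂ → ℝ} (hη : ContDiff ℝ ∞ η) (hηs : HasCompactSupport η) (hηΩ : tsupport η ⊆ Ω) :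
    ∫ z, (fderiv ℝ η z v) • f z = - ∫ z, η z • g z := by
  have := h η hη hηs hηΩ
  rwa [setIntegral_eq_integral_of_forall_compl_eq_zero,
    setIntegral_eq_integral_of_forall_compl_eq_zero] at this
  · intro z hz
    rw [image_eq_zero_of_notMem_tsupport fun h' => hz (hηΩ h'), zero_smul]
  · intro z hz
    rw [fderiv_of_notMem_tsupport (𝕜 := ℝ) fun h' => hz (hηΩ h')]
    simp

lemma isWeakDeriv_of_eq_integral {f g : ℂ → ℂ} {v : ℂ} {Ω : Set ℂ}
    (h : ∀ η : ℂ → ℝ, ContDiff ℝ ∞ η → HasCompactSupport η → tsupport η ⊆ Ω →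
      ∫ z, (fderiv ℝ η z v) • f z = - ∫ z, η z • g z) : IsWeakDeriv f g v Ω := by
  intro η hη hηs hηΩ
  rw [setIntegral_eq_integral_of_forall_compl_eq_zero,
    setIntegral_eq_integral_of_forall_compl_eq_zero]
  · exact h η hη hηs hηΩ
  · intro z hz
    rw [image_eq_zero_of_notMem_tsupport fun h' => hz (hηΩ h'), zero_smul]
  · intro z hz
    rw [fderiv_of_notMem_tsupport (𝕜 := ℝ) fun h' => hz (hηΩ h')]
    simp

lemma IsWeakDeriv.mono {f g : ℂ → ℂ} {v : ℂ} {Ω Ω' : Set ℂ} (h : IsWeakDeriv f g v Ω)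
    (hΩ : Ω' ⊆ Ω) : IsWeakDeriv f g v Ω' :=
  isWeakDeriv_of_eq_integral fun _ hη hηs hηΩ => h.eq_integral hη hηs (hηΩ.trans hΩ)

end Restriction

/-! ### Null boundary, and primitives across the boundary. -/

section Frontier

variable {D : Set ℂ} {φ : ℂ → ℂ} {W : Set (Set ℂ)}

lemma abs_re_sub_le (z w : ℂ) : |z.re - w.re| ≤ ‖z - w‖ := by
  simpa using Complex.abs_re_le_norm (z - w)

lemma abs_im_sub_le (z w : ℂ) : |z.im - w.im| ≤ ‖z - w‖ := by
  simpa using Complex.abs_im_le_norm (z - w)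

/-- The boundary of a Jordan domain with square summable shadows is a null set. -/
theorem IsWhitneyDecomposition.volume_frontier_eq_zero (hD : IsJordanDomain D)
    (hφ : IsConformalFromDisk φ D) (hW : IsWhitneyDecomposition W D)
    (hs : Summable fun Q : W => diam (shadow φ D (Q : Set ℂ)) ^ 2) :
    volume (frontier D) = 0 := by
  -- The cell cover of the zero function suffices, since only the length of ∂D on lines is needed
  -- here; Fubini then gives area zero.
  have h0 : ∀ v, IsWeakDeriv 0 0 v D := fun v η _ _ _ => by simp
  obtain ⟨cc⟩ := hW.nonempty_cellCover (F := 0) (g₁ := 0) (g₂ := 0) hD.1 continuous_zero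
    HasCompactSupport.zero (integrable_zero _ _ _) (integrable_zero _ _ _) MemLp.zero
    MemLp.zero (h0 _) (h0 _)
  have hWD : ∀ Q ∈ W, Q ⊆ D := fun Q hQ => hW.1 ▸ subset_sUnion_of_mem hQ
  have key := cc.ae_volume_image_eq_zero continuous_zero hφ hD hWD hs abs_im_sub_le
  have hm : MeasurableSet (frontier D) := isClosed_frontier.measurableSet
  rw [← lintegral_indicator_one hm, lintegral_eq_lintegral_lintegral_mk
    (h := (frontier D).indicator 1) ((measurable_one.indicator hm).aemeasurable), lintegral_eq_zero_iff']
  swap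
  · have h2 : Measurable fun p : ℝ × ℝ => (frontier D).indicator (1 : ℂ → ENNReal) ⟨p.2, p.1⟩ :=
      (measurable_one.indicator hm).comp (measurable_complex_mk.comp measurable_swap)
    exact h2.lintegral_prod_right'.aemeasurable
  filter_upwards [key] with y hy
  have h2 := (hy _ abs_re_sub_le).1
  have h3 : ∀ x : ℝ, (frontier D).indicator (1 : ℂ → ENNReal) ⟨x, y⟩ =
      ((fun x : ℝ => (⟨x, y⟩ : ℂ)) ⁻¹' frontier D).indicator 1 x := fun x => rfl
  simp_rw [h3]
  rw [lintegral_indicator_one (hm.preimage (continuous_mk_left y).measurable)]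
  refine measure_mono_null ?_ h2
  exact fun x hx => ⟨⟨x, y⟩, ⟨hx, rfl⟩, rfl⟩

/-- A continuous function is a primitive of its weak derivative off `∂D` on almost every
horizontal and almost every vertical line. -/
theorem IsWhitneyDecomposition.ae_sub_eq_intervalIntegral (hD : IsJordanDomain D)
    (hφ : IsConformalFromDisk φ D) (hW : IsWhitneyDecomposition W D)
    (hs : Summable fun Q : W => diam (shadow φ D (Q : Set ℂ)) ^ 2)
    {F g₁ g₂ : ℂ → ℂ} (hF : Continuous F) (hFs : HasCompactSupport F)
    (hg₁ : Integrable g₁) (hg₂ : Integrable g₂) (hg₁' : MemLp g₁ 2) (hg₂' : MemLp g₂ 2)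
    (h₁ : IsWeakDeriv F g₁ 1 (frontier D)ᶜ) (h₂ : IsWeakDeriv F g₂ Complex.I (frontier D)ᶜ) :
    (∀ᵐ y : ℝ, ∀ a b : ℝ, a ≤ b → F ⟨b, y⟩ - F ⟨a, y⟩ = ∫ x in a..b, g₁ ⟨x, y⟩) ∧
    (∀ᵐ x : ℝ, ∀ a b : ℝ, a ≤ b → F ⟨x, b⟩ - F ⟨x, a⟩ = ∫ y in a..b, g₂ ⟨x, y⟩) := by
  -- The image of ∂D is controlled by the gradient inside D. The gradient on the other side enters
  -- only through the segments that miss ∂D.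
  have hDE : D ⊆ (frontier D)ᶜ := fun z hz hz' => by
    rw [hD.1.frontier_eq] at hz'; exact hz'.2 hz
  obtain ⟨cc⟩ := hW.nonempty_cellCover hD.1 hF hFs hg₁ hg₂ hg₁' hg₂' (h₁.mono hDE) (h₂.mono hDE)
  have hWD : ∀ Q ∈ W, Q ⊆ D := fun Q hQ => hW.1 ▸ subset_sUnion_of_mem hQ
  have hE : IsClosed (frontier D) := isClosed_frontier
  constructor
  · filter_upwards [cc.ae_volume_image_eq_zero hF hφ hD hWD hs abs_im_sub_le,
      h₁.ae_sub_eq_intervalIntegral hE.isOpen_compl hF hFs hg₁, ae_integrable_mk hg₁]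
      with y hy hline hint a b hab
    have hsec : ∀ x : ℝ, x ∈ (fun x : ℝ => (⟨x, y⟩ : ℂ)) ⁻¹' frontier D →
      (⟨x, y⟩ : ℂ) ∈ frontier D ∩ Complex.im ⁻¹' {y} := fun x hx => ⟨hx, rfl⟩
    refine sub_eq_intervalIntegral_of_volume_image_eq_zero' (F := fun x => F ⟨x, y⟩)
      (g := fun x => g₁ ⟨x, y⟩) (hF.comp (continuous_mk_left y)) hint.locallyIntegrable
      (hE.preimage (continuous_mk_left y)) ?_ ?_ ?_ ?_ hab
    · refine measure_mono_null ?_ (hy _ abs_re_sub_le).1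
      exact fun x hx => ⟨⟨x, y⟩, hsec x hx, rfl⟩
    · refine measure_mono_null ?_ (hy _ abs_re_sub_le).2
      rintro _ ⟨x, hx, rfl⟩
      exact ⟨⟨x, y⟩, hsec x hx, rfl⟩
    · refine measure_mono_null ?_ (hy _ abs_im_sub_le).2
      rintro _ ⟨x, hx, rfl⟩
      exact ⟨⟨x, y⟩, hsec x hx, rfl⟩
    · exact fun c d hcd hdis => hline c d hcd fun x hx hx' => disjoint_left.1 hdis hx hx'
  · filter_upwards [cc.ae_volume_image_eq_zero hF hφ hD hWD hs abs_re_sub_le,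
      h₂.ae_sub_eq_intervalIntegral_vertical hE.isOpen_compl hF hFs hg₂,
      ae_integrable_mk (integrable_comp_swapReIm hg₂)]
      with y hy hline hint a b hab
    have hsec : ∀ x : ℝ, x ∈ (fun x : ℝ => (⟨y, x⟩ : ℂ)) ⁻¹' frontier D →
      (⟨y, x⟩ : ℂ) ∈ frontier D ∩ Complex.re ⁻¹' {y} := fun x hx => ⟨hx, rfl⟩
    simp only [Function.comp_apply, swapReIm_mk] at hint
    refine sub_eq_intervalIntegral_of_volume_image_eq_zero' (F := fun x => F ⟨y, x⟩)
      (g := fun x => g₂ ⟨y, x⟩) (hF.comp (continuous_mk_right y)) hint.locallyIntegrable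
      (hE.preimage (continuous_mk_right y)) ?_ ?_ ?_ ?_ hab
    · refine measure_mono_null ?_ (hy _ abs_im_sub_le).1
      exact fun x hx => ⟨⟨y, x⟩, hsec x hx, rfl⟩
    · refine measure_mono_null ?_ (hy _ abs_re_sub_le).2
      rintro _ ⟨x, hx, rfl⟩
      exact ⟨⟨y, x⟩, hsec x hx, rfl⟩
    · refine measure_mono_null ?_ (hy _ abs_im_sub_le).2
      rintro _ ⟨x, hx, rfl⟩
      exact ⟨⟨y, x⟩, hsec x hx, rfl⟩
    · exact fun c d hcd hdis => hline c d hcd fun x hx hx' => disjoint_left.1 hdis hx hx'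

end Frontier

/-! ### From primitives on lines back to weak derivatives. -/

section IntegrationByParts

/-- A primitive of an integrable function is absolutely continuous with derivative G almost
everywhere. Integration by parts applies on an interval containing the support of u, and the
boundary terms vanish. -/
lemma integral_deriv_mul_eq_neg_of_sub_eq_intervalIntegral {u q G : ℝ → ℝ} (hu : ContDiff ℝ 1 u)
    (hus : HasCompactSupport u) (hG : Integrable G)
    (h : ∀ a b, a ≤ b → q b - q a = ∫ x in a..b, G x) :
    ∫ x, deriv u x * q x = - ∫ x, u x * G x := by
  obtain ⟨R, hR0, hR⟩ : ∃ R : ℝ, 0 < R ∧ ∀ x, x ∉ Ioo (-R) R → x ∉ tsupport u := by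
    obtain ⟨R, hR0, hR⟩ := hus.isBounded.subset_ball_lt 0 (0 : ℝ)
    refine ⟨R, hR0, fun x hx hx' => hx ?_⟩
    have := hR hx'
    rwa [Real.ball_eq_Ioo, zero_sub, zero_add] at this
  have hRR : -R ≤ R := by linarith
  have hint : ∀ c d, IntervalIntegrable G volume c d := fun c d => hG.intervalIntegrable
  have hq : q = fun x => q (-R) + ∫ t in (-R)..x, G t := by
    funext x
    rcases le_total (-R) x with hx | hx
    · rw [← h _ _ hx]; ring
    · rw [intervalIntegral.integral_symm, ← h _ _ hx]; ring
  have hqac : AbsolutelyContinuousOnInterval q (-R) R := by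
    rw [hq]
    exact (contDiffOn_const (n := 1)).absolutelyContinuousOnInterval.add
      ((hint (-R) R).absolutelyContinuousOnInterval_intervalIntegral (by simp [hR0.le]))
  have huac : AbsolutelyContinuousOnInterval u (-R) R :=
    hu.contDiffOn.absolutelyContinuousOnInterval
  have h0 : ∀ x, x ∉ Ioo (-R) R → u x = 0 := fun x hx =>
    image_eq_zero_of_notMem_tsupport (hR x hx)
  have h0' : ∀ x, x ∉ Ioo (-R) R → deriv u x = 0 := fun x hx => by
    by_contra hne
    exact hR x hx (support_deriv_subset hne)
  have hIBP := huac.integral_mul_deriv_eq_deriv_mul hqac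
  rw [h0 R (by simp), h0 (-R) (by simp)] at hIBP
  have hder : ∀ᵐ x, deriv q x = G x := by
    filter_upwards [LocallyIntegrable.ae_hasDerivAt_integral hG.locallyIntegrable] with x hx
    have := (hx (-R)).const_add (q (-R))
    rw [← hq] at this
    exact this.deriv
  have e1 : ∫ x in (-R)..R, u x * deriv q x = ∫ x, u x * G x := by
    rw [intervalIntegral.integral_of_le hRR,
      setIntegral_eq_integral_of_forall_compl_eq_zero fun x hx => by
        rw [h0 x fun h' => hx (Ioo_subset_Ioc_self h'), zero_mul]]
    refine integral_congr_ae ?_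
    filter_upwards [hder] with x hx
    rw [hx]
  have e2 : ∫ x in (-R)..R, deriv u x * q x = ∫ x, deriv u x * q x := by
    rw [intervalIntegral.integral_of_le hRR,
      setIntegral_eq_integral_of_forall_compl_eq_zero fun x hx => by
        rw [h0' x fun h' => hx (Ioo_subset_Ioc_self h'), zero_mul]]
  rw [e1, e2] at hIBP
  linarith

lemma integral_deriv_smul_eq_neg_of_sub_eq_intervalIntegral {u : ℝ → ℝ} {q G : ℝ → ℂ}
    (hu : ContDiff ℝ 1 u) (hus : HasCompactSupport u) (hq : Continuous q) (hG : Integrable G)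
    (h : ∀ a b, a ≤ b → q b - q a = ∫ x in a..b, G x) :
    ∫ x, deriv u x • q x = - ∫ x, u x • G x := by
  have hi1 : Integrable fun x => deriv u x • q x :=
    ((hu.continuous_deriv le_rfl).smul hq).integrable_of_hasCompactSupport hus.deriv.smul_right
  have hi2 : Integrable fun x => u x • G x := by
    obtain ⟨M, hM⟩ := hu.continuous.bounded_above_of_compact_support hus
    exact hG.bdd_smul M hu.continuous.aestronglyMeasurable (Eventually.of_forall hM)
  have hint : ∀ c d, IntervalIntegrable G volume c d := fun c d => hG.intervalIntegrable
  have aux : ∀ L : ℂ →L[ℝ] ℝ, L (∫ x, deriv u x • q x) = L (- ∫ x, u x • G x) := fun L => by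
    rw [map_neg, ← L.integral_comp_comm hi1, ← L.integral_comp_comm hi2]
    simp only [map_smul, smul_eq_mul]
    refine integral_deriv_mul_eq_neg_of_sub_eq_intervalIntegral hu hus (L.integrable_comp hG)
      fun a b hab => ?_
    rw [← map_sub, h a b hab, L.intervalIntegral_comp_comm (hint a b)]
  exact Complex.ext (aux Complex.reCLM) (aux Complex.imCLM)

/-- Integration by parts on almost every line, integrated over the lines by Fubini. -/
theorem isWeakDeriv_of_ae_sub_eq_intervalIntegral {F g : ℂ → ℂ} {Ω : Set ℂ} (hF : Continuous F)
    (hg : Integrable g)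
    (h : ∀ᵐ y : ℝ, ∀ a b : ℝ, a ≤ b → F ⟨b, y⟩ - F ⟨a, y⟩ = ∫ x in a..b, g ⟨x, y⟩) :
    IsWeakDeriv F g 1 Ω := by
  refine isWeakDeriv_of_eq_integral fun η hη hηs _ => ?_
  have hi1 : Integrable fun z => (fderiv ℝ η z 1) • F z :=
    (((hη.continuous_fderiv (by simp)).clm_apply continuous_const).smul
      hF).integrable_of_hasCompactSupport ((hηs.fderiv_apply (𝕜 := ℝ) 1).smul_right)
  have hi2 : Integrable fun z => η z • g z := by
    obtain ⟨M, hM⟩ := hη.continuous.bounded_above_of_compact_support hηs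
    exact hg.bdd_smul M hη.continuous.aestronglyMeasurable (Eventually.of_forall hM)
  rw [integral_eq_integral_integral_mk hi1, integral_eq_integral_integral_mk hi2, ← integral_neg]
  refine integral_congr_ae ?_
  filter_upwards [h, ae_integrable_mk hg] with y hy hgy
  have hmk : ∀ x : ℝ, HasDerivAt (fun x : ℝ => (⟨x, y⟩ : ℂ)) 1 x := fun x => by
    have h1 : HasDerivAt (fun x : ℝ => (x : ℂ) + y * Complex.I) 1 x :=
      Complex.ofRealCLM.hasDerivAt.add_const _
    convert h1 using 2 with x
    exact Complex.mk_eq_add_mul_I _ _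
  have hcd : ContDiff ℝ 1 fun x : ℝ => η ⟨x, y⟩ := by
    have h1 : ContDiff ℝ 1 fun x : ℝ => (x : ℂ) + y * Complex.I :=
      Complex.ofRealCLM.contDiff.add contDiff_const
    have h2 := (hη.of_le (by simp) : ContDiff ℝ 1 η).comp h1
    convert h2 using 2 with x
    simp [Complex.mk_eq_add_mul_I]
  have hcs : HasCompactSupport fun x : ℝ => η ⟨x, y⟩ := by
    refine HasCompactSupport.intro (hηs.image Complex.continuous_re) fun x hx => ?_
    by_contra hne
    exact hx ⟨⟨x, y⟩, subset_tsupport _ hne, rfl⟩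
  have hder : ∀ x : ℝ, deriv (fun x : ℝ => η ⟨x, y⟩) x = fderiv ℝ η ⟨x, y⟩ 1 := fun x =>
    ((hη.differentiable (by simp) _).hasFDerivAt.comp_hasDerivAt x (hmk x)).deriv
  have := integral_deriv_smul_eq_neg_of_sub_eq_intervalIntegral (q := fun x => F ⟨x, y⟩)
    (G := fun x => g ⟨x, y⟩) hcd hcs (hF.comp (continuous_mk_left y)) hgy hy
  simpa only [hder] using this

theorem isWeakDeriv_of_ae_sub_eq_intervalIntegral_vertical {F g : ℂ → ℂ} {Ω : Set ℂ}
    (hF : Continuous F) (hg : Integrable g)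
    (h : ∀ᵐ x : ℝ, ∀ a b : ℝ, a ≤ b → F ⟨x, b⟩ - F ⟨x, a⟩ = ∫ y in a..b, g ⟨x, y⟩) :
    IsWeakDeriv F g Complex.I Ω := by
  have h1 : IsWeakDeriv (F ∘ swapReIm) (g ∘ swapReIm) (swapReIm Complex.I) univ := by
    rw [swapReIm_I]
    refine isWeakDeriv_of_ae_sub_eq_intervalIntegral (hF.comp swapReIm.continuous)
      (integrable_comp_swapReIm hg) ?_
    simpa using h
  have h2 := (h1.comp_linearIsometryEquiv swapReIm).mono (subset_univ Ω)
  have e : ∀ k : ℂ → ℂ, (k ∘ swapReIm) ∘ swapReIm = k := fun k => by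
    funext z; simp
  rwa [e, e] at h2

end IntegrationByParts

/-! ### Absolute continuity on lines. -/

section AbsolutelyContinuous

/-- This is the absolute continuity of the integral of |G|. One integrable G for the whole line
makes δ uniform over all segments in S. -/
lemma absContOn_of_sub_eq_intervalIntegral {h G : ℝ → ℂ} {S : Set ℝ} (hG : Integrable G)
    (H : ∀ a b, a ≤ b → Icc a b ⊆ S → h b - h a = ∫ x in a..b, G x) : AbsContOn h S := by
  intro ε hε
  obtain ⟨δ, hδ, hδG⟩ := exists_pos_setLIntegral_lt_of_measure_lt (μ := volume)
    (f := fun x => ‖G x‖ₑ) hG.2.ne (ε := ENNReal.ofReal ε) (by simpa using hε)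
  obtain ⟨δ', hδ'0, hδ'⟩ := ENNReal.lt_iff_exists_nnreal_btwn.1 hδ
  refine ⟨δ', by exact_mod_cast hδ'0, fun n a b hab hS hdis hsum => ?_⟩
  have hterm : ∀ i, ENNReal.ofReal ‖h (b i) - h (a i)‖ ≤ ∫⁻ x in Ioo (a i) (b i), ‖G x‖ₑ := by
    intro i
    rw [ofReal_norm, H _ _ (hab i) (hS i), intervalIntegral.integral_of_le (hab i),
      integral_Ioc_eq_integral_Ioo]
    exact enorm_integral_le_lintegral_enorm _
  have hvol : volume (⋃ i, Ioo (a i) (b i)) < δ := by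
    refine ((measure_iUnion_fintype_le _ _).trans ?_).trans_lt hδ'
    simp only [Real.volume_Ioo]
    rw [← ENNReal.ofReal_sum_of_nonneg fun i _ => sub_nonneg.2 (hab i)]
    exact (ENNReal.ofReal_le_ofReal hsum.le).trans (by simp)
  have hfin : ENNReal.ofReal (∑ i, ‖h (b i) - h (a i)‖) < ENNReal.ofReal ε := by
    rw [ENNReal.ofReal_sum_of_nonneg fun i _ => norm_nonneg _]
    refine (Finset.sum_le_sum fun i _ => hterm i).trans_lt ?_
    refine lt_of_eq_of_lt ?_ (hδG _ hvol)
    rw [lintegral_iUnion (fun i => measurableSet_Ioo) hdis, tsum_fintype]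
  exact (ENNReal.ofReal_lt_ofReal_iff hε).1 hfin

end AbsolutelyContinuous

/-! ### Cutoff functions and exhaustion of U. -/

section Localization

variable {f g : ℂ → ℂ} {U E : Set ℂ}

lemma exists_contDiff_cutoff {K : Set ℂ} (hK : IsCompact K) (hU : IsOpen U) (hKU : K ⊆ U) :
    ∃ χ : ℂ → ℝ, ContDiff ℝ ∞ χ ∧ HasCompactSupport χ ∧ tsupport χ ⊆ U ∧
      ∀ᶠ z in 𝓝ˢ K, χ z = 1 := by
  obtain ⟨L, hL, hKL, hLU⟩ := exists_compact_between hK hU hKU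
  obtain ⟨χ, h1, h0, -⟩ := exists_contMDiffMap_one_nhds_of_subset_interior (n := (⊤ : ℕ∞))
    (modelWithCornersSelf ℝ ℂ) hK.isClosed hKL
  exact ⟨χ, χ.contMDiff.contDiff, HasCompactSupport.intro hL h0,
    (closure_minimal (fun z hz => by by_contra h; exact hz (h0 z h)) hL.isClosed).trans hLU, h1⟩

lemma continuous_smul_of_tsupport_subset {χ : ℂ → ℝ} (hχ : Continuous χ) (hU : IsOpen U)
    (hχU : tsupport χ ⊆ U) (hf : ContinuousOn f U) : Continuous fun z => χ z • f z := by
  refine continuous_of_tsupport fun z hz => ?_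
  have hzU : z ∈ U := hχU (tsupport_smul_subset_left χ f hz)
  exact hχ.continuousAt.smul (hf.continuousAt (hU.mem_nhds hzU))

lemma tsupport_fderiv_apply_subset_self (χ : ℂ → ℝ) (v : ℂ) :
    tsupport (fun z => fderiv ℝ χ z v) ⊆ tsupport χ :=
  tsupport_fderiv_apply_subset ℝ v

/-- The product rule for a weak derivative and a cutoff function. -/
lemma IsWeakDeriv.smul_cutoff {v : ℂ} {χ : ℂ → ℝ} (hχ : ContDiff ℝ ∞ χ) (hU : IsOpen U) (hχU : tsupport χ ⊆ U) (hf : ContinuousOn f U)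
    (hg : Integrable g) (h : IsWeakDeriv f g v (U \ E)) :
    IsWeakDeriv (fun z => χ z • f z) (fun z => χ z • g z + (fderiv ℝ χ z v) • f z) v Eᶜ := by
  refine isWeakDeriv_of_eq_integral fun η hη hηs hηE => ?_
  have hdχ : Continuous fun z => fderiv ℝ χ z v :=
    (hχ.continuous_fderiv (by simp)).clm_apply continuous_const
  have hdη : Continuous fun z => fderiv ℝ η z v :=
    (hη.continuous_fderiv (by simp)).clm_apply continuous_const
  have hχf : Continuous fun z => χ z • f z :=
    continuous_smul_of_tsupport_subset hχ.continuous hU hχU hf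
  have hdχf : Continuous fun z => (fderiv ℝ χ z v) • f z :=
    continuous_smul_of_tsupport_subset hdχ hU
      ((tsupport_fderiv_apply_subset_self χ v).trans hχU) hf
  -- The product ηχ is an admissible test function for f: χ keeps its support in U, and η keeps it
  -- off E.
  have key := h.eq_integral (η := fun z => η z * χ z) (hη.mul hχ) hηs.mul_right
    (fun z hz => ⟨hχU (tsupport_mul_subset_right hz), hηE (tsupport_mul_subset_left hz)⟩)
  have hfd : ∀ z, fderiv ℝ (fun z => η z * χ z) z v = η z * fderiv ℝ χ z v + fderiv ℝ η z v * χ z :=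
    fun z => by
      rw [fderiv_fun_mul (hη.differentiable (by simp) z) (hχ.differentiable (by simp) z)]
      simp [mul_comm]
  have e1 : ∀ z, (fderiv ℝ (fun z => η z * χ z) z v) • f z =
      η z • ((fderiv ℝ χ z v) • f z) + (fderiv ℝ η z v) • (χ z • f z) := fun z => by
    rw [hfd, add_smul, mul_smul, mul_smul]
  have i1 : Integrable fun z => η z • ((fderiv ℝ χ z v) • f z) :=
    (hη.continuous.smul hdχf).integrable_of_hasCompactSupport hηs.smul_right
  have i2 : Integrable fun z => (fderiv ℝ η z v) • (χ z • f z) :=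
    (hdη.smul hχf).integrable_of_hasCompactSupport (hηs.fderiv_apply (𝕜 := ℝ) v).smul_right
  have i3 : Integrable fun z => η z • (χ z • g z) := by
    obtain ⟨M, hM⟩ := (hη.continuous.mul hχ.continuous).bounded_above_of_compact_support
      (hηs.mul_right)
    have := hg.bdd_smul M (hη.continuous.mul hχ.continuous).aestronglyMeasurable
      (Eventually.of_forall hM)
    exact this.congr (Eventually.of_forall fun z => mul_smul (η z) (χ z) (g z))
  simp_rw [e1, mul_smul] at key
  rw [integral_add i1 i2] at key
  simp_rw [smul_add]
  rw [integral_add i3 i1, eq_neg_iff_add_eq_zero]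
  rw [eq_neg_iff_add_eq_zero] at key
  rw [← key]
  ring

/-- On a set of finite area L² is contained in L¹. Integrability is needed for Fubini on lines. -/
lemma integrable_of_memLp_two (hg : MemLp g 2) (hU : Bornology.IsBounded U)
    (h0 : ∀ z ∉ U, g z = 0) : Integrable g := by
  have h1 : IntegrableOn g U := by
    have : IsFiniteMeasure (volume.restrict U) := ⟨by simpa using hU.measure_lt_top⟩
    exact (hg.restrict U).integrable (by norm_num)
  exact (integrableOn_iff_integrable_of_support_subset fun z hz => by
    by_contra h; exact hz (h0 z h)).1 h1

/-- The points at distance at least `1 / (n + 1)` from the complement of `U`. -/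
def innerSet (U : Set ℂ) (n : ℕ) : Set ℂ := {z | 1 / ((n : ℝ) + 1) ≤ infDist z Uᶜ}

lemma innerSet_subset (U : Set ℂ) (n : ℕ) : innerSet U n ⊆ U := fun z hz => by
  by_contra h
  have : infDist z Uᶜ = 0 := infDist_zero_of_mem h
  simp only [innerSet, mem_ofPred_eq, this] at hz
  exact absurd hz (not_le.2 (by positivity))

lemma isCompact_innerSet (hU : Bornology.IsBounded U) (n : ℕ) : IsCompact (innerSet U n) :=
  isCompact_of_isClosed_isBounded
    (isClosed_le continuous_const (continuous_infDist_pt _)) (hU.subset (innerSet_subset U n))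

lemma exists_subset_innerSet (hU : IsOpen U) (hUb : Bornology.IsBounded U) {K : Set ℂ}
    (hK : IsCompact K) (hKU : K ⊆ U) : ∃ n, K ⊆ innerSet U n := by
  -- The distance to an empty complement would be 0 by convention and the inner sets would be empty;
  -- boundedness of U rules this out.
  have hne : (Uᶜ).Nonempty := by
    rw [nonempty_compl]
    rintro rfl
    exact NormedSpace.unbounded_univ ℝ ℂ hUb
  obtain ⟨δ, hδ, hδU⟩ := hK.exists_cthickening_subset_open hU hKU
  obtain ⟨n, hn⟩ := exists_nat_one_div_lt hδ
  refine ⟨n, fun z hz => hn.le.trans ((le_infDist hne).2 fun w hw => ?_)⟩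
  by_contra h
  refine hw (hδU (mem_cthickening_of_dist_le w z δ K hz ?_))
  rw [dist_comm]
  exact (not_le.1 h).le

end Localization

/-! ### Removability of the boundary. -/

section Removability

variable {D U : Set ℂ} {φ : ℂ → ℂ} {W : Set (Set ℂ)}

/-- A continuous function on `U` with square integrable weak gradient off `∂D` is, near any compact
subset of `U`, a primitive of its gradient on almost every line. -/
lemma IsWhitneyDecomposition.exists_primitive_near_isCompact (hD : IsJordanDomain D)
    (hφ : IsConformalFromDisk φ D) (hW : IsWhitneyDecomposition W D)
    (hs : Summable fun Q : W => diam (shadow φ D (Q : Set ℂ)) ^ 2) (hU : IsOpen U)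
    {f g₁ g₂ : ℂ → ℂ} (hf : ContinuousOn f U)
    (hg₁ : Integrable g₁) (hg₂ : Integrable g₂) (hg₁' : MemLp g₁ 2) (hg₂' : MemLp g₂ 2)
    (h₁ : IsWeakDeriv f g₁ 1 (U \ frontier D))
    (h₂ : IsWeakDeriv f g₂ Complex.I (U \ frontier D))
    {K : Set ℂ} (hK : IsCompact K) (hKU : K ⊆ U) :
    ∃ F G₁ G₂ : ℂ → ℂ, Continuous F ∧ Integrable G₁ ∧ Integrable G₂ ∧
      (∀ z ∈ K, F z = f z ∧ G₁ z = g₁ z ∧ G₂ z = g₂ z) ∧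
      (∀ᵐ y : ℝ, ∀ a b : ℝ, a ≤ b → F ⟨b, y⟩ - F ⟨a, y⟩ = ∫ x in a..b, G₁ ⟨x, y⟩) ∧
      (∀ᵐ x : ℝ, ∀ a b : ℝ, a ≤ b → F ⟨x, b⟩ - F ⟨x, a⟩ = ∫ y in a..b, G₂ ⟨x, y⟩) := by
  obtain ⟨χ, hχ, hχs, hχU, hχ1⟩ := exists_contDiff_cutoff hK hU hKU
  obtain ⟨M, hM⟩ := hχ.continuous.bounded_above_of_compact_support hχs
  have hdχf : ∀ v, Continuous fun z => (fderiv ℝ χ z v) • f z := fun v =>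
    continuous_smul_of_tsupport_subset
      ((hχ.continuous_fderiv (by simp)).clm_apply continuous_const) hU
      ((tsupport_fderiv_apply_subset_self χ v).trans hχU) hf
  have hdχs : ∀ v, HasCompactSupport fun z => (fderiv ℝ χ z v) • f z := fun v =>
    (hχs.fderiv_apply (𝕜 := ℝ) v).smul_right
  have hint : ∀ g : ℂ → ℂ, Integrable g → ∀ v,
      Integrable fun z => χ z • g z + (fderiv ℝ χ z v) • f z := fun g hg v =>
    (hg.bdd_smul M hχ.continuous.aestronglyMeasurable (Eventually.of_forall hM)).add
      ((hdχf v).integrable_of_hasCompactSupport (hdχs v))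
  have hmem : ∀ g : ℂ → ℂ, MemLp g 2 → ∀ v,
      MemLp (fun z => χ z • g z + (fderiv ℝ χ z v) • f z) 2 := fun g hg v => by
    refine MemLp.add (f := fun z => χ z • g z) ?_ ((hdχf v).memLp_of_hasCompactSupport (hdχs v))
    refine (hg.const_mul (M : ℂ)).mono
      (hχ.continuous.aestronglyMeasurable.smul hg.aestronglyMeasurable)
      (Eventually.of_forall fun z => ?_)
    rw [norm_smul, norm_mul]
    refine mul_le_mul_of_nonneg_right ((hM z).trans ?_) (norm_nonneg _)
    simpa using le_abs_self M
  have hF : Continuous fun z => χ z • f z :=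
    continuous_smul_of_tsupport_subset hχ.continuous hU hχU hf
  obtain ⟨l₁, l₂⟩ := hW.ae_sub_eq_intervalIntegral hD hφ hs hF hχs.smul_right (hint g₁ hg₁ 1)
    (hint g₂ hg₂ Complex.I) (hmem g₁ hg₁' 1) (hmem g₂ hg₂' Complex.I)
    (h₁.smul_cutoff hχ hU hχU hf hg₁) (h₂.smul_cutoff hχ hU hχU hf hg₂)
  refine ⟨_, _, _, hF, hint g₁ hg₁ 1, hint g₂ hg₂ Complex.I, fun z hz => ?_, l₁, l₂⟩
  -- The cutoff is 1 near K, not merely on K, so the term with its derivative vanishes there.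
  have hz1 : χ =ᶠ[𝓝 z] fun _ => 1 := (eventually_nhdsSet_iff_forall.1 hχ1) z hz
  have hz0 : fderiv ℝ χ z = 0 := by rw [hz1.fderiv_eq]; simp
  simp [hz1.eq_of_nhds, hz0]

/-- A continuous function whose weak gradient off `∂D` is square integrable has the same weak
gradient across `∂D`, and it is absolutely continuous on almost every line. -/
theorem IsWhitneyDecomposition.isWeakDeriv_and_isACL (hD : IsJordanDomain D)
    (hφ : IsConformalFromDisk φ D) (hW : IsWhitneyDecomposition W D)
    (hs : Summable fun Q : W => diam (shadow φ D (Q : Set ℂ)) ^ 2) (hU : IsOpen U)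
    (hUb : Bornology.IsBounded U) {f g₁ g₂ : ℂ → ℂ} (hf : ContinuousOn f U)
    (hg₁ : Integrable g₁) (hg₂ : Integrable g₂) (hg₁' : MemLp g₁ 2) (hg₂' : MemLp g₂ 2)
    (h₁ : IsWeakDeriv f g₁ 1 (U \ frontier D))
    (h₂ : IsWeakDeriv f g₂ Complex.I (U \ frontier D)) :
    IsWeakDeriv f g₁ 1 U ∧ IsWeakDeriv f g₂ Complex.I U ∧ IsACL f U := by
  choose F G₁ G₂ hF hG₁ hG₂ heq hl₁ hl₂ using fun n =>
    hW.exists_primitive_near_isCompact hD hφ hs hU hf hg₁ hg₂ hg₁' hg₂' h₁ h₂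
      (isCompact_innerSet hUb n) (innerSet_subset U n)
  -- The support of a test function lies in one of the inner sets, where f and g coincide with the
  -- global functions F n and G n.
  have transfer : ∀ (v : ℂ) (g : ℂ → ℂ) (G : ℕ → ℂ → ℂ),
      (∀ n, ∀ z ∈ innerSet U n, G n z = g z) → (∀ n, IsWeakDeriv (F n) (G n) v univ) →
      IsWeakDeriv f g v U := by
    intro v g G hGg hw
    refine isWeakDeriv_of_eq_integral fun η hη hηs hηU => ?_
    obtain ⟨n, hn⟩ := exists_subset_innerSet hU hUb hηs hηU
    have e1 : ∀ z, (fderiv ℝ η z v) • f z = (fderiv ℝ η z v) • F n z := fun z => by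
      by_cases hz : z ∈ tsupport η
      · rw [(heq n z (hn hz)).1]
      · rw [fderiv_of_notMem_tsupport (𝕜 := ℝ) hz]; simp
    have e2 : ∀ z, η z • g z = η z • G n z := fun z => by
      by_cases hz : z ∈ tsupport η
      · rw [hGg n z (hn hz)]
      · rw [image_eq_zero_of_notMem_tsupport hz, zero_smul, zero_smul]
    simp_rw [e1, e2]
    exact (hw n).eq_integral hη hηs (subset_univ _)
  refine ⟨transfer 1 g₁ G₁ (fun n z hz => (heq n z hz).2.1) fun n =>
      isWeakDeriv_of_ae_sub_eq_intervalIntegral (hF n) (hG₁ n) (hl₁ n),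
    transfer Complex.I g₂ G₂ (fun n z hz => (heq n z hz).2.2) fun n =>
      isWeakDeriv_of_ae_sub_eq_intervalIntegral_vertical (hF n) (hG₂ n) (hl₂ n), ?_, ?_⟩
  -- The index n depends on the segment, but the primitive identity holds for all n on the same
  -- line, and on the segment the integrand is always g₁. This gives absolute continuity up to the
  -- boundary of U.
  · filter_upwards [ae_all_iff.2 hl₁, ae_integrable_mk hg₁] with y hy hgy
    refine absContOn_of_sub_eq_intervalIntegral (G := fun x => g₁ ⟨x, y⟩) hgy fun a b hab hS => ?_
    obtain ⟨n, hn⟩ := exists_subset_innerSet hU hUb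
      (isCompact_Icc.image (continuous_mk_left y) (s := Icc a b)) (image_subset_iff.2 hS)
    have hn' : ∀ x ∈ Icc a b, (⟨x, y⟩ : ℂ) ∈ innerSet U n := fun x hx => hn ⟨x, hx, rfl⟩
    rw [← (heq n _ (hn' a ⟨le_rfl, hab⟩)).1, ← (heq n _ (hn' b ⟨hab, le_rfl⟩)).1, hy n a b hab]
    refine intervalIntegral.integral_congr fun x hx => ?_
    rw [uIcc_of_le hab] at hx
    exact (heq n _ (hn' x hx)).2.1
  · filter_upwards [ae_all_iff.2 hl₂, ae_integrable_mk (integrable_comp_swapReIm hg₂)] with x hx hgx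
    simp only [Function.comp_apply, swapReIm_mk] at hgx
    refine absContOn_of_sub_eq_intervalIntegral (G := fun y => g₂ ⟨x, y⟩) hgx fun a b hab hS => ?_
    obtain ⟨n, hn⟩ := exists_subset_innerSet hU hUb
      (isCompact_Icc.image (continuous_mk_right x) (s := Icc a b)) (image_subset_iff.2 hS)
    have hn' : ∀ y ∈ Icc a b, (⟨x, y⟩ : ℂ) ∈ innerSet U n := fun y hy => hn ⟨y, hy, rfl⟩
    rw [← (heq n _ (hn' a ⟨le_rfl, hab⟩)).1, ← (heq n _ (hn' b ⟨hab, le_rfl⟩)).1, hx n a b hab]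
    refine intervalIntegral.integral_congr fun y hy => ?_
    rw [uIcc_of_le hab] at hy
    exact (heq n _ (hn' y hy)).2.2

theorem IsWhitneyDecomposition.hasL2WeakGradient_and_isACL (hD : IsJordanDomain D)
    (hφ : IsConformalFromDisk φ D) (hW : IsWhitneyDecomposition W D)
    (hs : Summable fun Q : W => diam (shadow φ D (Q : Set ℂ)) ^ 2) (hU : IsOpen U)
    (hUb : Bornology.IsBounded U) {K : Set ℂ} (hK : K ⊆ frontier D) {f : ℂ → ℂ}
    (hf : ContinuousOn f U) (h : HasL2WeakGradient f (U \ K)) :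
    HasL2WeakGradient f U ∧ IsACL f U := by
  obtain ⟨-, g₁, g₂, hg₁, hg₂, h₁, h₂⟩ := h
  have hm : MeasurableSet (U \ frontier D) := hU.measurableSet.diff isClosed_frontier.measurableSet
  have hsub : U \ frontier D ⊆ U \ K := sdiff_subset_sdiff_right hK
  -- The gradient is cut down to U \ ∂D and extended by zero; these extensions turn out to be the
  -- weak derivatives on all of U.
  have hmem : ∀ g : ℂ → ℂ, MemLp g 2 (volume.restrict (U \ K)) →
      MemLp ((U \ frontier D).indicator g) 2 := fun g hg =>
    (memLp_indicator_iff_restrict hm).2 (hg.mono_measure (Measure.restrict_mono_set _ hsub))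
  have hint : ∀ g : ℂ → ℂ, MemLp g 2 (volume.restrict (U \ K)) →
      Integrable ((U \ frontier D).indicator g) := fun g hg =>
    integrable_of_memLp_two (hmem g hg) hUb
      fun z hz => indicator_of_notMem (fun h => hz h.1) _
  have hind : ∀ (g : ℂ → ℂ) (v : ℂ), IsWeakDeriv f g v (U \ K) →
      IsWeakDeriv f ((U \ frontier D).indicator g) v (U \ frontier D) := fun g v hw => by
    intro η hη hηs hηU
    rw [hw.mono hsub η hη hηs hηU]
    congr 1
    exact setIntegral_congr_fun hm fun z hz => by simp only [indicator_of_mem hz]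
  obtain ⟨w₁, w₂, hacl⟩ := hW.isWeakDeriv_and_isACL hD hφ hs hU hUb hf (hint g₁ hg₁) (hint g₂ hg₂)
    (hmem g₁ hg₁) (hmem g₂ hg₂) (hind g₁ _ h₁) (hind g₂ _ h₂)
  exact ⟨⟨hf.locallyIntegrableOn hU.measurableSet, _, _, (hmem g₁ hg₁).restrict U,
    (hmem g₂ hg₂).restrict U, w₁, w₂⟩, hacl⟩

lemma exitArc_subset {γ : ℝ → ℂ} {I : Set ℝ} {T : Set ℂ} {t : ℝ} : exitArc γ I T t ⊆ γ '' I :=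
  image_mono fun _ h => h.1

end Removability

end Auxiliary

theorem mainTheorem9
    (D : Set ℂ) (hD : IsJordanDomain D)
    (φ : ℂ → ℂ) (hφ : IsConformalFromDisk φ D)
    (W : Set (Set ℂ)) (hW : IsWhitneyDecomposition W D)
    (hs : Summable fun Q : W => Metric.diam (shadow φ D (Q : Set ℂ)) ^ 2)
    (U : Set ℂ) (hUo : IsOpen U) (hUc : IsConnected U) (hUb : Bornology.IsBounded U)
    (γ : ℝ → ℂ) (I : Set ℝ) (hγ : ParameterizesJordanCurve γ I (frontier D))
    (t : ℝ) (htI : t ∈ I) (htU : γ t ∈ U)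
    (f : ℂ → ℂ) (hf : ContinuousOn f U) :
    (MemW12 f (U \ exitArc γ I U t) → MemW12 f U ∧ IsACL f U) ∧
    (HasL2WeakGradient f (U \ exitArc γ I U t) → HasL2WeakGradient f U ∧ IsACL f U) := by
  have hK : exitArc γ I U t ⊆ frontier D := exitArc_subset.trans hγ.2.2.2.1.subset
  have key := fun h => hW.hasL2WeakGradient_and_isACL hD hφ hs hUo hUb hK hf h
  refine ⟨fun h => ?_, key⟩
  obtain ⟨h1, h2⟩ := key h.2
  refine ⟨⟨?_, h1⟩, h2⟩
  -- As the arc is a null set, square integrability of f itself on U \ K and on U is the same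
  -- condition.
  have hnull : MeasureTheory.volume (exitArc γ I U t) = 0 :=
    MeasureTheory.measure_mono_null hK (hW.volume_frontier_eq_zero hD hφ hs)
  have := h.1
  rwa [MeasureTheory.Measure.restrict_congr_set (MeasureTheory.sdiff_null_ae_eq_self hnull)] at this
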